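/- Let $p\neq 2$ be a prime, $K$ a finite extension of $\mathbb{Q}_p$ with ring of integers $\mathcal{O}_K$, uniformizer $\varpi$, residue field $\mathbb{F}=\mathbb{F}_q$, and let $\bar{\mathbb{F}}$ be an algebraic closure of $\mathbb{F}$. Put $G=\mathrm{GL}_2(K)$, $G^\circ=\mathrm{GL}_2(\mathcal{O}_K)$, $I\subset G^\circ$ the Iwahori subgroup of matrices that are upper triangular modulo $\varpi$, $[G]_2=\{g\in G: v_K(\det g)\in 2\mathbb{Z}\}$ and $w=\begin{pmatrix}0&1\\ \varpi&0\end{pmatrix}$. Let $\bar{\mathbb{H}}$ be the special fibre over $\bar{\mathbb{F}}$ of the standard semistable formal model of the Drinfeld upper half plane of $K$: its irreducible components are projective lines $\mathbb{P}_s$ indexed by the vertices $s$ of the Bruhat–Tits tree, and $\mathbb{P}_s$, $\mathbb{P}_{s'}$ meet, in an ordinary double point, exactly when $s,s'$ are adjacent. Let $s_1=[\mathcal{O}_K^2]$ and $s_0=[\mathcal{O}_K\times\varpi\mathcal{O}_K]=ws_1$. Let $\bar{\mathscr{L}}$ be a $[G]_2$-equivariant line bundle on $\bar{\mathbb{H}}$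 with data $(1,r,k_0,k_1)$, $r\in\mathbb{Z}/(q-1)$, $k_0,k_1\in\mathbb{Z}$: this means that $\bar{\mathscr{L}}|_{\mathbb{P}_{s_0}}$ has degree $k_0$ and that $\bar{\mathscr{L}}|_{\mathbb{P}_{s_1}}\cong{\det}^r\otimes\mathcal{O}(k_1)$ as $G^\circ\varpi^{\mathbb{Z}}$-equivariant line bundles ($\varpi$ acting trivially, $G^\circ$ through $\mathrm{GL}_2(\mathbb{F})$, and $\mathcal{O}(n)$ normalized by $H^0(\mathbb{P}_{s_1},\mathcal{O}(n))=\mathrm{Sym}^n\bar{\mathbb{F}}^2$ for $n\ge0$). (Such data always satisfy $(q-1)\mid k_0+k_1$.) Put $r_1=r$ and $r_0=r+k_1$; indices $i$ are taken modulo $2$. Let $\mathrm{Ind}$ be full induction (no support condition). For $n\geq 0$ let $\sigma^{(1)}_{n,m}=\mathrm{Ind}_{G^\circ\varpi^{\mathbb{Z}}}^{[G]_2}(\mathrm{Sym}^n\bar{\mathbb{F}}^2\otimes{\det}^m)$ and $\tau^{(1)}_{n,m}=\mathrm{Ind}_{G^\circ\varpi^{\mathbb{Z}}}^{[G]_2}((\mathrm{Sym}^n\bar{\mathbb{F}}^2)^\vee\otimes{\det}^m)$,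 where $\varpi$ acts trivially on the inducing representations and $G^\circ$ acts through $\mathrm{GL}_2(\mathbb{F})$; let $\sigma^{(0)}_{n,m}$, $\tau^{(0)}_{n,m}$ be the inductions from $wG^\circ w^{-1}\varpi^{\mathbb{Z}}$ of the same representations conjugated by $w$, i.e. composed with $h\mapsto w^{-1}hw$. For $n<0$ all four are $0$. Let $I(m,n)=\mathrm{Ind}_{I\varpi^{\mathbb{Z}}}^{[G]_2}\mu_{m,n}$, where $\mu_{m,n}$ is trivial on $\varpi$ and sends $\begin{pmatrix}a&b\\c&d\end{pmatrix}\in I$ to $\bar a^m\bar d^n$. There are $[G]_2$-equivariant maps $f_i:\sigma^{(i)}_{k_i,r_i}\to I(r_1,r_0)$ ($i=0,1$) given by $\varphi\mapsto(g\mapsto\varphi(g)(0,1))$, elements of $\mathrm{Sym}^n\bar{\mathbb{F}}^2$ being viewed as homogeneous polynomials of degree $n$ in the standard basis $(z_0,z_1)$ of $\bar{\mathbb{F}}^2$. The following hold; all maps are $[G]_2$-equivariant and $\bar{\mathbb{F}}$-linear. 1. If $k_0,k_1\ge q+1$, there is an exact sequence $0\to\sigma^{(0)}_{k_0-q-1,1+r_0}\oplus\sigma^{(1)}_{k_1-q-1,1+r_1}\to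 H^0(\bar{\mathbb{H}},\bar{\mathscr{L}})\to I(r_1,r_0)\to0$. 2. If $0\le k_0,k_1\le q$, then $f_0,f_1$ are injective, and $H^0(\bar{\mathbb{H}},\bar{\mathscr{L}})\cong\mathrm{im}(f_0)\cap\mathrm{im}(f_1)=\sigma^{(0)}_{k_0,r_0}\cap\sigma^{(1)}_{k_1,r_1}\subset I(r_1,r_0)$, and $H^0(\bar{\mathbb{H}},\bar{\mathscr{L}})^\vee\cong I(r_1,r_0)^\vee/(\ker f_0^\vee+\ker f_1^\vee)$. The last isomorphism holds both when $^\vee$ is the topological dual (for the topology of pointwise convergence, that is the topology induced by a product of discrete spaces; so $I(m,n)^\vee$ is a compact induction) and when $^\vee$ is the full linear dual. 3. If $0\le k_i\le q$ and $k_{i+1}\ge q+1$ for some $i$, there is an exact sequence $0\to\sigma^{(i+1)}_{k_{i+1}-q-1,1+r_{i+1}}\to H^0(\bar{\mathbb{H}},\bar{\mathscr{L}})\to\sigma^{(i)}_{k_i,r_i}\to0$. 4. If $k_0,k_1\le-1$, there is an exact sequence $0\to I(r_1,r_0)\to H^1(\bar{\mathbb{H}},\bar{\mathscr{L}})\to\tau^{(0)}_{-2-k_0,r_0-1}\oplus\tau^{(1)}_{-2-k_1,r_1-1}\to0$.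 5. If $k_i\le-1$ and $-1\le k_{i+1}\le q$ for some $i$, then $f_{i+1}$ is injective and there is an exact sequence $0\to I(r_1,r_0)/\sigma^{(i+1)}_{k_{i+1},r_{i+1}}\to H^1(\bar{\mathbb{H}},\bar{\mathscr{L}})\to\tau^{(i)}_{-2-k_i,r_i-1}\to0$, where $\sigma^{(i+1)}_{k_{i+1},r_{i+1}}$ is embedded by $f_{i+1}$. 6. If $k_i\le-1$ and $k_{i+1}\ge q+1$ for some $i$, then $H^0(\bar{\mathbb{H}},\bar{\mathscr{L}})\cong\sigma^{(i+1)}_{k_{i+1}-q-1,1+r_{i+1}}$ and $H^1(\bar{\mathbb{H}},\bar{\mathscr{L}})\cong\tau^{(i)}_{-2-k_i,r_i-1}$. -/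

import Mathlib

open ValuativeRel
open scoped MatrixGroups LinearAlgebra.Projectivization

namespace Drinfeld

noncomputable section

/-! ### The projective line over `k`, as a classical variety -/

section ProjectiveLine

variable (k : Type*) [Field k]

/-- Homogeneous coordinates: nonzero vectors `z = (z₀, z₁)` of `k²`. -/
abbrev Coord := {z : Fin 2 → k // z ≠ 0}

/-- The (closed points of the) projective line over `k`. -/
def P1 := ℙ k (Fin 2 → k)

variable {k}

/-- The point `[z₀ : z₁]`. -/
def Coord.pt (z : Coord k) : P1 k := Projectivization.mk k z.1 z.2

/-- The coordinates `(0, 1)`. -/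
def nodeCoord : Coord k := ⟨![0, 1], fun h => one_ne_zero (congrFun h 1)⟩

/-- Change of coordinates by `A ∈ GL₂(k)`: `z ↦ Aᵀ z`, i.e. `zⱼ ↦ ∑ᵢ Aᵢⱼ zᵢ`. -/
def Coord.change (A : GL (Fin 2) k) (z : Coord k) : Coord k :=
  ⟨A.1.transpose.mulVec z.1, fun h => z.2 (by
    have hdet : A.1.transpose.det ≠ 0 := by
      rw [Matrix.det_transpose]
      exact (Matrix.isUnit_iff_isUnit_det _).1 A.isUnit |>.ne_zero
    exact Matrix.eq_zero_of_mulVec_eq_zero hdet h)⟩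

/-- The nonvanishing locus `D(Q)` of a polynomial `Q`, on homogeneous coordinates. -/
def nonvanishing (Q : MvPolynomial (Fin 2) k) : Set (P1 k) :=
  {p | ∃ z : Coord k, z.pt = p ∧ MvPolynomial.eval z.1 Q ≠ 0}

/-- The Zariski topology, generated by the `D(Q)` for `Q` homogeneous. -/
instance : TopologicalSpace (P1 k) :=
  TopologicalSpace.generateFrom
    {U | ∃ (n : ℕ) (Q : MvPolynomial (Fin 2) k), Q.IsHomogeneous n ∧ U = nonvanishing Q}

/-- `IsTwistRegular n V F`: the function `F` of the homogeneous coordinates is a section of the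
Serre twist `𝒪(n)` on the open set `V` of the projective line, i.e. around each point of `V` it is
a quotient `P / Q` of homogeneous polynomials with `deg P = deg Q + n`. -/
def IsTwistRegular (n : ℤ) (V : Set (P1 k)) (F : Coord k → k) : Prop :=
  ∀ z : Coord k, z.pt ∈ V →
    ∃ (a b : ℕ) (P Q : MvPolynomial (Fin 2) k),
      P.IsHomogeneous a ∧ Q.IsHomogeneous b ∧ (a : ℤ) = b + n ∧ MvPolynomial.eval z.1 Q ≠ 0 ∧
      ∀ z' : Coord k, z'.pt ∈ V → MvPolynomial.eval z'.1 Q ≠ 0 →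
        F z' * MvPolynomial.eval z'.1 Q = MvPolynomial.eval z'.1 P

/-- Regular functions on an open set `V` of the projective line. -/
def IsRegularP1 (V : Set (P1 k)) (f : P1 k → k) : Prop :=
  IsTwistRegular 0 V fun z => f z.pt

/-- The fibre of `𝒪(n)` at a point `p`: functions of the homogeneous coordinates of `p` that are
homogeneous of degree `n`. -/
def twistFiber (n : ℤ) (p : P1 k) : Submodule k ({z : Coord k // z.pt = p} → k) where
  carrier := {u | ∀ (z z' : {z : Coord k // z.pt = p}) (c : k), z'.1.1 = c • z.1.1 →
    u z' = c ^ n * u z}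
  add_mem' hu hv z z' c h := by
    simp only [Pi.add_apply, hu z z' c h, hv z z' c h, mul_add]
  zero_mem' z z' c h := by simp
  smul_mem' a u hu z z' c h := by
    simp only [Pi.smul_apply, smul_eq_mul, hu z z' c h]; ring

lemma IsTwistRegular.mono {n : ℤ} {V V' : Set (P1 k)} {F : Coord k → k} (hV : V' ⊆ V)
    (h : IsTwistRegular n V F) : IsTwistRegular n V' F := by
  intro z hz
  obtain ⟨a, b, P, Q, hP, hQ, hab, h0, hF⟩ := h z (hV hz)
  exact ⟨a, b, P, Q, hP, hQ, hab, h0, fun z' hz' => hF z' (hV hz')⟩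

lemma IsTwistRegular.add {n : ℤ} {V : Set (P1 k)} {F F' : Coord k → k}
    (h : IsTwistRegular n V F) (h' : IsTwistRegular n V F') :
    IsTwistRegular n V (fun z => F z + F' z) := by
  intro z hz
  obtain ⟨a, b, P, Q, hP, hQ, hab, h0, hF⟩ := h z hz
  obtain ⟨a', b', P', Q', hP', hQ', hab', h0', hF'⟩ := h' z hz
  refine ⟨a + b', b + b', P * Q' + P' * Q, Q * Q', ?_, hQ.mul hQ', by push_cast; omega, ?_, ?_⟩
  · have e : a + b' = a' + b := by omega
    exact (hP.mul hQ').add (e ▸ hP'.mul hQ)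
  · simpa using ⟨h0, h0'⟩
  · intro z' hz' hne
    rw [map_mul] at hne
    have e := hF z' hz' (left_ne_zero_of_mul hne)
    have e' := hF' z' hz' (right_ne_zero_of_mul hne)
    simp only [map_mul, map_add]
    rw [← e, ← e']; ring

lemma IsTwistRegular.const_mul {n : ℤ} {V : Set (P1 k)} {F : Coord k → k} (c : k)
    (h : IsTwistRegular n V F) : IsTwistRegular n V (fun z => c * F z) := by
  intro z hz
  obtain ⟨a, b, P, Q, hP, hQ, hab, h0, hF⟩ := h z hz
  refine ⟨a, b, MvPolynomial.C c * P, Q, ?_, hQ, hab, h0, fun z' hz' hne => ?_⟩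
  · simpa using (MvPolynomial.isHomogeneous_C (Fin 2) c).mul hP
  · rw [map_mul, MvPolynomial.eval_C, ← hF z' hz' hne]; ring

lemma isRegularP1_zero (V : Set (P1 k)) : IsRegularP1 V (fun _ => 0) := fun z _ =>
  ⟨0, 0, 0, 1, MvPolynomial.isHomogeneous_zero _ _ _, MvPolynomial.isHomogeneous_one _ _,
    by simp, by simp, by simp⟩

end ProjectiveLine

/-! ### The groups `GL₂(K)`, `[G]₂`, `G°`, `I` -/

section Groups

variable {K : Type*} [Field K] [ValuativeRel K]

variable (K) in
/-- Uniformizers of `K`. -/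
abbrev Uniformizer := {π : 𝒪[K] // Irreducible π}

/-- A uniformizer as a unit of `K`. -/
def Uniformizer.unit (ϖ : Uniformizer K) : Kˣ :=
  Units.mk0 (ϖ.1 : K) fun h => ϖ.2.ne_zero (Subtype.ext h)

/-- The inclusion `GL₂(𝒪_K) → GL₂(K)`. -/
def emb : GL (Fin 2) 𝒪[K] →* GL (Fin 2) K :=
  Matrix.GeneralLinearGroup.map (algebraMap 𝒪[K] K)

variable (k : Type*) [Field k]

/-- The reduction map `𝒪_K → k`, where `k` is an algebra over the residue field. -/
def redHom [Algebra 𝓀[K] k] : 𝒪[K] →+* k :=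
  (algebraMap 𝓀[K] k).comp (IsLocalRing.residue 𝒪[K])

/-- The reduction map `GL₂(𝒪_K) → GL₂(k)`. -/
def red [Algebra 𝓀[K] k] : GL (Fin 2) 𝒪[K] →* GL (Fin 2) k :=
  Matrix.GeneralLinearGroup.map (redHom k)

variable (ϖ : Uniformizer K)

/-- The matrix `w = (0, 1; ϖ, 0)`. -/
def wMat : GL (Fin 2) K :=
  Matrix.GeneralLinearGroup.mkOfDetNeZero !![0, 1; (ϖ.unit : K), 0] (by
    simp [Matrix.det_fin_two])

/-- The group `[G]₂` of the `g ∈ GL₂(K)` with `v(det g)` even, i.e. `det g ∈ ϖ^{2ℤ} 𝒪_K^×`. -/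
def evenGroup : Subgroup (GL (Fin 2) K) :=
  (Subgroup.zpowers (ϖ.unit ^ 2) ⊔
    (Units.map (algebraMap 𝒪[K] K).toMonoidHom).range).comap Matrix.GeneralLinearGroup.det

/-- The group `G° × ϖ^ℤ`. -/
abbrev MaxCompactMod (K : Type*) [Field K] [ValuativeRel K] :=
  GL (Fin 2) 𝒪[K] × Multiplicative ℤ

/-- The element carrying the standard vertex `s₁ = [𝒪_K²]` to `s_i` : `w` for `i = 0`,
`1` for `i = 1`. -/
def toVertex (i : Fin 2) : GL (Fin 2) K := if i = 0 then wMat ϖ else 1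

lemma mem_evenGroup_aux (i : Fin 2) (x : MaxCompactMod K) :
    toVertex ϖ i * emb x.1 * (toVertex ϖ i)⁻¹ *
      Matrix.GeneralLinearGroup.scalar (Fin 2) (ϖ.unit ^ x.2.toAdd) ∈ evenGroup ϖ := by
  rw [evenGroup, Subgroup.mem_comap]
  have e : Matrix.GeneralLinearGroup.det (toVertex ϖ i * emb x.1 * (toVertex ϖ i)⁻¹ *
      Matrix.GeneralLinearGroup.scalar (Fin 2) (ϖ.unit ^ x.2.toAdd)) =
      (ϖ.unit ^ 2) ^ x.2.toAdd * Matrix.GeneralLinearGroup.det (emb x.1) := by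
    rw [map_mul, map_mul, map_mul, map_inv, Matrix.GeneralLinearGroup.det_scalar,
      mul_comm (Matrix.GeneralLinearGroup.det (toVertex ϖ i)), mul_inv_cancel_right, mul_comm]
    congr 1
    rw [Fintype.card_fin, ← zpow_natCast, ← zpow_mul, ← zpow_natCast, ← zpow_mul, mul_comm]
  rw [e]
  refine Subgroup.mul_mem_sup (Subgroup.mem_zpowers_iff.2 ⟨_, rfl⟩)
    ⟨Matrix.GeneralLinearGroup.det x.1, ?_⟩
  ext
  exact RingHom.map_det (algebraMap 𝒪[K] K) x.1.1

/-- The stabilizer in `[G]₂` of the vertex `s_i`: the injective homomorphism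
`(h, n) ↦ w^{1-i} h w^{i-1} ϖⁿ` from `G° × ϖ^ℤ` to `[G]₂`. Its image is `G°ϖ^ℤ` for `i = 1` and
`w G° w⁻¹ ϖ^ℤ` for `i = 0`. -/
def stabHom (i : Fin 2) : MaxCompactMod K →* evenGroup ϖ where
  toFun x := ⟨_, mem_evenGroup_aux ϖ i x⟩
  map_one' := by ext1; simp
  map_mul' x y := by
    ext1
    have hs := Matrix.GeneralLinearGroup.scalar_commute (n := Fin 2) (ϖ.unit ^ x.2.toAdd)
      (toVertex ϖ i * emb y.1 * (toVertex ϖ i)⁻¹)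
    simp only [Prod.fst_mul, Prod.snd_mul, map_mul, toAdd_mul, zpow_add, Subgroup.coe_mul]
    calc _ = (toVertex ϖ i * emb x.1 * (toVertex ϖ i)⁻¹) *
          ((toVertex ϖ i * emb y.1 * (toVertex ϖ i)⁻¹) *
          Matrix.GeneralLinearGroup.scalar (Fin 2) (ϖ.unit ^ x.2.toAdd)) *
          Matrix.GeneralLinearGroup.scalar (Fin 2) (ϖ.unit ^ y.2.toAdd) := by group
      _ = _ := by rw [← hs]; group

/-- The Iwahori subgroup `I` of `GL₂(𝒪_K)`: matrices whose reduction is upper triangular. -/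
def iwahori (K : Type*) [Field K] [ValuativeRel K] : Subgroup (GL (Fin 2) 𝒪[K]) where
  carrier := {h | h.1 1 0 ∈ 𝓂[K]}
  one_mem' := by simp
  mul_mem' {a b} ha hb := by
    simp only [Set.mem_ofPred_eq, Units.val_mul, Matrix.mul_apply, Fin.sum_univ_two] at *
    exact add_mem (Ideal.mul_mem_right _ _ ha) (Ideal.mul_mem_left _ _ hb)
  inv_mem' {a} ha := by
    simp only [Set.mem_ofPred_eq, Matrix.coe_units_inv, Matrix.inv_def, Matrix.adjugate_fin_two,
      Matrix.smul_apply, Matrix.of_apply, Matrix.cons_val_one, Matrix.cons_val_zero,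
      smul_eq_mul] at *
    exact Ideal.mul_mem_left _ _ (neg_mem ha)

end Groups

/-! ### The special fibre `H̄` of the semistable model of the Drinfeld upper half plane -/

section SpecialFibre

variable {K : Type*} [Field K] [ValuativeRel K] (ϖ : Uniformizer K)
variable (k : Type*) [Field k] [Algebra 𝓀[K] k]

/-- The identifications defining the special fibre from the disjoint union of projective lines
indexed by `g ∈ GL₂(K)`. In `(g, [z₀ : z₁])`, the pair `(z₀, z₁)` stands for the values on the
basis `g e₁, g e₂` of a nonzero linear form on the reduction of the lattice `g 𝒪_K²`.
* The projective line only depends on the homothety class of the lattice `g 𝒪_K²`, up to a linear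
  change of coordinates (`coord`, `homothety`).
* For each edge of the Bruhat-Tits tree, i.e. two adjacent lattices `g w 𝒪_K² ⊂ g 𝒪_K²`, the point
  of the first line given by the forms that kill `g w 𝒪_K²`
  is glued to the point of the second line given by the forms
  that kill `ϖ g 𝒪_K²`; both have coordinates `[0 : 1]` (`node`). -/
inductive Glue : GL (Fin 2) K × P1 k → GL (Fin 2) K × P1 k → Prop
  | coord (g : GL (Fin 2) K) (h : GL (Fin 2) 𝒪[K]) (z : Coord k) :
      Glue (g, z.pt) (g * emb h, (z.change (red k h)).pt)
  | homothety (g : GL (Fin 2) K) (c : Kˣ) (p : P1 k) :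
      Glue (g, p) (g * Matrix.GeneralLinearGroup.scalar (Fin 2) c, p)
  | node (g : GL (Fin 2) K) :
      Glue (g, nodeCoord.pt) (g * wMat ϖ, nodeCoord.pt)

/-- The (closed points of the) special fibre `H̄` over the algebraically closed field `k`: a tree of
projective lines indexed by the vertices of the Bruhat-Tits tree of `GL₂(K)`, two lines meeting
transversally in a rational point when the vertices are adjacent. -/
def HBar := Quot (Glue ϖ k)

variable {k}

/-- The parametrization of the component of the vertex `[g 𝒪_K²]` by the projective line. -/
def chart (g : GL (Fin 2) K) (p : P1 k) : HBar ϖ k := Quot.mk _ (g, p)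

variable {ϖ}

/-- The action of `GL₂(K)` on `H̄`. -/
instance : MulAction (GL (Fin 2) K) (HBar ϖ k) where
  smul g := Quot.map (fun x => (g * x.1, x.2)) (by
    rintro _ _ (⟨g', h, z⟩ | ⟨g', c, p⟩ | ⟨g'⟩)
    · simpa only [mul_assoc] using Glue.coord (ϖ := ϖ) (g * g') h z
    · simpa only [mul_assoc] using Glue.homothety (ϖ := ϖ) (g * g') c p
    · simpa only [mul_assoc] using Glue.node (ϖ := ϖ) (k := k) (g * g'))
  one_smul := by
    rintro ⟨g, p⟩
    exact congrArg (Quot.mk _) (by simp)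
  mul_smul a b := by
    rintro ⟨g, p⟩
    exact congrArg (Quot.mk _) (by simp [mul_assoc])

lemma smul_chart (g g' : GL (Fin 2) K) (p : P1 k) :
    g • chart ϖ g' p = chart ϖ (g * g') p := rfl

/-- The Zariski topology of `H̄`: a set is open iff its trace on each component is open (the
components form a locally finite closed covering). -/
instance : TopologicalSpace (HBar ϖ k) :=
  ⨆ g : GL (Fin 2) K, TopologicalSpace.coinduced (chart ϖ g) inferInstance

lemma isOpen_iff (U : Set (HBar ϖ k)) :
    IsOpen U ↔ ∀ g : GL (Fin 2) K, IsOpen (chart ϖ g ⁻¹' U) := by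
  rw [isOpen_iSup_iff]
  simp only [isOpen_coinduced]

lemma isOpen_preimage_smul (g : GL (Fin 2) K) {U : Set (HBar ϖ k)} (hU : IsOpen U) :
    IsOpen ((fun x => g • x) ⁻¹' U) := by
  rw [isOpen_iff] at hU ⊢
  exact fun g' => hU (g * g')

/-- The structure sheaf of `H̄`. The singularities being ordinary double points, a function on
an open set `U` is regular iff its restriction to each component is regular. -/
def IsRegularOn (U : Set (HBar ϖ k)) (f : HBar ϖ k → k) : Prop :=
  ∀ g : GL (Fin 2) K, IsRegularP1 (chart ϖ g ⁻¹' U) (fun p => f (chart ϖ g p))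

end SpecialFibre

/-! ### Equivariant line bundles and their cohomology -/

section LineBundles

universe v

variable {K : Type*} [Field K] [ValuativeRel K] (ϖ : Uniformizer K)
variable (k : Type*) [Field k] [Algebra 𝓀[K] k]

/-- A line bundle on `H̄`: a family of lines with regular transition functions between local frames
(`frame x` is a frame on the neighbourhood `base x` of `x`; its values elsewhere are irrelevant). -/
structure LineBundle where
  fiber : HBar ϖ k → Type v
  [addCommGroup : ∀ x, AddCommGroup (fiber x)]
  [module : ∀ x, Module k (fiber x)]
  base : HBar ϖ k → Set (HBar ϖ k)
  isOpen_base : ∀ x, IsOpen (base x)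
  mem_base : ∀ x, x ∈ base x
  frame : HBar ϖ k → ∀ y, fiber y
  exists_unique_coeff : ∀ x, ∀ y ∈ base x, ∀ v : fiber y, ∃! c : k, v = c • frame x y
  transition : ∀ x x', ∃ c : HBar ϖ k → k, IsRegularOn (base x ∩ base x') c ∧
    ∀ y ∈ base x ∩ base x', frame x' y = c y • frame x y

attribute [instance] LineBundle.addCommGroup LineBundle.module

variable {ϖ k}

namespace LineBundle

variable (L : LineBundle.{v} ϖ k)

/-- Regular sections on an open set `U`: the coefficient in each frame is regular. (A section on `U`
is represented by a family of vectors over all of `H̄`; only its values on `U` matter.) -/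
def IsRegular (U : Set (HBar ϖ k)) (s : ∀ x, L.fiber x) : Prop :=
  ∀ x, ∃ f : HBar ϖ k → k, IsRegularOn (U ∩ L.base x) f ∧
    ∀ y ∈ U ∩ L.base x, s y = f y • L.frame x y

/-- Regularity of a section near the point `x`. -/
def IsRegularAt (s : ∀ x, L.fiber x) (x : HBar ϖ k) : Prop :=
  ∃ U : Set (HBar ϖ k), IsOpen U ∧ x ∈ U ∧ L.IsRegular U s

/-- Regular sections, on an open set `V` of the projective line, of the restriction (pull-back)
of `L` to the component of the vertex `[g 𝒪_K²]`. -/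
def IsRegularOnComponent (g : GL (Fin 2) K) (V : Set (P1 k))
    (t : ∀ p, L.fiber (chart ϖ g p)) : Prop :=
  ∀ x, ∃ f : P1 k → k, IsRegularP1 (V ∩ chart ϖ g ⁻¹' L.base x) f ∧
    ∀ p ∈ V ∩ chart ϖ g ⁻¹' L.base x, t p = f p • L.frame x (chart ϖ g p)

/-- An isomorphism from the restriction of `L` to the component of the vertex `[g 𝒪_K²]` to
the line bundle `𝒪(n)`. -/
structure ComponentIso (g : GL (Fin 2) K) (n : ℤ) where
  fiberEquiv : ∀ p, L.fiber (chart ϖ g p) ≃ₗ[k] twistFiber n p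
  isRegular_iff : ∀ (V : Set (P1 k)), IsOpen V → ∀ t : ∀ p, L.fiber (chart ϖ g p),
    L.IsRegularOnComponent g V t ↔
      IsTwistRegular n V fun z => (fiberEquiv z.pt (t z.pt)).1 ⟨z, rfl⟩

/-- The image, under an isomorphism with `𝒪(n)`, of (the restriction of) a section of `L`,
as a function of the homogeneous coordinates. -/
def ComponentIso.coeff {L : LineBundle.{v} ϖ k} {g : GL (Fin 2) K} {n : ℤ}
    (θ : L.ComponentIso g n) (s : ∀ x, L.fiber x) (z : Coord k) : k :=
  (θ.fiberEquiv z.pt (s (chart ϖ g z.pt))).1 ⟨z, rfl⟩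

variable {L}

lemma IsRegular.mono {U U' : Set (HBar ϖ k)} {s : ∀ x, L.fiber x} (hU : U' ⊆ U)
    (h : L.IsRegular U s) : L.IsRegular U' s := by
  intro x
  obtain ⟨f, hf, hs⟩ := h x
  exact ⟨f, fun g => (hf g).mono (Set.preimage_mono (Set.inter_subset_inter_left _ hU)),
    fun y hy => hs y ⟨hU hy.1, hy.2⟩⟩

lemma IsRegular.zero (U : Set (HBar ϖ k)) : L.IsRegular U 0 := fun x =>
  ⟨fun _ => 0, fun _ => isRegularP1_zero _, fun y _ => by simp⟩

lemma IsRegular.add {U : Set (HBar ϖ k)} {s t : ∀ x, L.fiber x}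
    (hs : L.IsRegular U s) (ht : L.IsRegular U t) : L.IsRegular U (s + t) := by
  intro x
  obtain ⟨f, hf, hs⟩ := hs x
  obtain ⟨f', hf', ht⟩ := ht x
  exact ⟨fun y => f y + f' y, fun g => IsTwistRegular.add (hf g) (hf' g), fun y hy => by
    rw [Pi.add_apply, hs y hy, ht y hy, add_smul]⟩

lemma IsRegular.smul {U : Set (HBar ϖ k)} {s : ∀ x, L.fiber x} (c : k)
    (hs : L.IsRegular U s) : L.IsRegular U (c • s) := by
  intro x
  obtain ⟨f, hf, hs⟩ := hs x
  exact ⟨fun y => c * f y, fun g => IsTwistRegular.const_mul c (hf g), fun y hy => by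
    rw [Pi.smul_apply, hs y hy, mul_smul]⟩

lemma IsRegularAt.zero (x : HBar ϖ k) : L.IsRegularAt 0 x :=
  ⟨Set.univ, isOpen_univ, trivial, IsRegular.zero _⟩

lemma IsRegularAt.add {s t : ∀ x, L.fiber x} {x : HBar ϖ k}
    (hs : L.IsRegularAt s x) (ht : L.IsRegularAt t x) : L.IsRegularAt (s + t) x := by
  obtain ⟨U, hU, hx, hs⟩ := hs
  obtain ⟨U', hU', hx', ht⟩ := ht
  exact ⟨U ∩ U', hU.inter hU', ⟨hx, hx'⟩,
    (hs.mono Set.inter_subset_left).add (ht.mono Set.inter_subset_right)⟩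

lemma IsRegularAt.smul {s : ∀ x, L.fiber x} {x : HBar ϖ k} (c : k)
    (hs : L.IsRegularAt s x) : L.IsRegularAt (c • s) x := by
  obtain ⟨U, hU, hx, hs⟩ := hs
  exact ⟨U, hU, hx, hs.smul c⟩

variable (L)

/-- The space `H⁰(H̄, L)` of global sections. -/
def H0 : Submodule k (∀ x, L.fiber x) where
  carrier := {s | L.IsRegular Set.univ s}
  add_mem' hs ht := hs.add ht
  zero_mem' := IsRegular.zero _
  smul_mem' c _ hs := hs.smul c

/-- Let `𝒟` be the flasque sheaf of all (not necessarily regular) sections of the family of lines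
`L`; it contains the sheaf of regular sections `ℒ`. A global section of `𝒟 / ℒ` is represented
by a family `d`, where `d x` is a section of `𝒟` representing it near `x`: the condition is that
`d y` and `d x` have the same class in the stalk `(𝒟 / ℒ)_y` for `y` near `x`. -/
def quotientSections : Submodule k (HBar ϖ k → ∀ y, L.fiber y) where
  carrier := {d | ∀ x, ∃ U : Set (HBar ϖ k), IsOpen U ∧ x ∈ U ∧
    ∀ y ∈ U, L.IsRegularAt (d y - d x) y}
  add_mem' {d d'} hd hd' x := by
    obtain ⟨U, hU, hx, h⟩ := hd x
    obtain ⟨U', hU', hx', h'⟩ := hd' x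
    refine ⟨U ∩ U', hU.inter hU', ⟨hx, hx'⟩, fun y hy => ?_⟩
    simpa only [Pi.add_apply, add_sub_add_comm] using (h y hy.1).add (h' y hy.2)
  zero_mem' x := ⟨Set.univ, isOpen_univ, trivial, fun y _ => by
    simpa using IsRegularAt.zero y⟩
  smul_mem' c d hd x := by
    obtain ⟨U, hU, hx, h⟩ := hd x
    refine ⟨U, hU, hx, fun y hy => ?_⟩
    simpa only [Pi.smul_apply, smul_sub] using (h y hy).smul c

/-- The families `d` whose class in `Γ(H̄, 𝒟 / ℒ)` is the image of a global section `e` of `𝒟`. -/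
def boundaries : Submodule k (HBar ϖ k → ∀ y, L.fiber y) where
  carrier := {d | ∃ e : ∀ y, L.fiber y, ∀ x, L.IsRegularAt (d x - e) x}
  add_mem' {d d'} hd hd' := by
    obtain ⟨e, h⟩ := hd
    obtain ⟨e', h'⟩ := hd'
    exact ⟨e + e', fun x => by
      simpa only [Pi.add_apply, add_sub_add_comm] using (h x).add (h' x)⟩
  zero_mem' := ⟨0, fun x => by simpa using IsRegularAt.zero x⟩
  smul_mem' c d hd := by
    obtain ⟨e, h⟩ := hd
    exact ⟨c • e, fun x => by
      simpa only [Pi.smul_apply, smul_sub] using (h x).smul c⟩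

/-- The cohomology space `H¹(H̄, L)`. Since `𝒟` is flasque, it is the cokernel of
`Γ(H̄, 𝒟) → Γ(H̄, 𝒟 / ℒ)`. -/
abbrev H1 := L.quotientSections ⧸ L.boundaries.submoduleOf L.quotientSections

end LineBundle

variable (ϖ k) in
/-- A `[G]₂`-equivariant line bundle on `H̄`. The action is given by its effect `ρ g` on sections;
semilinearity over all functions expresses that `ρ g` comes from linear maps between the fibres
`L_x → L_{g x}`. -/
structure EquivariantLineBundle extends LineBundle.{v} ϖ k where
  ρ : Representation k (evenGroup ϖ) (∀ x, fiber x)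
  ρ_smul : ∀ (g : evenGroup ϖ) (f : HBar ϖ k → k) (s : ∀ x, fiber x),
    ρ g (fun x => f x • s x) = fun x => f ((g : GL (Fin 2) K)⁻¹ • x) • ρ g s x
  ρ_isRegular : ∀ (g : evenGroup ϖ) (U : Set (HBar ϖ k)) (s : ∀ x, fiber x), IsOpen U →
    toLineBundle.IsRegular U s →
    toLineBundle.IsRegular ((fun x => (g : GL (Fin 2) K)⁻¹ • x) ⁻¹' U) (ρ g s)

namespace EquivariantLineBundle

variable (L : EquivariantLineBundle.{v} ϖ k)

lemma isRegularAt_ρ (g : evenGroup ϖ) {s : ∀ x, L.fiber x} {x : HBar ϖ k}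
    (hs : L.IsRegularAt s ((g : GL (Fin 2) K)⁻¹ • x)) : L.IsRegularAt (L.ρ g s) x := by
  obtain ⟨U, hU, hx, hs⟩ := hs
  exact ⟨_, isOpen_preimage_smul _ hU, hx, L.ρ_isRegular g U s hU hs⟩

/-- The representation of `[G]₂` on `H⁰(H̄, L)`. -/
def H0Rep : Representation k (evenGroup ϖ) L.H0 :=
  L.ρ.subrepresentation L.H0 fun g s hs => L.ρ_isRegular g Set.univ s isOpen_univ hs

/-- The action of `[G]₂` on families of sections: `(g d) x = g (d (g⁻¹ x))`. -/
def familyRep : Representation k (evenGroup ϖ) (HBar ϖ k → ∀ y, L.fiber y) where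
  toFun g :=
    { toFun := fun d x => L.ρ g (d ((g : GL (Fin 2) K)⁻¹ • x))
      map_add' := fun d d' => by funext x; simp
      map_smul' := fun c d => by funext x; simp }
  map_one' := by ext1 d; funext x; simp
  map_mul' g h := by ext1 d; funext x; simp [mul_smul]

/-- The representation of `[G]₂` on `H¹(H̄, L)`. -/
def H1Rep : Representation k (evenGroup ϖ) L.H1 :=
  (L.familyRep.subrepresentation L.quotientSections (by
    intro g d hd x
    obtain ⟨U, hU, hx, h⟩ := hd ((g : GL (Fin 2) K)⁻¹ • x)
    refine ⟨_, isOpen_preimage_smul (g : GL (Fin 2) K)⁻¹ hU, hx, fun y hy => ?_⟩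
    have := L.isRegularAt_ρ g (h _ hy)
    rwa [map_sub] at this)).quotient _ (by
    rintro g ⟨d, _⟩ ⟨e, h⟩
    refine ⟨L.ρ g e, fun x => ?_⟩
    have := L.isRegularAt_ρ g (h ((g : GL (Fin 2) K)⁻¹ • x))
    rwa [map_sub] at this)

/-- `L` has the data `(1, r, k₀, k₁)`: its degree on the component of `s₀ = [w 𝒪_K²]` is `k₀`, and
its restriction to the component of `s₁ = [𝒪_K²]` is isomorphic to `det^r ⊗ 𝒪(k₁)` as
a `G°ϖ^ℤ`-equivariant line bundle, where `ϖ` acts trivially and `h ∈ G°` acts on `𝒪(k₁)` through its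
reduction, by `F(z₀, z₁) ↦ F(hᵀ(z₀, z₁))` on homogeneous functions. -/
def HasData (r k₀ k₁ : ℤ) : Prop :=
  Nonempty (L.ComponentIso (wMat ϖ) k₀) ∧
  ∃ θ : L.ComponentIso 1 k₁, ∀ (h : GL (Fin 2) 𝒪[K]) (n : Multiplicative ℤ)
    (s : ∀ x, L.fiber x) (z : Coord k),
    θ.coeff (L.ρ (stabHom ϖ 1 (h, n)) s) z =
      ((Matrix.GeneralLinearGroup.det (red k h) ^ r : kˣ) : k) *
        θ.coeff s (z.change (red k h))

end EquivariantLineBundle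

end LineBundles

/-! ### Representations -/

section Representations

variable {k : Type*} [Field k]

/-- `Sym^n k²`, as the space of homogeneous polynomials of degree `n` in `z₀, z₁`
(zero for `n < 0`). -/
def sym (k : Type*) [Field k] : ℤ → Submodule k (MvPolynomial (Fin 2) k)
  | .ofNat n => MvPolynomial.homogeneousSubmodule (Fin 2) k n
  | .negSucc _ => ⊥

/-- The substitution `zⱼ ↦ ∑ᵢ Aᵢⱼ zᵢ`. -/
def subst (A : Matrix (Fin 2) (Fin 2) k) : MvPolynomial (Fin 2) k →ₐ[k] MvPolynomial (Fin 2) k :=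
  MvPolynomial.aeval fun j => ∑ i, MvPolynomial.C (A i j) * MvPolynomial.X i

/-- The action of `GL₂(k)` on polynomials. -/
def polyRep (k : Type*) [Field k] : Representation k (GL (Fin 2) k) (MvPolynomial (Fin 2) k) where
  toFun A := (subst A.1).toLinearMap
  map_one' := by
    have : subst (1 : Matrix (Fin 2) (Fin 2) k) = AlgHom.id k _ := by
      ext1 j
      simp [subst, Matrix.one_apply]
    rw [Units.val_one, this]
    rfl
  map_mul' A B := by
    have : subst (A * B).1 = (subst A.1).comp (subst B.1) := by
      ext1 j
      simp only [subst, MvPolynomial.aeval_X, AlgHom.comp_apply, Units.val_mul, Matrix.mul_apply,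
        Fin.sum_univ_two, map_add, map_mul, MvPolynomial.algHom_C, MvPolynomial.algebraMap_eq]
      ring
    rw [this]
    rfl

/-- The representation of `GL₂(k)` on `Sym^n k²`. -/
def symRep (k : Type*) [Field k] (n : ℤ) : Representation k (GL (Fin 2) k) (sym k n) :=
  (polyRep k).subrepresentation (sym k n) (by
    intro A P hP
    cases n with
    | ofNat n =>
      have h := MvPolynomial.IsHomogeneous.aeval (n := 1) hP
        (fun j => ∑ i, MvPolynomial.C (A.1 i j) * MvPolynomial.X i) (fun j =>
          MvPolynomial.IsHomogeneous.sum _ _ _ fun i _ => by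
            simpa using (MvPolynomial.isHomogeneous_C (Fin 2) (A.1 i j)).mul
              (MvPolynomial.isHomogeneous_X k i))
      rw [one_mul] at h
      exact h
    | negSucc n =>
      have : P = 0 := hP
      subst this
      exact (map_zero _ : polyRep k A 0 = 0))

/-- The twist `ρ ⊗ det^r` of a representation of `GL₂(k)`. -/
def detTwist {V : Type*} [AddCommGroup V] [Module k V] (r : ℤ)
    (ρ : Representation k (GL (Fin 2) k) V) : Representation k (GL (Fin 2) k) V where
  toFun A := ((Matrix.GeneralLinearGroup.det A ^ r : kˣ) : k) • ρ A
  map_one' := by simp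
  map_mul' A B := by
    rw [map_mul, mul_zpow, map_mul, Units.val_mul, smul_mul_smul_comm]

variable {K : Type*} [Field K] [ValuativeRel K]

/-- Inflation of a representation of `GL₂(k)` to `G°ϖ^ℤ`, with `ϖ` acting trivially. -/
def inflate [Algebra 𝓀[K] k] {V : Type*} [AddCommGroup V] [Module k V]
    (ρ : Representation k (GL (Fin 2) k) V) : Representation k (MaxCompactMod K) V :=
  MonoidHom.comp ρ ((red k).comp (MonoidHom.fst _ _))

variable (ϖ : Uniformizer K) [Algebra 𝓀[K] k]

/-- The character `μ_{m,n}` of `Iϖ^ℤ`: `(a, b; c, d) ↦ a^m d^n` on `I`, and `ϖ ↦ 1`. -/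
def iwahoriChar (K : Type*) [Field K] [ValuativeRel K] (k : Type*) [Field k] [Algebra 𝓀[K] k]
    (m n : ℤ) : iwahori K × Multiplicative ℤ →* k where
  toFun h := redHom k (h.1.1.1 0 0) ^ m * redHom k (h.1.1.1 1 1) ^ n
  map_one' := by simp
  map_mul' a b := by
    have key : ∀ c : iwahori K, redHom k (c.1.1 1 0) = 0 := fun c => by
      have hc : c.1.1 1 0 ∈ 𝓂[K] := c.2
      rw [redHom, RingHom.comp_apply, (IsLocalRing.residue_eq_zero_iff _).2 hc, map_zero]
    simp only [Prod.fst_mul, Subgroup.coe_mul, Units.val_mul, Matrix.mul_apply, Fin.sum_univ_two,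
      map_add, map_mul, key, mul_zero, zero_mul, add_zero, zero_add, mul_zpow]
    ring

/-- The homomorphism `Iϖ^ℤ → [G]₂`. -/
def iwahoriHom : iwahori K × Multiplicative ℤ →* evenGroup ϖ :=
  (stabHom ϖ 1).comp ((iwahori K).subtype.prodMap (MonoidHom.id _))

/-- The character `μ_{m,n}` as a representation on `k`. -/
def iwahoriCharRep (K : Type*) [Field K] [ValuativeRel K] (k : Type*) [Field k] [Algebra 𝓀[K] k]
    (m n : ℤ) : Representation k (iwahori K × Multiplicative ℤ) k :=
  (algebraMap k (Module.End k k)).toMonoidHom.comp (iwahoriChar K k m n)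

/-- The representation `σ^{(i)}_{n,r}` of `[G]₂`: the (full) induction from `G°ϖ^ℤ` (`i = 1`),
resp. `w G° w⁻¹ ϖ^ℤ` (`i = 0`), of `Sym^n k² ⊗ det^r`, resp. of its conjugate by `w`. -/
def sigma (k : Type*) [Field k] [Algebra 𝓀[K] k] (i : Fin 2) (n r : ℤ) :
    Representation k (evenGroup ϖ) (Representation.coindV (stabHom ϖ i)
      (inflate (K := K) (detTwist r (symRep k n)))) :=
  Representation.coind _ _

/-- The representation `τ^{(i)}_{n,r}` of `[G]₂`: the (full) induction from `G°ϖ^ℤ` (`i = 1`),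
resp. `w G° w⁻¹ ϖ^ℤ` (`i = 0`), of `(Sym^n k²)^∨ ⊗ det^r`, resp. of its conjugate by `w`. -/
def tau (k : Type*) [Field k] [Algebra 𝓀[K] k] (i : Fin 2) (n r : ℤ) :
    Representation k (evenGroup ϖ) (Representation.coindV (stabHom ϖ i)
      (inflate (K := K) (detTwist r (symRep k n).dual))) :=
  Representation.coind _ _

/-- The representation `I(m, n)` of `[G]₂`: the (full) induction of `μ_{m,n}` from `Iϖ^ℤ`. -/
def iwahoriInd (k : Type*) [Field k] [Algebra 𝓀[K] k] (m n : ℤ) :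
    Representation k (evenGroup ϖ) (Representation.coindV (iwahoriHom ϖ)
      (iwahoriCharRep K k m n)) :=
  Representation.coind _ _

variable {ϖ}

/-- An intertwining map `f : σ^{(i)}_{n,r} → I(m, m')` is the evaluation map if it is induced by the
evaluation `P ↦ P(0, 1)` of homogeneous polynomials at the double point. -/
def IsEvaluation {i : Fin 2} {n r m m' : ℤ}
    (f : (sigma ϖ k i n r).IntertwiningMap (iwahoriInd ϖ k m m')) : Prop :=
  ∀ φ g, (f φ).1 g = MvPolynomial.eval ![0, 1] (φ.1 g).1

end Representations

section Generalities

variable {k G : Type*} [Field k] [Group G]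

/-- There is a short exact sequence of representations `0 → V₁ → V₂ → V₃ → 0`. -/
def HasShortExact {V₁ V₂ V₃ : Type*} [AddCommMonoid V₁] [Module k V₁] [AddCommMonoid V₂]
    [Module k V₂] [AddCommMonoid V₃] [Module k V₃] (ρ₁ : Representation k G V₁)
    (ρ₂ : Representation k G V₂) (ρ₃ : Representation k G V₃) : Prop :=
  ∃ (f : ρ₁.IntertwiningMap ρ₂) (g : ρ₂.IntertwiningMap ρ₃),
    Function.Injective f ∧ Function.Exact f g ∧ Function.Surjective g

/-- The quotient of a representation by a subrepresentation. -/
def quotientRep {V : Type*} [AddCommGroup V] [Module k V] {ρ : Representation k G V}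
    (S : Subrepresentation ρ) : Representation k G (V ⧸ S.toSubmodule) :=
  ρ.quotient S.toSubmodule fun g _ hv => S.apply_mem_toSubmodule g hv

/-- The topological contragredient of a representation on a space of functions
`W ⊆ ∏ₓ Mₓ` with the topology induced by the product of the discrete topologies: the linear forms
that vanish on all `f ∈ W` vanishing at some given finite set of points. -/
def topDual {X : Type*} {M : X → Type*} [∀ x, AddCommMonoid (M x)] [∀ x, Module k (M x)]
    {W : Submodule k (∀ x, M x)} (ρ : Representation k G W)
    (hρ : ∀ g x, ∃ y, ∀ f : W, f.1 y = 0 → (ρ g f).1 x = 0) : Subrepresentation ρ.dual where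
  toSubmodule :=
    { carrier := {φ | ∃ S : Set X, S.Finite ∧ ∀ f : W, (∀ x ∈ S, f.1 x = 0) → φ f = 0}
      add_mem' := by
        rintro φ φ' ⟨S, hS, h⟩ ⟨S', hS', h'⟩
        refine ⟨S ∪ S', hS.union hS', fun f hf => ?_⟩
        rw [LinearMap.add_apply, h f fun x hx => hf x (Or.inl hx),
          h' f fun x hx => hf x (Or.inr hx), add_zero]
      zero_mem' := ⟨∅, Set.finite_empty, fun _ _ => rfl⟩
      smul_mem' := by
        rintro c φ ⟨S, hS, h⟩
        exact ⟨S, hS, fun f hf => by rw [LinearMap.smul_apply, h f hf, smul_zero]⟩ }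
  apply_mem_toSubmodule := by
    rintro g φ ⟨S, hS, h⟩
    choose y hy using hρ g⁻¹
    refine ⟨y '' S, hS.image y, fun f hf => ?_⟩
    exact h (ρ g⁻¹ f) fun x hx => hy x f (hf (y x) ⟨x, hx, rfl⟩)

/-- The kernel of the transpose `f^∨ : D → V^∨` of `f : V → W`, where `D` is a subrepresentation
of the linear dual of `W`: the linear forms in `D` that vanish on the image of `f`. -/
def kerTranspose {V W : Type*} [AddCommMonoid V] [Module k V] [AddCommMonoid W] [Module k W]
    {ρ : Representation k G V} {ρ' : Representation k G W} (D : Subrepresentation ρ'.dual)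
    (f : ρ.IntertwiningMap ρ') : Subrepresentation D.toRepresentation where
  toSubmodule :=
    { carrier := {φ | ∀ v, φ.1 (f v) = 0}
      add_mem' := by
        intro φ φ' h h' v
        rw [Submodule.coe_add, LinearMap.add_apply, h v, h' v, add_zero]
      zero_mem' := fun _ => rfl
      smul_mem' := by
        intro c φ h v
        rw [Submodule.coe_smul, LinearMap.smul_apply, h v, smul_zero] }
  apply_mem_toSubmodule := by
    intro g φ h v
    change φ.1 (ρ' g⁻¹ (f v)) = 0
    rw [← f.isIntertwining]
    exact h _

/-- The intersection of the images of two intertwining maps. -/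
def imageInter {V V' W : Type*} [AddCommMonoid V] [Module k V] [AddCommMonoid V'] [Module k V']
    [AddCommMonoid W] [Module k W] {ρ : Representation k G V} {ρ' : Representation k G V'}
    {ρ'' : Representation k G W} (f : ρ.IntertwiningMap ρ'') (f' : ρ'.IntertwiningMap ρ'') :
    Subrepresentation ρ'' :=
  f.range ⊓ f'.range

/-- The representation `ρ'` is isomorphic to `D / (ker f^∨ + ker f'^∨)`, where `D` is a
subrepresentation of the linear dual of the common target of `f` and `f'`: it is the target of a
surjective intertwining map on `D` with kernel `ker f^∨ + ker f'^∨`. -/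
def IsDualQuotient {V V' W U : Type*} [AddCommMonoid V] [Module k V] [AddCommMonoid V']
    [Module k V'] [AddCommMonoid W] [Module k W] [AddCommMonoid U] [Module k U]
    {ρ : Representation k G V} {ρ' : Representation k G V'} {ρ'' : Representation k G W}
    (D : Subrepresentation ρ''.dual) (f : ρ.IntertwiningMap ρ'') (f' : ρ'.IntertwiningMap ρ'')
    (θ : Representation k G U) : Prop :=
  ∃ π : D.toRepresentation.IntertwiningMap θ,
    Function.Surjective π ∧ π.ker = kerTranspose D f ⊔ kerTranspose D f'

end Generalities

section Duals

variable {K : Type*} [Field K] [ValuativeRel K] {ϖ : Uniformizer K}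
variable {k : Type*} [Field k] [Algebra 𝓀[K] k]

/-- The topological contragredient of `I(m, n)`. -/
def iwahoriIndDual (ϖ : Uniformizer K) (k : Type*) [Field k] [Algebra 𝓀[K] k] (m n : ℤ) :
    Subrepresentation (iwahoriInd ϖ k m n).dual :=
  topDual (iwahoriInd ϖ k m n) fun g x => ⟨x * g, fun _ hf => hf⟩

/-- The topological contragredient of `H⁰(H̄, L)`. -/
def EquivariantLineBundle.H0Dual (L : EquivariantLineBundle ϖ k) :
    Subrepresentation L.H0Rep.dual :=
  topDual L.H0Rep fun g x => ⟨(g : GL (Fin 2) K)⁻¹ • x, fun s hs => by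
    classical
    have h := L.ρ_smul g (fun y => if y = (g : GL (Fin 2) K)⁻¹ • x then 0 else 1) s.1
    have e : (fun y => (if y = (g : GL (Fin 2) K)⁻¹ • x then (0 : k) else 1) • s.1 y) = s.1 := by
      funext y
      by_cases hy : y = (g : GL (Fin 2) K)⁻¹ • x
      · subst hy; simp [hs]
      · simp [hy]
    rw [e] at h
    have := congrFun h x
    rw [if_pos rfl, zero_smul] at this
    exact this⟩

end Duals

end

end Drinfeld

/-!
A component of `H̄` is a projective line with homogeneous coordinates `(z₀, z₁)`, and its double
points are the `q + 1` rational points, permuted transitively by `GL₂(𝔽_q)`. The group `[G]₂` has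
two orbits of components, represented by `s₀` and `s₁`, and one orbit of double points, whose
stabilizer is `Iϖ^ℤ`. Hence a section of `L` is a pair of equivariant families of homogeneous
functions, one for each of the two standard components, that agree at the standard double point. On
the component of `s₁` the stabilizer acts through `det ^ r₁ ⊗ 𝒪(κ₁)` by hypothesis; on the component
of `s₀` its action differs from the natural one on `𝒪(κ₀)` by a character, and comparison at the
double point shows that the character is `det ^ r₀` (`exists_trivialization`). The same comparison
yields the congruence `r₀ + κ₀ ≡ r₁ mod q - 1`, in the form of `Trivialization.weight`.

Since `H⁰(ℙ¹, 𝒪(n)) = Sym^n`, the space `H⁰` is the fibre product of `σ^{(0)}_{κ₀, r₀}` and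
`σ^{(1)}_{κ₁, r₁}` over `I(r₁, r₀)`, the space of values at the double points
(`exists_isFibreProduct`). The maps to `I` are the evaluation maps `f_i`. A form vanishing at all
rational points is a multiple of `z₀^q z₁ - z₀ z₁^q`, on which `GL₂(𝔽_q)` acts by `det`; so the
kernel of `f_i` is `σ^{(i)}_{κ_i - q - 1, 1 + r_i}` (`exists_kernel_of_isEvaluation`), which is zero
if `κ_i ≤ q`. If `κ_i ≥ q`, interpolation at the `q + 1` rational points shows that `f_i` is
surjective (`surjective_of_isEvaluation`). The assertions on `H⁰` are formal consequences.

For `H¹`, the exact sequence of the normalization of `H̄` reads `σ^{(0)} × σ^{(1)} → I → H¹ →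
τ^{(0)} × τ^{(1)} → 0` (`exists_isConnectingSequence`), where `τ^{(i)}` is induced from `H¹(ℙ¹,
𝒪(κ_i))`. The latter space vanishes for `κ_i ≥ -1`, because every principal part is the principal
part of a global section (`cocycles_le_coboundaries`). In general, the residue pairing identifies it
with the dual of `Sym^{-2-κ_i}`, up to a twist by `det⁻¹`: the residue of a class of `𝒪(-2)` is
defined by the Koszul sequence `0 → 𝒪(-2) → 𝒪(-1)² → 𝒪 → 0` (`HasResidue`), it detects classes
(`residue_eq_zero_iff`), and every linear form on `Sym^{-2-κ_i}` occurs (`exists_residue_eq`). The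
last map of the exact sequence is surjective, although the components meet, because a class on a
component may be represented by a family vanishing at the double points. The assertions on `H¹`
follow, since `σ^{(i)}` vanishes if `κ_i < 0` and `τ^{(i)}` if `κ_i ≥ -1`.

If both `κ_i` are at most `q`, then `H⁰` is the intersection of the images of `f₀` and `f₁`. For
full duals it is linear algebra that the forms vanishing on an intersection are sums of forms
vanishing on the two subspaces. For topological duals the same holds because `I` is the full dual of
its topological dual (`exists_eq_of_dual_iwahoriIndDual`) and the images of `f₀` and `f₁` are
closed, being cut out component by component by linear relations between finitely many values
(`exists_eq_of_forall_iwahoriIndDual`, `exists_add_of_forall_inf`).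
-/

namespace Drinfeld

/-! ### Forms in two variables and the Zariski topology on homogeneous coordinates -/

section Forms

open MvPolynomial Filter Topology

variable {k : Type*} [Field k]

lemma Coord.pt_eq_iff {z z' : Coord k} : z.pt = z'.pt ↔ ∃ c : k, z.1 = c • z'.1 := by
  refine (Projectivization.mk_eq_mk_iff' k z.1 z'.1 z.2 z'.2).trans ?_
  exact ⟨fun ⟨c, h⟩ => ⟨c, h.symm⟩, fun ⟨c, h⟩ => ⟨c, h.symm⟩⟩

lemma Coord.exists_pt (p : P1 k) : ∃ z : Coord k, z.pt = p := by
  induction p using Projectivization.ind with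
  | h v hv => exact ⟨⟨v, hv⟩, rfl⟩

/-- The scalar relating two proportional coordinate vectors is nonzero. -/
lemma Coord.ne_zero_of_eq_smul {z z' : Coord k} {c : k} (h : z'.1 = c • z.1) : c ≠ 0 := by
  rintro rfl
  exact z'.2 (by rw [h, zero_smul])

lemma eval_smul_of_isHomogeneous {P : MvPolynomial (Fin 2) k} {a : ℕ} (hP : P.IsHomogeneous a)
    (c : k) (v : Fin 2 → k) : eval (c • v) P = c ^ a * eval v P := by
  rw [eval_eq, eval_eq, Finset.mul_sum]
  refine Finset.sum_congr rfl fun d hd => ?_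
  have e := hP.degree_eq_sum_deg_support hd
  simp only [Pi.smul_apply, smul_eq_mul, mul_pow, Finset.prod_mul_distrib,
    Finset.prod_pow_eq_pow_sum]
  rw [← e]; ring

lemma eval_ne_zero_iff_of_pt_eq {P : MvPolynomial (Fin 2) k} {a : ℕ} (hP : P.IsHomogeneous a)
    {z z' : Coord k} (h : z.pt = z'.pt) : eval z.1 P ≠ 0 ↔ eval z'.1 P ≠ 0 := by
  obtain ⟨c, hc⟩ := Coord.pt_eq_iff.1 h
  have := Coord.ne_zero_of_eq_smul hc
  rw [hc, eval_smul_of_isHomogeneous hP]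
  simp [this]

/-- The Zariski topology on homogeneous coordinates, induced from the projective line. -/
instance : TopologicalSpace (Coord k) := .induced Coord.pt inferInstance

lemma mem_nonvanishing {Q : MvPolynomial (Fin 2) k} {b : ℕ} (hQ : Q.IsHomogeneous b)
    {z : Coord k} : z.pt ∈ nonvanishing Q ↔ eval z.1 Q ≠ 0 :=
  ⟨fun ⟨_, h, h'⟩ => (eval_ne_zero_iff_of_pt_eq hQ h).1 h', fun h => ⟨z, rfl, h⟩⟩

/-- The sets `D(R)`, `R` homogeneous, form a basis of the topology. -/
lemma exists_form_of_isOpen {V : Set (P1 k)} (hV : IsOpen V) {z : Coord k} (hz : z.pt ∈ V) :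
    ∃ (b : ℕ) (R : MvPolynomial (Fin 2) k), R.IsHomogeneous b ∧ eval z.1 R ≠ 0 ∧
      ∀ z' : Coord k, eval z'.1 R ≠ 0 → z'.pt ∈ V := by
  induction hV with
  | basic U hU =>
    obtain ⟨n, Q, hQ, rfl⟩ := hU
    exact ⟨n, Q, hQ, (mem_nonvanishing hQ).1 hz, fun z' h => (mem_nonvanishing hQ).2 h⟩
  | univ => exact ⟨0, 1, isHomogeneous_one _ _, by simp, fun _ _ => trivial⟩
  | inter U U' _ _ h h' =>
    obtain ⟨b, R, hR, h0, h1⟩ := h hz.1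
    obtain ⟨b', R', hR', h0', h1'⟩ := h' hz.2
    refine ⟨_, _, hR.mul hR', by simpa using ⟨h0, h0'⟩, fun z' hne => ?_⟩
    rw [map_mul] at hne
    exact ⟨h1 _ (left_ne_zero_of_mul hne), h1' _ (right_ne_zero_of_mul hne)⟩
  | sUnion 𝒰 _ ih =>
    obtain ⟨U, hU, hzU⟩ := hz
    obtain ⟨b, R, hR, h0, h1⟩ := ih U hU hzU
    exact ⟨b, R, hR, h0, fun z' h => ⟨U, hU, h1 z' h⟩⟩

lemma eventually_nhds_iff_exists_form {p : Coord k → Prop} {z : Coord k} :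
    (∀ᶠ z' in 𝓝 z, p z') ↔ ∃ (b : ℕ) (R : MvPolynomial (Fin 2) k), R.IsHomogeneous b ∧
      eval z.1 R ≠ 0 ∧ ∀ z' : Coord k, eval z'.1 R ≠ 0 → p z' := by
  constructor
  · intro h
    obtain ⟨U, hU, hUo, hz⟩ := eventually_nhds_iff.1 h
    obtain ⟨V, hV, rfl⟩ := isOpen_induced_iff.1 hUo
    obtain ⟨b, R, hR, h0, h1⟩ := exists_form_of_isOpen hV hz
    exact ⟨b, R, hR, h0, fun z' h => hU _ (h1 z' h)⟩
  · rintro ⟨b, R, hR, h0, h1⟩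
    refine eventually_nhds_iff.2 ⟨Coord.pt ⁻¹' nonvanishing R, fun z' h => ?_, ?_, ?_⟩
    · exact h1 z' ((mem_nonvanishing hR).1 h)
    · exact isOpen_induced (TopologicalSpace.isOpen_generateFrom_of_mem ⟨b, R, hR, rfl⟩)
    · exact (mem_nonvanishing hR).2 h0

lemma eventually_eval_ne_zero {P : MvPolynomial (Fin 2) k} {a : ℕ} (hP : P.IsHomogeneous a)
    {z : Coord k} (h : eval z.1 P ≠ 0) : ∀ᶠ z' : Coord k in 𝓝 z, eval z'.1 P ≠ 0 :=
  eventually_nhds_iff_exists_form.2 ⟨a, P, hP, h, fun _ h => h⟩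

lemma eventually_nhds_of_pt_eq {p : Coord k → Prop} {z z' : Coord k} (h : z.pt = z'.pt)
    (hp : ∀ᶠ y in 𝓝 z, p y) : ∀ᶠ y in 𝓝 z', p y := by
  rw [nhds_induced] at hp ⊢
  rwa [← h]

/-- A linear form vanishing exactly at the point with coordinates `v`. -/
noncomputable def linForm (v : Fin 2 → k) : MvPolynomial (Fin 2) k :=
  C (v 1) * X 0 - C (v 0) * X 1

lemma linForm_isHomogeneous (v : Fin 2 → k) : (linForm v).IsHomogeneous 1 := by
  simpa [linForm] using ((isHomogeneous_C (Fin 2) (v 1)).mul (isHomogeneous_X k 0)).sub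
    ((isHomogeneous_C (Fin 2) (v 0)).mul (isHomogeneous_X k 1))

lemma eval_linForm (v z : Fin 2 → k) : eval z (linForm v) = v 1 * z 0 - v 0 * z 1 := by
  simp [linForm]

lemma eval_linForm_eq_zero {v z : Coord k} : eval z.1 (linForm v.1) = 0 ↔ z.pt = v.pt := by
  rw [eval_linForm, Coord.pt_eq_iff]
  constructor
  · intro h
    have hv : v.1 0 ≠ 0 ∨ v.1 1 ≠ 0 := by
      by_contra! hc
      exact v.2 (by ext i; fin_cases i <;> simp [hc])
    rcases hv with hv | hv
    · refine ⟨z.1 0 / v.1 0, ?_⟩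
      ext i
      fin_cases i
      · simp [hv]
      · simp only [Pi.smul_apply, smul_eq_mul, Fin.mk_one]
        field_simp
        linear_combination -h
    · refine ⟨z.1 1 / v.1 1, ?_⟩
      ext i
      fin_cases i
      · simp only [Pi.smul_apply, smul_eq_mul, Fin.zero_eta]
        field_simp
        linear_combination h
      · simp [hv]
  · rintro ⟨c, hc⟩
    simp only [hc, Pi.smul_apply, smul_eq_mul]
    ring

lemma linForm_ne_zero (v : Coord k) : linForm v.1 ≠ 0 := by
  intro h
  refine v.2 (funext fun i => ?_)
  have h0 : eval ![1, 0] (linForm v.1) = 0 := by rw [h, map_zero]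
  have h1 : eval ![0, 1] (linForm v.1) = 0 := by rw [h, map_zero]
  rw [eval_linForm] at h0 h1
  fin_cases i
  · simpa using h1
  · simpa using h0

lemma exists_coord_ne_zero (z : Coord k) : ∃ j, z.1 j ≠ 0 := by
  by_contra! h
  exact z.2 (funext h)

/-- A form with a zero is divisible by the corresponding linear form: modulo that linear form,
`v_j X_i` agrees with `v_i X_j`. -/
lemma linForm_dvd {P : MvPolynomial (Fin 2) k} {a : ℕ} (hP : P.IsHomogeneous (a + 1))
    {v : Coord k} (h : eval v.1 P = 0) :
    ∃ P' : MvPolynomial (Fin 2) k, P'.IsHomogeneous a ∧ P = linForm v.1 * P' := by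
  have hdvd : linForm v.1 ∣ P := by
    obtain ⟨j, hj⟩ := exists_coord_ne_zero v
    rw [← Ideal.mem_span_singleton]
    set J := Ideal.span {linForm v.1}
    have hX : ∀ i, Ideal.Quotient.mk J (C (v.1 j) * X i) =
        Ideal.Quotient.mk J (C (v.1 i) * X j) := by
      intro i
      rw [Ideal.Quotient.eq]
      have hl : C (v.1 1) * X 0 - C (v.1 0) * X 1 ∈ J := Ideal.subset_span rfl
      fin_cases i <;> fin_cases j <;> simp only [Fin.zero_eta, Fin.mk_one, sub_self, zero_mem]
      · exact hl
      · simpa using neg_mem hl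
    -- Modulo the linear form, `v_j X_i = v_i X_j`; as `P` is homogeneous of degree `a + 1`, this
    -- gives `v_j ^ (a + 1) P = P(v) X_j ^ (a + 1) = 0`.
    have h1 : Ideal.Quotient.mk J (aeval (fun i => C (v.1 j) * X i) P) =
        Ideal.Quotient.mk J (aeval (fun i => C (v.1 i) * X j) P) := by
      change Ideal.Quotient.mkₐ k J _ = Ideal.Quotient.mkₐ k J _
      rw [← AlgHom.comp_apply, ← AlgHom.comp_apply]
      congr 1
      ext1 i
      simpa using hX i
    have h2 : aeval (fun i => C (v.1 i) * X j) P = 0 := by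
      have : aeval (fun i => C (v.1 i) * X j : Fin 2 → MvPolynomial (Fin 2) k) P =
          C (eval v.1 P) * X j ^ (a + 1) := by
        rw [aeval_def, eval₂_eq, eval_eq, map_sum, Finset.sum_mul]
        refine Finset.sum_congr rfl fun d hd => ?_
        have e := hP.degree_eq_sum_deg_support hd
        simp only [mul_pow, Finset.prod_mul_distrib, Finset.prod_pow_eq_pow_sum, map_mul, map_prod,
          map_pow]
        rw [← e, algebraMap_eq]; ring
      rw [this, h, C_0, zero_mul]
    have h3 : aeval (fun i => C (v.1 j) * X i : Fin 2 → MvPolynomial (Fin 2) k) P =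
        C (v.1 j ^ (a + 1)) * P := by
      conv_rhs => rw [P.as_sum, Finset.mul_sum]
      rw [aeval_def, eval₂_eq]
      refine Finset.sum_congr rfl fun d hd => ?_
      have e := hP.degree_eq_sum_deg_support hd
      simp only [mul_pow, Finset.prod_mul_distrib, Finset.prod_pow_eq_pow_sum]
      rw [monomial_eq, ← e, algebraMap_eq, Finsupp.prod]
      simp only [map_pow]
      ring
    rw [h3, h2, map_zero, Ideal.Quotient.eq_zero_iff_mem] at h1
    have := J.mul_mem_left (C ((v.1 j ^ (a + 1))⁻¹)) h1
    rwa [← mul_assoc, ← C_mul, inv_mul_cancel₀ (pow_ne_zero _ hj), C_1, one_mul] at this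
  -- The quotient may be replaced by its homogeneous component of degree `a`.
  obtain ⟨P', rfl⟩ := hdvd
  refine ⟨homogeneousComponent a P', homogeneousComponent_isHomogeneous _ _, ?_⟩
  let : GradedAlgebra (homogeneousSubmodule (Fin 2) k) := gradedAlgebra
  have e := DirectSum.coe_decompose_mul_add_of_left_mem (homogeneousSubmodule (Fin 2) k) (j := a)
    (b := P') (linForm_isHomogeneous v.1)
  rw [DirectSum.decompose_of_mem_same (homogeneousSubmodule (Fin 2) k) (by rw [add_comm]; exact hP)]
    at e
  exact e.trans (congrArg _ (decomposition.decompose'_apply P' a))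

/-- A form of degree `0` is constant. -/
lemma exists_eq_C {P : MvPolynomial (Fin 2) k} (hP : P.IsHomogeneous 0) : ∃ c, P = C c :=
  ⟨_, totalDegree_eq_zero_iff_eq_C.1 ((totalDegree_zero_iff_isHomogeneous (Fin 2)).2 hP)⟩

section Infinite

variable [Infinite k]

lemma eq_of_eval_coord {P P' : MvPolynomial (Fin 2) k}
    (h : ∀ z : Coord k, eval z.1 P = eval z.1 P') : P = P' := by
  have : X 0 * P = X 0 * P' := by
    refine MvPolynomial.funext fun v => ?_
    by_cases hv : v = 0
    · simp [hv]
    · simp [h ⟨v, hv⟩]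
  exact mul_left_cancel₀ (X_ne_zero 0) this

lemma exists_eval_ne_zero {P : MvPolynomial (Fin 2) k} (h : P ≠ 0) :
    ∃ z : Coord k, eval z.1 P ≠ 0 := by
  by_contra! hc
  exact h (eq_of_eval_coord fun z => by rw [hc z, map_zero])

end Infinite

section IsAlgClosed

variable [IsAlgClosed k]

lemma exists_zero_of_isHomogeneous {Q : MvPolynomial (Fin 2) k} {b : ℕ}
    (hQ : Q.IsHomogeneous (b + 1)) : ∃ z : Coord k, eval z.1 Q = 0 := by
  by_contra! hne
  set g : Polynomial k := aeval ![Polynomial.X, 1] Q with hg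
  have hge : ∀ t, g.eval t = eval ![t, 1] Q := fun t => by
    rw [hg, ← Polynomial.coe_evalRingHom, aeval_def, hom_eval₂, eval_eq', eval₂_eq']
    refine Finset.sum_congr rfl fun d _ => ?_
    simp
  -- Without zeros with `z₁ = 1`, the dehomogenization is constant, so that `Q = c X₁ ^ (b + 1)`;
  -- but this form vanishes at `(1, 0)`.
  have hdeg : g.degree = 0 := by
    by_contra h0
    obtain ⟨x, hx⟩ := IsAlgClosed.exists_root g h0
    exact hne ⟨![x, 1], fun h => one_ne_zero (congrFun h 1)⟩ (by rw [← hge]; exact hx)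
  rw [Polynomial.eq_C_of_degree_eq_zero hdeg] at hge
  set c := g.coeff 0
  have : Q = C c * X 1 ^ (b + 1) := by
    have : X 1 * Q = X 1 * (C c * X 1 ^ (b + 1)) := by
      refine MvPolynomial.funext fun v => ?_
      by_cases hv : v 1 = 0
      · simp [hv]
      · have e : v = v 1 • ![v 0 / v 1, 1] := by
          ext i; fin_cases i <;> simp [mul_div_cancel₀, hv]
        have : eval v Q = v 1 ^ (b + 1) * c := by
          rw [e, eval_smul_of_isHomogeneous hQ, ← hge]; simp
        simp [this, mul_comm]
    exact mul_left_cancel₀ (X_ne_zero 1) this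
  exact hne ⟨![1, 0], fun h => one_ne_zero (congrFun h 0)⟩ (by rw [this]; simp)

lemma finite_zeros {Q : MvPolynomial (Fin 2) k} {b : ℕ} (hQ : Q.IsHomogeneous b) (h0 : Q ≠ 0) :
    {p : P1 k | ∃ z : Coord k, z.pt = p ∧ eval z.1 Q = 0}.Finite := by
  induction b generalizing Q with
  | zero =>
    obtain ⟨c, rfl⟩ := exists_eq_C hQ
    have hc : c ≠ 0 := by rintro rfl; simp at h0
    convert Set.finite_empty
    ext p; simp [hc]
  | succ b ih =>
    obtain ⟨v, hv⟩ := exists_zero_of_isHomogeneous hQ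
    obtain ⟨Q', hQ', rfl⟩ := linForm_dvd hQ hv
    refine ((ih hQ' (right_ne_zero_of_mul h0)).union (Set.finite_singleton v.pt)).subset ?_
    rintro _ ⟨z, rfl, hz⟩
    rw [map_mul, mul_eq_zero] at hz
    rcases hz with hz | hz
    · exact Or.inr (eval_linForm_eq_zero.1 hz)
    · exact Or.inl ⟨z, rfl, hz⟩

/-- The Zariski topology of the projective line is the cofinite topology. -/
lemma finite_of_eventually {p : P1 k → Prop} {z : Coord k} (h : ∀ᶠ z' : Coord k in 𝓝 z, p z'.pt) :
    {q | ¬ p q}.Finite := by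
  obtain ⟨b, R, hR, h0, h1⟩ := eventually_nhds_iff_exists_form.1 h
  refine (finite_zeros hR (by rintro rfl; simp at h0)).subset fun q hq => ?_
  obtain ⟨z', rfl⟩ := Coord.exists_pt q
  exact ⟨z', rfl, by_contra fun hc => hq (h1 z' hc)⟩

end IsAlgClosed

lemma exists_pow_linForm_mul {Q : MvPolynomial (Fin 2) k} {b : ℕ} (hQ : Q.IsHomogeneous b)
    (h0 : Q ≠ 0) (v : Coord k) : ∃ (m b' : ℕ) (B : MvPolynomial (Fin 2) k),
      B.IsHomogeneous b' ∧ b = m + b' ∧ Q = linForm v.1 ^ m * B ∧ eval v.1 B ≠ 0 := by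
  induction b generalizing Q with
  | zero =>
    refine ⟨0, 0, Q, hQ, rfl, by simp, ?_⟩
    obtain ⟨c, rfl⟩ := exists_eq_C hQ
    have hc : c ≠ 0 := by rintro rfl; simp at h0
    simpa
  | succ b ih =>
    by_cases h : eval v.1 Q = 0
    · obtain ⟨Q', hQ', rfl⟩ := linForm_dvd hQ h
      obtain ⟨m, b', B, hB, rfl, rfl, hv⟩ := ih hQ' (right_ne_zero_of_mul h0)
      exact ⟨m + 1, b', B, hB, by ring, by ring, hv⟩
    · exact ⟨0, b + 1, Q, hQ, by simp, by simp, h⟩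

lemma eventually_notMem {S : Set (P1 k)} (hS : S.Finite) {z : Coord k} (hz : z.pt ∉ S) :
    ∀ᶠ z' : Coord k in 𝓝 z, z'.pt ∉ S := by
  have : ∀ q ∈ S, ∀ᶠ z' : Coord k in 𝓝 z, z'.pt ≠ q := by
    intro q hq
    obtain ⟨v, rfl⟩ := Coord.exists_pt q
    have h := eventually_eval_ne_zero (linForm_isHomogeneous v.1) (z := z)
      (fun h => hz (eval_linForm_eq_zero.1 h ▸ hq))
    exact h.mono fun z' h => fun h' => h (eval_linForm_eq_zero.2 h')
  filter_upwards [(Filter.eventually_all_finite hS).2 this] with z' h hm using h _ hm rfl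

/-- Near a point, the other points of a given finite set can be avoided. -/
lemma eventually_eq_or_notMem {S : Set (P1 k)} (hS : S.Finite) (z : Coord k) :
    ∀ᶠ z' : Coord k in 𝓝 z, z'.pt = z.pt ∨ z'.pt ∉ S := by
  filter_upwards [eventually_notMem (hS.subset (Set.sdiff_subset (t := {z.pt}))) (z := z)
    (fun h => h.2 rfl)] with z' h
  by_contra! hc
  exact h ⟨hc.2, hc.1⟩

end Forms


/-! ### Germs of sections of the Serre twists -/

section Germs

open MvPolynomial Filter Topology

variable {k : Type*} [Field k]

/-- The functions of the homogeneous coordinates that are homogeneous of degree `n`, i.e. the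
(not necessarily regular) sections of `𝒪(n)` over the projective line. -/
def homFun (k : Type*) [Field k] (n : ℤ) : Submodule k (Coord k → k) where
  carrier := {F | ∀ (z z' : Coord k) (c : k), z'.1 = c • z.1 → F z' = c ^ n * F z}
  add_mem' hu hv z z' c h := by
    simp only [Pi.add_apply, hu z z' c h, hv z z' c h, mul_add]
  zero_mem' z z' c h := by simp
  smul_mem' a u hu z z' c h := by
    simp only [Pi.smul_apply, smul_eq_mul, hu z z' c h]; ring

/-- The functions of the homogeneous coordinates that are regular sections of `𝒪(n)` near `z`. -/
def regAt (n : ℤ) (z : Coord k) : Submodule k (Coord k → k) where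
  carrier := {F | ∃ (a b : ℕ) (P Q : MvPolynomial (Fin 2) k), P.IsHomogeneous a ∧
    Q.IsHomogeneous b ∧ (a : ℤ) = b + n ∧ eval z.1 Q ≠ 0 ∧
    ∀ᶠ z' : Coord k in 𝓝 z, F z' * eval z'.1 Q = eval z'.1 P}
  add_mem' := by
    rintro F F' ⟨a, b, P, Q, hP, hQ, hab, h0, hF⟩ ⟨a', b', P', Q', hP', hQ', hab', h0', hF'⟩
    refine ⟨a + b', b + b', P * Q' + P' * Q, Q * Q', ?_, hQ.mul hQ', by push_cast; omega, ?_, ?_⟩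
    · have e : a + b' = a' + b := by omega
      exact (hP.mul hQ').add (e ▸ hP'.mul hQ)
    · simpa using ⟨h0, h0'⟩
    · filter_upwards [hF, hF'] with z' e e'
      simp only [map_mul, map_add, Pi.add_apply]
      rw [← e, ← e']; ring
  zero_mem' := by
    obtain ⟨j, hj⟩ := exists_coord_ne_zero z
    exact ⟨_, _, 0, X j ^ n.natAbs, isHomogeneous_zero _ _ (n.natAbs + n).toNat,
      isHomogeneous_X_pow _ _, by omega, by simp [hj], by simp⟩
  smul_mem' := by
    rintro c F ⟨a, b, P, Q, hP, hQ, hab, h0, hF⟩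
    refine ⟨a, b, C c * P, Q, hP.C_mul c, hQ, hab, h0, ?_⟩
    filter_upwards [hF] with z' e
    rw [Pi.smul_apply, smul_eq_mul, map_mul, eval_C, ← e, mul_assoc]

lemma isTwistRegular_iff {n : ℤ} {V : Set (P1 k)} (hV : IsOpen V) {F : Coord k → k} :
    IsTwistRegular n V F ↔ ∀ z : Coord k, z.pt ∈ V → F ∈ regAt n z := by
  constructor
  · intro h z hz
    obtain ⟨a, b, P, Q, hP, hQ, hab, h0, hF⟩ := h z hz
    refine ⟨a, b, P, Q, hP, hQ, hab, h0, ?_⟩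
    filter_upwards [eventually_eval_ne_zero hQ h0, (isOpen_induced hV).mem_nhds hz] with z' h1 h2
    exact hF z' h2 h1
  · intro h z hz
    obtain ⟨a, b, P, Q, hP, hQ, hab, h0, hF⟩ := h z hz
    obtain ⟨c, R, hR, h0R, hR'⟩ := eventually_nhds_iff_exists_form.1 hF
    refine ⟨a + c, b + c, P * R, Q * R, hP.mul hR, hQ.mul hR, by push_cast; omega,
      by simpa using ⟨h0, h0R⟩, fun z' _ hne => ?_⟩
    rw [map_mul] at hne ⊢
    rw [map_mul, ← mul_assoc, hR' z' (right_ne_zero_of_mul hne)]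

variable {n m : ℤ} {z : Coord k} {F F' : Coord k → k}

lemma regAt_congr (h : ∀ᶠ z' in 𝓝 z, F z' = F' z') : F ∈ regAt n z ↔ F' ∈ regAt n z := by
  constructor
  · rintro ⟨a, b, P, Q, hP, hQ, hab, h0, hF⟩
    exact ⟨a, b, P, Q, hP, hQ, hab, h0, by filter_upwards [h, hF] with z' e e'; rw [← e, e']⟩
  · rintro ⟨a, b, P, Q, hP, hQ, hab, h0, hF⟩
    exact ⟨a, b, P, Q, hP, hQ, hab, h0, by filter_upwards [h, hF] with z' e e'; rw [e, e']⟩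

lemma regAt_of_pt_eq {z' : Coord k} (h : z.pt = z'.pt) (hF : F ∈ regAt n z) : F ∈ regAt n z' := by
  obtain ⟨a, b, P, Q, hP, hQ, hab, h0, hF⟩ := hF
  exact ⟨a, b, P, Q, hP, hQ, hab, (eval_ne_zero_iff_of_pt_eq hQ h).1 h0,
    eventually_nhds_of_pt_eq h hF⟩

lemma eventually_mem_regAt (hF : F ∈ regAt n z) : ∀ᶠ z' in 𝓝 z, F ∈ regAt n z' := by
  obtain ⟨a, b, P, Q, hP, hQ, hab, h0, hF⟩ := hF
  filter_upwards [eventually_eval_ne_zero hQ h0, eventually_eventually_nhds.2 hF] with z' h1 h2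
  exact ⟨a, b, P, Q, hP, hQ, hab, h1, h2⟩

lemma mul_mem_regAt (hF : F ∈ regAt n z) (hF' : F' ∈ regAt m z) :
    (fun z => F z * F' z) ∈ regAt (n + m) z := by
  obtain ⟨a, b, P, Q, hP, hQ, hab, h0, hF⟩ := hF
  obtain ⟨a', b', P', Q', hP', hQ', hab', h0', hF'⟩ := hF'
  refine ⟨_, _, _, _, hP.mul hP', hQ.mul hQ', by push_cast; omega, by simpa using ⟨h0, h0'⟩, ?_⟩
  filter_upwards [hF, hF'] with z' e e'
  rw [map_mul, map_mul, ← e, ← e']; ring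

lemma form_mem_regAt {P : MvPolynomial (Fin 2) k} {a : ℕ} (hP : P.IsHomogeneous a) (z : Coord k) :
    (fun z : Coord k => eval z.1 P) ∈ regAt a z :=
  ⟨a, 0, P, 1, hP, isHomogeneous_one _ _, by simp, by simp, by simp⟩

lemma eventually_ne_zero (hF : F ∈ regAt n z) (h : F z ≠ 0) : ∀ᶠ z' in 𝓝 z, F z' ≠ 0 := by
  obtain ⟨a, b, P, Q, hP, hQ, hab, h0, hF⟩ := hF
  have := hF.self_of_nhds
  filter_upwards [hF, eventually_eval_ne_zero hP (z := z) (this ▸ mul_ne_zero h h0)] with z' e e' h'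
  exact e' (by rw [← e, h', zero_mul])

lemma inv_mem_regAt (hF : F ∈ regAt n z) (h : F z ≠ 0) :
    (fun z => (F z)⁻¹) ∈ regAt (-n) z := by
  have hne := eventually_ne_zero hF h
  obtain ⟨a, b, P, Q, hP, hQ, hab, h0, hF⟩ := hF
  refine ⟨b, a, Q, P, hQ, hP, by omega, hF.self_of_nhds ▸ mul_ne_zero h h0, ?_⟩
  filter_upwards [hF, hne] with z' e e'
  rw [← e, inv_mul_cancel_left₀ e']

lemma zpow_mem_regAt (hF : F ∈ regAt 1 z) (h : F z ≠ 0) (n : ℤ) :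
    (fun z => F z ^ n) ∈ regAt n z := by
  have hnat : ∀ j : ℕ, (fun z => F z ^ j) ∈ regAt j z := fun j => by
    induction j with
    | zero => simpa using form_mem_regAt (isHomogeneous_one (Fin 2) k) z
    | succ j ih => simpa [pow_succ] using mul_mem_regAt ih hF
  rcases n with j | j
  · simpa using hnat j
  · simp only [zpow_negSucc]
    exact inv_mem_regAt (hnat (j + 1)) (pow_ne_zero _ h)

lemma mul_mem_homFun (hF : F ∈ homFun k n) (hF' : F' ∈ homFun k m) :
    (fun z => F z * F' z) ∈ homFun k (n + m) := fun z z' c h => by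
  simp only [hF z z' c h, hF' z z' c h, zpow_add₀ (Coord.ne_zero_of_eq_smul h)]; ring

lemma zpow_mem_homFun (hF : F ∈ homFun k n) (m : ℤ) : (fun z => F z ^ m) ∈ homFun k (n * m) :=
  fun z z' c h => by simp only [hF z z' c h, mul_zpow, zpow_mul]

lemma form_mem_homFun {P : MvPolynomial (Fin 2) k} {a : ℕ} (hP : P.IsHomogeneous a) :
    (fun z : Coord k => eval z.1 P) ∈ homFun k a := fun z z' c h => by
  simp only [h, eval_smul_of_isHomogeneous hP, zpow_natCast]

lemma eq_zero_iff_of_mem_homFun (hF : F ∈ homFun k n) {z z' : Coord k} (h : z.pt = z'.pt) :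
    F z = 0 ↔ F z' = 0 := by
  obtain ⟨c, hc⟩ := Coord.pt_eq_iff.1 h
  rw [hF z' z c hc]
  simp [zpow_ne_zero n (Coord.ne_zero_of_eq_smul hc)]

/-- Restricting a homogeneous function to a set of points of the projective line (extension by
zero). -/
lemma indicator_mem_homFun (hF : F ∈ homFun k n) (p : P1 k → Prop) [DecidablePred p] :
    (fun z : Coord k => if p z.pt then F z else 0) ∈ homFun k n := fun z z' c h => by
  have e : z'.pt = z.pt := Coord.pt_eq_iff.2 ⟨c, h⟩
  simp only [e, hF z z' c h, mul_ite, mul_zero]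

lemma isHomogeneous_of_mem_sym {P : MvPolynomial (Fin 2) k} {a : ℕ} (hP : P ∈ sym k a) :
    P.IsHomogeneous a := hP

/-- An element of `Sym^n` is a form of degree `n`, or `n < 0` and it is zero. -/
lemma mem_sym_cases {P : MvPolynomial (Fin 2) k} (hP : P ∈ sym k n) :
    (∃ a : ℕ, n = a ∧ P.IsHomogeneous a) ∨ (n < 0 ∧ P = 0) := by
  rcases n with a | a
  · exact Or.inl ⟨a, rfl, hP⟩
  · exact Or.inr ⟨Int.negSucc_lt_zero a, hP⟩

lemma sym_mem_regAt {P : MvPolynomial (Fin 2) k} (hP : P ∈ sym k n) (z : Coord k) :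
    (fun z : Coord k => eval z.1 P) ∈ regAt n z := by
  rcases mem_sym_cases hP with ⟨a, rfl, hP⟩ | ⟨_, rfl⟩
  · exact form_mem_regAt hP z
  · simp only [map_zero]
    exact (regAt n z).zero_mem

lemma sym_mem_homFun {P : MvPolynomial (Fin 2) k} (hP : P ∈ sym k n) :
    (fun z : Coord k => eval z.1 P) ∈ homFun k n := by
  rcases mem_sym_cases hP with ⟨a, rfl, hP⟩ | ⟨_, rfl⟩
  · exact form_mem_homFun hP
  · simp only [map_zero]
    exact (homFun k n).zero_mem

section Infinite

variable [Infinite k]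

/-- Two fractions representing the same function, possibly near different points, are equal: the
projective line is irreducible. -/
lemma mul_eq_mul_of_eventually {z₁ z₂ : Coord k} {P Q P' Q' : MvPolynomial (Fin 2) k}
    (h : ∀ᶠ z : Coord k in 𝓝 z₁, F z * eval z.1 Q = eval z.1 P)
    (h' : ∀ᶠ z : Coord k in 𝓝 z₂, F z * eval z.1 Q' = eval z.1 P') : P * Q' = P' * Q := by
  obtain ⟨b, R, hR, h0, h1⟩ := eventually_nhds_iff_exists_form.1 h
  obtain ⟨b', R', hR', h0', h1'⟩ := eventually_nhds_iff_exists_form.1 h'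
  have hne : R * R' ≠ 0 := mul_ne_zero (by rintro rfl; simp at h0) (by rintro rfl; simp at h0')
  refine mul_left_cancel₀ hne (eq_of_eval_coord fun z => ?_)
  simp only [map_mul]
  by_cases hz : eval z.1 R = 0
  · simp [hz]
  by_cases hz' : eval z.1 R' = 0
  · simp [hz']
  · rw [← h1 z hz, ← h1' z hz']; ring

lemma mul_eq_of_mem_regAt {z₁ z₂ : Coord k} {P Q : MvPolynomial (Fin 2) k}
    (h : ∀ᶠ z : Coord k in 𝓝 z₁, F z * eval z.1 Q = eval z.1 P) (h' : F ∈ regAt n z₂) :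
    F z₂ * eval z₂.1 Q = eval z₂.1 P := by
  obtain ⟨a, b, P', Q', hP', hQ', hab, h0, hF⟩ := h'
  have e := congrArg (eval z₂.1) (mul_eq_mul_of_eventually h hF)
  simp only [map_mul] at e
  refine mul_right_cancel₀ h0 ?_
  rw [e, ← hF.self_of_nhds]; ring

end Infinite

section IsAlgClosed

variable [IsAlgClosed k]

/-- A section of `𝒪(n)` that is regular everywhere and a fraction `P / Q` near a point is a form:
the zeros of `Q` are zeros of `P`, and the corresponding linear factors are cancelled one at a time.
-/
lemma exists_form_of_mul_eq {b a : ℕ} {P Q : MvPolynomial (Fin 2) k} (hP : P.IsHomogeneous a)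
    (hQ : Q.IsHomogeneous b) (hab : (a : ℤ) = b + n) (hQ0 : Q ≠ 0)
    (hreg : ∀ z, F ∈ regAt n z) {z₀ : Coord k}
    (h : ∀ᶠ z : Coord k in 𝓝 z₀, F z * eval z.1 Q = eval z.1 P) :
    ∃ P' ∈ sym k n, ∀ z : Coord k, F z = eval z.1 P' := by
  have hall : ∀ z : Coord k, F z * eval z.1 Q = eval z.1 P := fun z =>
    mul_eq_of_mem_regAt h (hreg z)
  obtain ⟨z₁, hz₁⟩ := exists_eval_ne_zero hQ0
  induction b generalizing P Q a z₀ with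
  | zero =>
    obtain ⟨c, rfl⟩ := exists_eq_C hQ
    have hc : c ≠ 0 := by rintro rfl; simp at hQ0
    obtain rfl : n = a := by omega
    refine ⟨C c⁻¹ * P, (hP.C_mul c⁻¹ : _), fun z => ?_⟩
    rw [map_mul, eval_C, ← hall z, eval_C, mul_comm, mul_inv_cancel_right₀ hc]
  | succ b ih =>
    by_cases hP0 : P = 0
    · subst hP0
      refine ⟨0, Submodule.zero_mem _, fun z => ?_⟩
      have : ∀ᶠ z : Coord k in 𝓝 z₁, F z * eval z.1 1 = eval z.1 0 := by
        filter_upwards [eventually_eval_ne_zero hQ hz₁] with z hz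
        simpa [hz] using hall z
      simpa using mul_eq_of_mem_regAt this (hreg z)
    obtain ⟨v, hv⟩ := exists_zero_of_isHomogeneous hQ
    obtain ⟨Q', hQ', rfl⟩ := linForm_dvd hQ hv
    have hPv : eval v.1 P = 0 := by rw [← hall v, hv, mul_zero]
    rcases a with _ | a
    · obtain ⟨c, rfl⟩ := exists_eq_C hP
      simp_all
    obtain ⟨P', hP', rfl⟩ := linForm_dvd hP hPv
    have h₁ : ∀ᶠ z : Coord k in 𝓝 z₁, F z * eval z.1 Q' = eval z.1 P' := by
      rw [map_mul] at hz₁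
      filter_upwards [eventually_eval_ne_zero (linForm_isHomogeneous _) (left_ne_zero_of_mul hz₁)]
        with z hz
      have := hall z
      rw [map_mul, map_mul] at this
      exact mul_left_cancel₀ hz (by rw [← this]; ring)
    exact ih hP' hQ' (by push_cast at hab; omega) (right_ne_zero_of_mul hQ0) h₁
      (fun z => mul_eq_of_mem_regAt h₁ (hreg z)) (by
        rw [map_mul] at hz₁
        exact right_ne_zero_of_mul hz₁)

/-- The global regular sections of `𝒪(n)` are the forms of degree `n`. -/
lemma exists_sym_of_forall_regAt (hreg : ∀ z, F ∈ regAt n z) :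
    ∃ P ∈ sym k n, ∀ z : Coord k, F z = eval z.1 P := by
  let z₀ : Coord k := nodeCoord
  obtain ⟨a, b, P, Q, hP, hQ, hab, h0, hF⟩ := hreg z₀
  exact exists_form_of_mul_eq hP hQ hab (by rintro rfl; simp at h0) hreg hF

lemma eq_zero_of_forall_regAt (hn : n < 0) (hreg : ∀ z, F ∈ regAt n z) : F = 0 := by
  obtain ⟨P, hP, h⟩ := exists_sym_of_forall_regAt hreg
  rcases mem_sym_cases hP with ⟨a, rfl, _⟩ | ⟨_, rfl⟩
  · omega
  · funext z; simp [h]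

lemma exists_ne_zero_nhds {S : Set (P1 k)} (hS : S.Finite) (z₀ : Coord k) {p : Coord k → Prop}
    (h : ∀ᶠ z in 𝓝 z₀, p z) : ∃ z, z.pt ∉ S ∧ p z := by
  obtain ⟨b, R, hR, h0, h1⟩ := eventually_nhds_iff_exists_form.1 h
  lift S to Finset (P1 k) using hS
  choose v hv using Coord.exists_pt (k := k)
  have hne : R * ∏ q ∈ S, linForm (v q).1 ≠ 0 :=
    mul_ne_zero (by rintro rfl; simp at h0) (Finset.prod_ne_zero_iff.2 fun q _ => linForm_ne_zero _)
  obtain ⟨z, hz⟩ := exists_eval_ne_zero hne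
  rw [map_mul, map_prod] at hz
  refine ⟨z, fun hmem => ?_, h1 z (left_ne_zero_of_mul hz)⟩
  exact Finset.prod_ne_zero_iff.1 (right_ne_zero_of_mul hz) _ hmem
    (eval_linForm_eq_zero.2 (hv _).symm)

/-- A section of `𝒪(n)` regular on a punctured neighbourhood of a point is a fraction there. -/
lemma exists_fraction_of_punctured {z₀ : Coord k}
    (h : ∀ᶠ z in 𝓝 z₀, z.pt ≠ z₀.pt → F ∈ regAt n z) :
    ∃ (a b : ℕ) (P Q : MvPolynomial (Fin 2) k), P.IsHomogeneous a ∧ Q.IsHomogeneous b ∧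
      (a : ℤ) = b + n ∧ Q ≠ 0 ∧
      ∀ᶠ z : Coord k in 𝓝 z₀, z.pt ≠ z₀.pt → F z * eval z.1 Q = eval z.1 P := by
  obtain ⟨z₁, h1, h2⟩ := exists_ne_zero_nhds (Set.finite_singleton z₀.pt) z₀ h
  obtain ⟨a, b, P, Q, hP, hQ, hab, h0, hF⟩ := h2 h1
  refine ⟨a, b, P, Q, hP, hQ, hab, by rintro rfl; simp at h0, ?_⟩
  filter_upwards [h] with z hz hne
  exact mul_eq_of_mem_regAt hF (hz hne)

/-- Principal parts: for `n ≥ -1`, the polar part at `z₀` of a fraction of degree `n` is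
the restriction of a section of `𝒪(n)` whose only pole is `z₀`. One lowers the order of the pole by
subtracting multiples of `X_j^{m+n} / l^m`, where `l` vanishes at `z₀` and `X_j` does not. -/
lemma exists_principal_part (hn : -1 ≤ n) (hF : F ∈ homFun k n) {z₀ : Coord k}
    (h : ∀ᶠ z in 𝓝 z₀, z.pt ≠ z₀.pt → F ∈ regAt n z) :
    ∃ e ∈ homFun k n, (∀ z, z.pt ≠ z₀.pt → e ∈ regAt n z) ∧ F - e ∈ regAt n z₀ := by
  classical
  obtain ⟨a, A, m, b', B, hA, hB, hb', hab, hB0, hfr⟩ : ∃ (a : ℕ) (A : MvPolynomial (Fin 2) k)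
      (m b' : ℕ) (B : MvPolynomial (Fin 2) k), A.IsHomogeneous a ∧ B.IsHomogeneous b' ∧ 1 ≤ b' ∧
      (a : ℤ) = m + b' + n ∧ eval z₀.1 B ≠ 0 ∧ ∀ᶠ z : Coord k in 𝓝 z₀, z.pt ≠ z₀.pt →
        F z * eval z.1 (linForm z₀.1 ^ m * B) = eval z.1 A := by
    obtain ⟨a, b, A, Q, hA, hQ, hab, hQ0, hfr⟩ := exists_fraction_of_punctured h
    obtain ⟨m, b', B, hB, rfl, rfl, hB0⟩ := exists_pow_linForm_mul hQ hQ0 z₀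
    obtain ⟨j, hj⟩ := exists_coord_ne_zero z₀
    -- The factor `X_j` keeps the degree of the numerator positive in the induction below.
    refine ⟨_, A * X j, m, _, B * X j, hA.mul (isHomogeneous_X k j), hB.mul (isHomogeneous_X k j),
      by omega, by push_cast at hab ⊢; omega, by simpa using ⟨hB0, hj⟩, ?_⟩
    filter_upwards [hfr] with z hz hne
    rw [← mul_assoc, map_mul, ← mul_assoc, hz hne, map_mul]
  clear h
  set l := linForm z₀.1
  have hl : ∀ z : Coord k, z.pt ≠ z₀.pt → eval z.1 l ≠ 0 := fun z => mt eval_linForm_eq_zero.1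
  induction m generalizing F A a with
  | zero =>
    -- Here `A / B` is regular at `z₀`, and `F` differs from it near `z₀` at most in its value at
    -- `z₀`.
    have hAB : (fun z : Coord k => eval z.1 A * (eval z.1 B)⁻¹) ∈ regAt n z₀ := by
      have := mul_mem_regAt (form_mem_regAt hA z₀) (inv_mem_regAt (form_mem_regAt hB z₀) hB0)
      rwa [show (a : ℤ) + -b' = n by push_cast at hab; omega] at this
    have hAB' : (fun z : Coord k => eval z.1 A * (eval z.1 B)⁻¹) ∈ homFun k n := by
      have := mul_mem_homFun (form_mem_homFun hA) (zpow_mem_homFun (form_mem_homFun hB) (-1))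
      simpa [show (a : ℤ) + -b' = n by push_cast at hab; omega] using this
    refine ⟨fun z => if z.pt = z₀.pt then F z - eval z.1 A * (eval z.1 B)⁻¹ else 0,
      indicator_mem_homFun (sub_mem hF hAB') (· = z₀.pt), fun z hz => ?_, ?_⟩
    · refine (regAt_congr (F' := 0) ?_).2 (zero_mem _)
      filter_upwards [eventually_notMem (Set.finite_singleton z₀.pt) hz] with z' hz'
      exact if_neg hz'
    · refine (regAt_congr ?_).2 hAB
      filter_upwards [hfr, eventually_eval_ne_zero hB hB0] with z' hz' hne
      by_cases e : z'.pt = z₀.pt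
      · simp [e]
      · simp only [Pi.sub_apply, if_neg e, sub_zero, pow_zero, one_mul] at hz' ⊢
        rw [← hz' e, mul_inv_cancel_right₀ hne]
  | succ m ih =>
    obtain ⟨j, hj⟩ := exists_coord_ne_zero z₀
    set d := (m + 1 + n).toNat with hd
    have hdn : (d : ℤ) = m + 1 + n := by omega
    -- The constant `c` is such that `A - c X_j ^ d B`, the numerator of `F - c X_j ^ d / l ^ (m +
    -- 1)`, vanishes at `z₀`; hence `l` divides it and the order of the pole drops.
    set c := eval z₀.1 A / (z₀.1 j ^ d * eval z₀.1 B) with hc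
    have hXd := isHomogeneous_X_pow (R := k) j d
    have hA' : (A - C c * (X j ^ d * B)).IsHomogeneous a := by
      have e : d + b' = a := by push_cast at hab; omega
      exact hA.sub (e ▸ (hXd.mul hB).C_mul c)
    have hev : eval z₀.1 (A - C c * (X j ^ d * B)) = 0 := by
      simp only [map_sub, map_mul, eval_C, map_pow, eval_X, hc]
      rw [div_mul_cancel₀ _ (mul_ne_zero (pow_ne_zero _ hj) hB0), sub_self]
    obtain ⟨a, rfl⟩ : ∃ a', a = a' + 1 := ⟨a - 1, by push_cast at hab; omega⟩
    obtain ⟨A', hA', hAA⟩ := linForm_dvd hA' hev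
    set e₁ : Coord k → k := fun z => c * (z.1 j ^ d * (eval z.1 l ^ (m + 1))⁻¹) with he₁
    have hlm := (linForm_isHomogeneous z₀.1).pow (m + 1)
    have he₁h : e₁ ∈ homFun k n := by
      have := (homFun k _).smul_mem c
        (mul_mem_homFun (form_mem_homFun hXd) (zpow_mem_homFun (form_mem_homFun hlm) (-1)))
      rw [show ((d : ℤ) + ↑(1 * (m + 1)) * -1) = n by push_cast; omega] at this
      convert this using 1
      funext z
      simp [he₁, l]
    have he₁r : ∀ z, z.pt ≠ z₀.pt → e₁ ∈ regAt n z := fun z hz => by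
      have := (regAt _ z).smul_mem c (mul_mem_regAt (form_mem_regAt hXd z)
        (inv_mem_regAt (form_mem_regAt hlm z) (by simpa using hl z hz)))
      rw [show ((d : ℤ) + -↑(1 * (m + 1))) = n by push_cast; omega] at this
      convert this using 1
      funext z
      simp [he₁, l]
    obtain ⟨e₂, he₂, h1, h2⟩ := ih (sub_mem hF he₁h) _ _ hA' (by push_cast at hab ⊢; omega) (by
      filter_upwards [hfr] with z hz hne
      have hlz := hl z hne
      have e := congrArg (eval z.1) hAA
      have e' := hz hne
      simp only [map_sub, map_mul, eval_C, map_pow, eval_X] at e e'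
      refine mul_left_cancel₀ hlz ?_
      rw [← e, ← e']
      simp only [he₁, Pi.sub_apply, map_mul, map_pow]
      field_simp
      ring)
    exact ⟨e₁ + e₂, add_mem he₁h he₂, fun z hz => add_mem (he₁r z hz) (h1 z hz),
      by rwa [← sub_sub]⟩

end IsAlgClosed

end Germs


/-! ### The first cohomology of the Serre twists on the projective line -/

section Cocycles

open MvPolynomial Filter Topology

variable {k : Type*} [Field k] {n m : ℤ}

/-- The families `D` of sections of `𝒪(n)` representing a global section of the quotient of
the sheaf of all sections by the sheaf of regular sections: `D p` represents it near `p`. -/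
def cocycles (k : Type*) [Field k] (n : ℤ) : Submodule k (P1 k → Coord k → k) where
  carrier := {D | (∀ p, D p ∈ homFun k n) ∧
    ∀ z₀ : Coord k, ∀ᶠ z in 𝓝 z₀, D z.pt - D z₀.pt ∈ regAt n z}
  add_mem' {D D'} h h' := ⟨fun p => add_mem (h.1 p) (h'.1 p), fun z₀ => by
    filter_upwards [h.2 z₀, h'.2 z₀] with z hz hz'
    simpa only [Pi.add_apply, add_sub_add_comm] using add_mem hz hz'⟩
  zero_mem' := ⟨fun p => zero_mem _, fun z₀ => Eventually.of_forall fun z => by simp⟩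
  smul_mem' c D h := ⟨fun p => Submodule.smul_mem _ c (h.1 p), fun z₀ => by
    filter_upwards [h.2 z₀] with z hz
    simpa only [Pi.smul_apply, smul_sub] using Submodule.smul_mem _ c hz⟩

/-- The families that come from a global (not necessarily regular) section of `𝒪(n)`. -/
def coboundaries (k : Type*) [Field k] (n : ℤ) : Submodule k (P1 k → Coord k → k) where
  carrier := {D | (∀ p, D p ∈ homFun k n) ∧
    ∃ e ∈ homFun k n, ∀ z : Coord k, D z.pt - e ∈ regAt n z}
  add_mem' := by
    rintro D D' ⟨h, e, he, hr⟩ ⟨h', e', he', hr'⟩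
    refine ⟨fun p => add_mem (h p) (h' p), e + e', add_mem he he', fun z => ?_⟩
    simpa only [Pi.add_apply, add_sub_add_comm] using add_mem (hr z) (hr' z)
  zero_mem' := ⟨fun p => zero_mem _, 0, zero_mem _, fun z => by simp⟩
  smul_mem' := by
    rintro c D ⟨h, e, he, hr⟩
    refine ⟨fun p => Submodule.smul_mem _ c (h p), c • e, Submodule.smul_mem _ c he, fun z => ?_⟩
    simpa only [Pi.smul_apply, smul_sub] using Submodule.smul_mem _ c (hr z)

lemma coboundaries_le_cocycles : coboundaries k n ≤ cocycles k n := by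
  rintro D ⟨h, e, he, hr⟩
  refine ⟨h, fun z₀ => ?_⟩
  filter_upwards [eventually_mem_regAt (hr z₀)] with z hz
  simpa using sub_mem (hr z) hz

lemma mul_mem_cocycles {P : MvPolynomial (Fin 2) k} (hP : P ∈ sym k m) {D : P1 k → Coord k → k}
    (hD : D ∈ cocycles k n) : (fun p z => eval z.1 P * D p z) ∈ cocycles k (m + n) := by
  refine ⟨fun p => mul_mem_homFun (sym_mem_homFun hP) (hD.1 p), fun z₀ => ?_⟩
  filter_upwards [hD.2 z₀] with z hz
  convert mul_mem_regAt (sym_mem_regAt hP z) hz using 1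
  funext z'
  simp only [Pi.sub_apply]; ring

variable [IsAlgClosed k]

/-- The first cohomology of `𝒪(n)` vanishes for `n ≥ -1`. -/
lemma cocycles_le_coboundaries (hn : -1 ≤ n) : cocycles k n ≤ coboundaries k n := by
  classical
  intro D hD
  refine ⟨hD.1, ?_⟩
  let z₀ : Coord k := nodeCoord
  have hfin := finite_of_eventually
    (p := fun p => ∀ z : Coord k, z.pt = p → D p - D z₀.pt ∈ regAt n z)
    (z := z₀) (by
      filter_upwards [hD.2 z₀] with z hz z' hz'
      exact regAt_of_pt_eq hz'.symm hz)
  -- Outside the finite set `S`, the family is represented by the single section `D z₀.pt`. The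
  -- global section sought is the sum of the latter and the principal parts of the differences at
  -- `S`.
  set S := hfin.toFinset with hS
  have hmem : ∀ z : Coord k, z.pt ∉ S → D z.pt - D z₀.pt ∈ regAt n z := fun z hz => by
    simp only [hS, Set.Finite.mem_toFinset, Set.mem_ofPred_eq, not_not] at hz
    exact hz z rfl
  choose v hv using Coord.exists_pt (k := k)
  have hpp : ∀ s : P1 k, ∃ e ∈ homFun k n, (∀ z : Coord k, z.pt ≠ s → e ∈ regAt n z) ∧
      (D s - D z₀.pt) - e ∈ regAt n (v s) := fun s => by
    obtain ⟨e, he, h1, h2⟩ := exists_principal_part hn (sub_mem (hD.1 s) (hD.1 z₀.pt))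
      (z₀ := v s) (by
      filter_upwards [hD.2 (v s), eventually_eq_or_notMem S.finite_toSet (v s)] with z hz hz' hne
      rw [hv] at hz
      have := sub_mem (hmem z (by simpa [hne] using hz')) hz
      simpa using this)
    exact ⟨e, he, fun z hz => h1 z (by rwa [hv]), h2⟩
  choose e he hereg hepp using hpp
  refine ⟨D z₀.pt + ∑ s ∈ S, e s, add_mem (hD.1 _) (Submodule.sum_mem _ fun s _ => he s),
    fun z => ?_⟩
  by_cases hz : z.pt ∈ S
  · rw [← Finset.add_sum_erase _ _ hz, ← add_assoc, ← sub_sub, ← sub_sub]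
    refine sub_mem (regAt_of_pt_eq (hv z.pt) (hepp z.pt)) (Submodule.sum_mem _ fun s hs => ?_)
    exact hereg s z (Finset.ne_of_mem_erase hs).symm
  · rw [← sub_sub]
    refine sub_mem (hmem z hz) (Submodule.sum_mem _ fun s hs => ?_)
    exact hereg s z (by rintro rfl; exact hz hs)

/-- `HasResidue D P c` : the class of the family `D`, multiplied by the form `P`, has residue `c`.
Here `P D` represents a class in the cohomology of `𝒪(-2)`, and its residue is the image under
the Koszul sequence `0 → 𝒪(-2) → 𝒪(-1)² → 𝒪 → 0`: each `z_j P D` bounds a unique `e_j`, and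
`z₁ e₀ - z₀ e₁` is a regular function, hence constant. -/
def HasResidue (D : P1 k → Coord k → k) (P : MvPolynomial (Fin 2) k) (c : k) : Prop :=
  ∃ e : Fin 2 → Coord k → k, (∀ j, e j ∈ homFun k (-1)) ∧
    (∀ j (z : Coord k), (fun y : Coord k => y.1 j * (eval y.1 P * D z.pt y)) - e j ∈ regAt (-1) z) ∧
    ∀ z : Coord k, z.1 1 * e 0 z - z.1 0 * e 1 z = c

/-- A section of `𝒪(-1)` bounding a given family is unique. -/
lemma eq_of_sub_mem_regAt {E : Coord k → Coord k → k} {e e' : Coord k → k}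
    (h : ∀ z, E z - e ∈ regAt (-1) z) (h' : ∀ z, E z - e' ∈ regAt (-1) z) : e = e' :=
  sub_eq_zero.1 (eq_zero_of_forall_regAt (n := -1) (by norm_num) fun z => by
    simpa using sub_mem (h' z) (h z))

lemma HasResidue.unique {D : P1 k → Coord k → k} {P : MvPolynomial (Fin 2) k} {c c' : k}
    (h : HasResidue D P c) (h' : HasResidue D P c') : c = c' := by
  obtain ⟨e, -, he, hc⟩ := h
  obtain ⟨e', -, he', hc'⟩ := h'
  rw [← hc nodeCoord, ← hc' nodeCoord, eq_of_sub_mem_regAt (he 0) (he' 0),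
    eq_of_sub_mem_regAt (he 1) (he' 1)]

omit [IsAlgClosed k] in
lemma HasResidue.add_left {D D' : P1 k → Coord k → k} {P : MvPolynomial (Fin 2) k} {c c' : k}
    (h : HasResidue D P c) (h' : HasResidue D' P c') : HasResidue (D + D') P (c + c') := by
  obtain ⟨e, h1, h2, h3⟩ := h
  obtain ⟨e', h1', h2', h3'⟩ := h'
  refine ⟨e + e', fun j => add_mem (h1 j) (h1' j), fun j z => ?_, fun z => ?_⟩
  · convert add_mem (h2 j z) (h2' j z) using 1
    funext y; simp only [Pi.add_apply, Pi.sub_apply]; ring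
  · rw [← h3 z, ← h3' z]; simp only [Pi.add_apply]; ring

omit [IsAlgClosed k] in
lemma HasResidue.smul_left {D : P1 k → Coord k → k} {P : MvPolynomial (Fin 2) k} {c : k}
    (h : HasResidue D P c) (a : k) : HasResidue (a • D) P (a * c) := by
  obtain ⟨e, h1, h2, h3⟩ := h
  refine ⟨a • e, fun j => Submodule.smul_mem _ a (h1 j), fun j z => ?_, fun z => ?_⟩
  · convert Submodule.smul_mem _ a (h2 j z) using 1
    funext y; simp only [Pi.smul_apply, Pi.sub_apply, smul_eq_mul]; ring
  · rw [← h3 z]; simp only [Pi.smul_apply, smul_eq_mul]; ring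

omit [IsAlgClosed k] in
lemma HasResidue.add_right {D : P1 k → Coord k → k} {P P' : MvPolynomial (Fin 2) k} {c c' : k}
    (h : HasResidue D P c) (h' : HasResidue D P' c') : HasResidue D (P + P') (c + c') := by
  obtain ⟨e, h1, h2, h3⟩ := h
  obtain ⟨e', h1', h2', h3'⟩ := h'
  refine ⟨e + e', fun j => add_mem (h1 j) (h1' j), fun j z => ?_, fun z => ?_⟩
  · convert add_mem (h2 j z) (h2' j z) using 1
    funext y; simp only [Pi.add_apply, Pi.sub_apply, map_add]; ring
  · rw [← h3 z, ← h3' z]; simp only [Pi.add_apply]; ring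

omit [IsAlgClosed k] in
lemma HasResidue.smul_right {D : P1 k → Coord k → k} {P : MvPolynomial (Fin 2) k} {c : k}
    (h : HasResidue D P c) (a : k) : HasResidue D (a • P) (a * c) := by
  obtain ⟨e, h1, h2, h3⟩ := h
  refine ⟨a • e, fun j => Submodule.smul_mem _ a (h1 j), fun j z => ?_, fun z => ?_⟩
  · convert Submodule.smul_mem _ a (h2 j z) using 1
    funext y; simp only [Pi.smul_apply, Pi.sub_apply, smul_eq_mul, smul_eval]; ring
  · rw [← h3 z]; simp only [Pi.smul_apply, smul_eq_mul]; ring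

omit [IsAlgClosed k] in
lemma X_mul_mem_sym (j : Fin 2) {P : MvPolynomial (Fin 2) k} (hP : P ∈ sym k (-2 - n)) :
    X j * P ∈ sym k (-1 - n) := by
  rcases mem_sym_cases hP with ⟨a, ha, hP⟩ | ⟨_, rfl⟩
  · have e : (-1 - n) = ((1 + a : ℕ) : ℤ) := by push_cast; omega
    rw [e]
    exact (isHomogeneous_X k j).mul hP
  · rw [mul_zero]; exact zero_mem _

lemma exists_bounding {D : P1 k → Coord k → k} (hD : D ∈ cocycles k n) {P : MvPolynomial (Fin 2) k}
    (hP : P ∈ sym k (-1 - n)) : ∃ e ∈ homFun k (-1), ∀ z : Coord k,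
      (fun y : Coord k => eval y.1 P * D z.pt y) - e ∈ regAt (-1) z := by
  have h := mul_mem_cocycles hP hD
  rw [show -1 - n + n = -1 by ring] at h
  exact (cocycles_le_coboundaries le_rfl h).2

lemma exists_hasResidue {D : P1 k → Coord k → k} (hD : D ∈ cocycles k n)
    {P : MvPolynomial (Fin 2) k} (hP : P ∈ sym k (-2 - n)) : ∃ c, HasResidue D P c := by
  have := fun j => exists_bounding hD (X_mul_mem_sym j hP)
  simp only [map_mul, eval_X, mul_assoc] at this
  choose e he h using this
  have hreg : ∀ z : Coord k, (fun z : Coord k => z.1 1 * e 0 z - z.1 0 * e 1 z) ∈ regAt 0 z := by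
    intro z
    have h0 := mul_mem_regAt (form_mem_regAt (isHomogeneous_X k (1 : Fin 2)) z) (h 0 z)
    have h1 := mul_mem_regAt (form_mem_regAt (isHomogeneous_X k (0 : Fin 2)) z) (h 1 z)
    convert sub_mem h1 h0 using 1
    · simp
    · funext y
      simp only [Pi.sub_apply, eval_X]; ring
  -- A regular function on the projective line is constant.
  obtain ⟨Q, hQ, hQe⟩ := exists_sym_of_forall_regAt hreg
  obtain ⟨c, rfl⟩ := exists_eq_C (isHomogeneous_of_mem_sym (a := 0) hQ)
  exact ⟨c, e, he, h, fun z => by simpa using hQe z⟩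

omit [IsAlgClosed k] in
lemma hasResidue_zero_of_mem_coboundaries {D : P1 k → Coord k → k} (hD : D ∈ coboundaries k n)
    {P : MvPolynomial (Fin 2) k} (hP : P ∈ sym k (-2 - n)) : HasResidue D P 0 := by
  obtain ⟨-, E, hE, hr⟩ := hD
  refine ⟨fun j y => y.1 j * (eval y.1 P * E y), fun j => ?_, fun j z => ?_, fun z => by ring⟩
  · have := mul_mem_homFun (form_mem_homFun (isHomogeneous_X k j))
      (mul_mem_homFun (sym_mem_homFun hP) hE)
    convert this using 1
    · congr 1; push_cast; ring
    · simp
  · convert mul_mem_regAt (form_mem_regAt (isHomogeneous_X k j) z)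
      (mul_mem_regAt (sym_mem_regAt hP z) (hr z)) using 1
    · congr 1; push_cast; ring
    · funext y; simp only [Pi.sub_apply, eval_X]; ring

/-- The pairing with forms detects classes: if all residues vanish, the sections bounding the
`z₀^a z₁^b D` with `a + b = -1 - n` are of the form `z₀^a z₁^b e`. -/
lemma mem_coboundaries_of_hasResidue_zero {D : P1 k → Coord k → k} (hD : D ∈ cocycles k n)
    (h : ∀ P ∈ sym k (-2 - n), HasResidue D P 0) : D ∈ coboundaries k n := by
  classical
  rcases le_or_gt (-1) n with hn | hn
  · exact cocycles_le_coboundaries hn hD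
  obtain ⟨m, hm⟩ : ∃ m : ℕ, -2 - n = m := ⟨(-2 - n).toNat, by omega⟩
  have hmon : ∀ a b : ℕ, a + b = m + 1 → (X 0 ^ a * X 1 ^ b : MvPolynomial (Fin 2) k) ∈
      sym k (-1 - n) := fun a b hab => by
    have e : (-1 - n) = ((a + b : ℕ) : ℤ) := by omega
    rw [e]
    exact (isHomogeneous_X_pow 0 a).mul (isHomogeneous_X_pow 1 b)
  have hex : ∀ a b : ℕ, ∃ e : Coord k → k, a + b = m + 1 → e ∈ homFun k (-1) ∧ ∀ z : Coord k,
      (fun y : Coord k => y.1 0 ^ a * y.1 1 ^ b * D z.pt y) - e ∈ regAt (-1) z := fun a b => by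
    by_cases hab : a + b = m + 1
    · obtain ⟨e, he, hr⟩ := exists_bounding hD (hmon a b hab)
      exact ⟨e, fun _ => ⟨he, by simpa using hr⟩⟩
    · exact ⟨0, fun h => absurd h hab⟩
  -- `E a b` bounds `z₀ ^ a z₁ ^ b D`. The vanishing of the residues gives
  -- `z₁ E (a + 1) b = z₀ E a (b + 1)`.
  choose E hE using hex
  have hstep : ∀ a b : ℕ, a + b = m → ∀ z : Coord k,
      z.1 1 * E (a + 1) b z = z.1 0 * E a (b + 1) z := by
    intro a b hab z
    obtain ⟨e, -, he, hc⟩ := h (X 0 ^ a * X 1 ^ b) (by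
      rw [hm, ← hab]
      exact (isHomogeneous_X_pow 0 a).mul (isHomogeneous_X_pow 1 b))
    have h0 : E (a + 1) b = e 0 := eq_of_sub_mem_regAt (hE (a + 1) b (by omega)).2 fun z => by
      convert he 0 z using 2
      funext y; simp only [map_mul, map_pow, eval_X]; ring
    have h1 : E a (b + 1) = e 1 := eq_of_sub_mem_regAt (hE a (b + 1) (by omega)).2 fun z => by
      convert he 1 z using 2
      funext y; simp only [map_mul, map_pow, eval_X]; ring
    rw [h0, h1]
    exact sub_eq_zero.1 (hc z)
  have hiter : ∀ j ≤ m + 1, ∀ z : Coord k,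
      z.1 1 ^ j * E j (m + 1 - j) z = z.1 0 ^ j * E 0 (m + 1) z := by
    intro j hj z
    induction j with
    | zero => simp
    | succ j ih =>
      have e := hstep j (m - j) (by omega) z
      rw [show m - j + 1 = m + 1 - j by omega] at e
      rw [show m + 1 - (j + 1) = m - j by omega, pow_succ, mul_assoc, e, mul_left_comm,
        ih (by omega)]
      ring
  -- Hence `E (m + 1) 0 / z₀ ^ (m + 1)` and `E 0 (m + 1) / z₁ ^ (m + 1)` agree where both are
  -- defined; together they form a section bounding `D`.
  have hkey := hiter (m + 1) le_rfl
  rw [Nat.sub_self] at hkey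
  have hn' : (-1 : ℤ) + -((m + 1 : ℕ) : ℤ) = n := by push_cast; omega
  have hh0 := mul_mem_homFun (hE (m + 1) 0 rfl).1
    (zpow_mem_homFun (form_mem_homFun (isHomogeneous_X_pow (R := k) (0 : Fin 2) (m + 1))) (-1))
  have hh1 := mul_mem_homFun (hE 0 (m + 1) (zero_add _)).1
    (zpow_mem_homFun (form_mem_homFun (isHomogeneous_X_pow (R := k) (1 : Fin 2) (m + 1))) (-1))
  simp only [map_pow, eval_X, zpow_neg_one, mul_neg_one, hn'] at hh0 hh1
  refine ⟨hD.1, fun z => if z.1 0 ≠ 0 then E (m + 1) 0 z * (z.1 0 ^ (m + 1))⁻¹ else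
    E 0 (m + 1) z * (z.1 1 ^ (m + 1))⁻¹, fun z z' c hc => ?_, fun z => ?_⟩
  · have : z'.1 0 ≠ 0 ↔ z.1 0 ≠ 0 := by
      rw [hc]; simp [Coord.ne_zero_of_eq_smul hc]
    simp only [this]
    split_ifs
    · exact hh0 z z' c hc
    · exact hh1 z z' c hc
  · have hdiv : ∀ (i : Fin 2) (e : Coord k → k), z.1 i ≠ 0 →
        (fun y : Coord k => y.1 i ^ (m + 1) * D z.pt y) - e ∈ regAt (-1) z →
        (fun y : Coord k => D z.pt y - e y * (y.1 i ^ (m + 1))⁻¹) ∈ regAt n z := by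
      intro i e hi he
      have := mul_mem_regAt he (inv_mem_regAt (form_mem_regAt
        (isHomogeneous_X_pow (R := k) i (m + 1)) z) (by simpa using hi))
      rw [hn'] at this
      refine (regAt_congr ?_).1 this
      filter_upwards [eventually_eval_ne_zero (isHomogeneous_X k i) (z := z) (by simpa using hi)]
        with y hy
      simp only [eval_X] at hy
      simp only [Pi.sub_apply, map_pow, eval_X]
      field_simp
    by_cases hz : z.1 0 ≠ 0
    · refine (regAt_congr ?_).1 (hdiv 0 _ hz (by simpa using (hE (m + 1) 0 rfl).2 z))
      filter_upwards [eventually_eval_ne_zero (isHomogeneous_X k (0 : Fin 2)) (z := z)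
        (by simpa using hz)] with y hy
      rw [eval_X] at hy
      simp [hy]
    · have hz1 : z.1 1 ≠ 0 := fun h1 => z.2 (by
        ext i; fin_cases i
        · exact not_not.1 hz
        · exact h1)
      refine (regAt_congr ?_).1 (hdiv 1 _ hz1 (by simpa using (hE 0 (m + 1) (zero_add _)).2 z))
      filter_upwards [eventually_eval_ne_zero (isHomogeneous_X k (1 : Fin 2)) (z := z)
        (by simpa using hz1)] with y hy
      rw [eval_X] at hy
      have hy1 := hkey y
      simp only [Pi.sub_apply]
      split_ifs with hy0
      · congr 1
        field_simp
        linear_combination -hy1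
      · rfl

/-- Serre duality for `𝒪(n)` on the projective line: the residue pairing with forms of degree
`-2 - n`. -/
noncomputable def residue (k : Type*) [Field k] [IsAlgClosed k] (n : ℤ) :
    cocycles k n →ₗ[k] Module.Dual k (sym k (-2 - n)) where
  toFun D :=
    { toFun := fun P => (exists_hasResidue D.2 P.2).choose
      map_add' := fun P P' => (exists_hasResidue D.2 (P + P').2).choose_spec.unique
        ((exists_hasResidue D.2 P.2).choose_spec.add_right (exists_hasResidue D.2 P'.2).choose_spec)
      map_smul' := fun c P => (exists_hasResidue D.2 (c • P).2).choose_spec.unique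
        ((exists_hasResidue D.2 P.2).choose_spec.smul_right c) }
  map_add' D D' := LinearMap.ext fun P => (exists_hasResidue (D + D').2 P.2).choose_spec.unique
    ((exists_hasResidue D.2 P.2).choose_spec.add_left (exists_hasResidue D'.2 P.2).choose_spec)
  map_smul' c D := LinearMap.ext fun P => (exists_hasResidue (c • D).2 P.2).choose_spec.unique
    ((exists_hasResidue D.2 P.2).choose_spec.smul_left c)

lemma hasResidue_residue (D : cocycles k n) (P : sym k (-2 - n)) :
    HasResidue D.1 P.1 (residue k n D P) := (exists_hasResidue D.2 P.2).choose_spec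

lemma residue_eq_zero_iff (D : cocycles k n) : residue k n D = 0 ↔ D.1 ∈ coboundaries k n := by
  constructor
  · intro h
    refine mem_coboundaries_of_hasResidue_zero D.2 fun P hP => ?_
    have := hasResidue_residue D ⟨P, hP⟩
    rwa [h] at this
  · intro h
    ext P
    exact (hasResidue_residue D P).unique (hasResidue_zero_of_mem_coboundaries h P.2)

/-- The pairing is nondegenerate: `1 / (l X_j P)`, with `l` vanishing at a point where `P` does not,
has nonzero residue against `P`. -/
lemma exists_hasResidue_ne_zero {N : Set (P1 k)} (hN : N.Finite) {P : MvPolynomial (Fin 2) k}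
    (hP : P ∈ sym k (-2 - n)) (hP0 : P ≠ 0) : ∃ D ∈ cocycles k n, ∃ c ≠ 0, HasResidue D P c ∧
      (∀ p ∈ N, D p = 0) ∧ ∀ p (z : Coord k), z.pt ∈ N → D p z = 0 := by
  classical
  obtain ⟨m, hm, hP⟩ := (mem_sym_cases hP).resolve_right fun h => hP0 h.2
  obtain ⟨z₁, hz₁⟩ := exists_eval_ne_zero hP0
  obtain ⟨v, hvN, hv⟩ := exists_ne_zero_nhds hN z₁ (eventually_eval_ne_zero hP hz₁)
  obtain ⟨j, hj⟩ := exists_coord_ne_zero v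
  set l := linForm v.1
  have hlv : ∀ z : Coord k, z.pt ≠ v.pt → eval z.1 l ≠ 0 := fun z => mt eval_linForm_eq_zero.1
  have hden : (l * (X j * P)).IsHomogeneous (1 + (1 + m)) :=
    (linForm_isHomogeneous _).mul ((isHomogeneous_X k j).mul hP)
  have hn : -((1 + (1 + m) : ℕ) : ℤ) = n := by push_cast; omega
  set F₀ : Coord k → k := fun z => (eval z.1 (l * (X j * P)))⁻¹ with hF₀
  set F : Coord k → k := fun z => if z.pt ∉ N then F₀ z else 0 with hF
  have hF₀h : F₀ ∈ homFun k n := by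
    simpa only [zpow_neg_one, mul_neg_one, hn] using zpow_mem_homFun (form_mem_homFun hden) (-1)
  have hFh : F ∈ homFun k n := indicator_mem_homFun hF₀h (· ∉ N)
  have hFv : ∀ᶠ z in 𝓝 v, F z = F₀ z := by
    filter_upwards [eventually_notMem hN hvN] with z hz using if_pos hz
  set D : P1 k → Coord k → k := fun p => if p = v.pt then F else 0 with hD
  have hDv : D v.pt = F := if_pos rfl
  have hDn : ∀ p, p ≠ v.pt → D p = 0 := fun p hp => if_neg hp
  have hDc : D ∈ cocycles k n := by
    refine ⟨fun p => ?_, fun z => ?_⟩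
    · by_cases hp : p = v.pt
      · rw [hp, hDv]; exact hFh
      · rw [hDn p hp]; exact zero_mem _
    · by_cases hz : z.pt = v.pt
      · refine eventually_nhds_of_pt_eq hz.symm ?_
        filter_upwards [eventually_eventually_nhds.2 hFv, eventually_eval_ne_zero hP hv,
          eventually_eval_ne_zero (isHomogeneous_X k j) (z := v) (by simpa using hj)]
          with y h1 h2 h3
        rw [hz, hDv]
        by_cases hy : y.pt = v.pt
        · rw [hy, hDv, sub_self]; exact zero_mem _
        · rw [hDn _ hy, zero_sub]
          refine neg_mem ((regAt_congr h1).2 ?_)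
          have := inv_mem_regAt (form_mem_regAt hden y) (by
            simp only [map_mul]; exact mul_ne_zero (hlv y hy) (mul_ne_zero h3 h2))
          rwa [hn] at this
      · filter_upwards [eventually_notMem (Set.finite_singleton v.pt) hz] with y hy
        rw [hDn _ hy, hDn _ hz, sub_self]; exact zero_mem _
  obtain ⟨c, hc⟩ := exists_hasResidue hDc (P := P) (by rw [hm]; exact hP)
  refine ⟨D, hDc, c, ?_, hc, fun p hp => hDn p (by rintro rfl; exact hvN hp), fun p z hz => ?_⟩
  · obtain ⟨e, he, hr, hce⟩ := hc
    -- The section bounding `X_j P D` is `1 / l`; the residue is its value at a zero of `X_j`.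
    have hej : e j = fun z : Coord k => (eval z.1 l)⁻¹ := by
      refine eq_of_sub_mem_regAt (hr j) fun z => ?_
      by_cases hz : z.pt = v.pt
      · refine regAt_of_pt_eq hz.symm ((regAt_congr (F' := 0) ?_).2 (zero_mem _))
        filter_upwards [hFv, eventually_eval_ne_zero hP hv,
          eventually_eval_ne_zero (isHomogeneous_X k j) (z := v) (by simpa using hj)]
          with y h1 h2 h3
        rw [eval_X] at h3
        simp only [Pi.sub_apply, hz, hDv, h1, hF₀, map_mul, eval_X, mul_inv, Pi.zero_apply]
        field_simp
        simp
      · rw [hDn _ hz]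
        have h1 := inv_mem_regAt (form_mem_regAt (linForm_isHomogeneous v.1) z) (hlv z hz)
        rw [Nat.cast_one] at h1
        convert neg_mem h1 using 1
        funext y
        simp [l]
    intro hc0
    subst hc0
    have key : ∀ w : Coord k, w.1 j = 0 → w.1 (1 - j) = 1 → False := fun w hw hw' => by
      have hwv : w.pt ≠ v.pt := fun h => by
        obtain ⟨a, ha⟩ := Coord.pt_eq_iff.1 h
        have := congrFun ha j
        rw [hw, Pi.smul_apply, smul_eq_mul, eq_comm, mul_eq_zero] at this
        exact this.elim (Coord.ne_zero_of_eq_smul ha) hj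
      have h0 : ∀ i : Fin 2, w.1 i = 0 → w.1 (1 - i) * e i w = 0 := by
        have := hce w
        rw [Fin.forall_fin_two]
        refine ⟨fun h => ?_, fun h => ?_⟩
        · rw [h, zero_mul, sub_zero] at this
          exact this
        · rw [h, zero_mul, zero_sub, neg_eq_zero] at this
          exact this
      have h1 := h0 j hw
      rw [hw', one_mul, hej] at h1
      exact inv_ne_zero (hlv w hwv) h1
    clear_value l
    fin_cases j
    · exact key ⟨![0, 1], fun h => one_ne_zero (congrFun h 1)⟩ rfl rfl
    · exact key ⟨![1, 0], fun h => one_ne_zero (congrFun h 0)⟩ rfl rfl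
  · by_cases hp : p = v.pt
    · rw [hp, hDv, hF]; simp [hz]
    · rw [hDn p hp]; rfl

instance (n : ℤ) : FiniteDimensional k (sym k n) := by
  rcases n with n | n
  · exact Module.Finite.iff_fg.2 (homogeneousSubmodule_fg (σ := Fin 2) (R := k) n)
  · exact inferInstanceAs (FiniteDimensional k (⊥ : Submodule k (MvPolynomial (Fin 2) k)))

omit [IsAlgClosed k] in
lemma eq_top_of_separating {V : Type*} [AddCommGroup V] [Module k V] [FiniteDimensional k V]
    (R : Submodule k (Module.Dual k V)) (h : ∀ v, v ≠ 0 → ∃ φ ∈ R, φ v ≠ 0) : R = ⊤ := by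
  rw [← Subspace.dualCoannihilator_dualAnnihilator_eq (W := R)]
  suffices h : R.dualCoannihilator = ⊥ by rw [h]; simp
  refine (Submodule.eq_bot_iff _).2 fun v hv => by_contra fun hv0 => ?_
  obtain ⟨φ, hφ, hne⟩ := h v hv0
  exact hne ((Submodule.mem_dualCoannihilator v).1 hv φ hφ)

/-- Every linear form on `Sym^{-2-n}` is the residue pairing with a family that avoids a given
finite set of points. -/
lemma exists_residue_eq {N : Set (P1 k)} (hN : N.Finite)
    (φ : Module.Dual k (sym k (-2 - n))) : ∃ D : cocycles k n, residue k n D = φ ∧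
      (∀ p ∈ N, D.1 p = 0) ∧ ∀ p (z : Coord k), z.pt ∈ N → D.1 p z = 0 := by
  -- The families avoiding `N` form a subspace; its image under the residue map separates points of
  -- the finite dimensional space of forms, hence is everything.
  let W : Submodule k (cocycles k n) :=
    { carrier := {D | (∀ p ∈ N, D.1 p = 0) ∧ ∀ p (z : Coord k), z.pt ∈ N → D.1 p z = 0}
      add_mem' := fun {D D'} h h' => ⟨fun p hp => by simp [h.1 p hp, h'.1 p hp],
        fun p z hz => by simp [h.2 p z hz, h'.2 p z hz]⟩
      zero_mem' := ⟨fun _ _ => rfl, fun _ _ _ => rfl⟩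
      smul_mem' := fun c D h => ⟨fun p hp => by simp [h.1 p hp],
        fun p z hz => by simp [h.2 p z hz]⟩ }
  suffices h : W.map (residue k n) = ⊤ by
    obtain ⟨D, hD, h⟩ := (h ▸ Submodule.mem_top : φ ∈ W.map (residue k n))
    exact ⟨D, h, hD⟩
  refine eq_top_of_separating _ fun P hP0 => ?_
  obtain ⟨D, hD, c, hc, hr, hDW⟩ := exists_hasResidue_ne_zero hN P.2 (n := n)
    (fun h => hP0 (Subtype.ext h))
  refine ⟨_, Submodule.mem_map_of_mem (show (⟨D, hD⟩ : cocycles k n) ∈ W from hDW), ?_⟩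
  rwa [(hasResidue_residue ⟨D, hD⟩ P).unique hr]

end Cocycles


/-! ### Changes of coordinates -/

section Change

open MvPolynomial Filter Topology

variable {k : Type*} [Field k] {n m : ℤ}

lemma Coord.change_apply (A : GL (Fin 2) k) (z : Coord k) (j : Fin 2) :
    (z.change A).1 j = A.1 0 j * z.1 0 + A.1 1 j * z.1 1 := by
  fin_cases j <;> simp [Coord.change]

lemma Coord.change_one (z : Coord k) : z.change 1 = z := Subtype.ext (by simp [Coord.change])

lemma Coord.change_mul (A B : GL (Fin 2) k) (z : Coord k) :
    z.change (A * B) = (z.change A).change B := Subtype.ext (by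
  simp only [Coord.change, Units.val_mul, Matrix.transpose_mul, Matrix.mulVec_mulVec])

lemma Coord.change_smul (A : GL (Fin 2) k) {z z' : Coord k} {c : k} (h : z'.1 = c • z.1) :
    (z'.change A).1 = c • (z.change A).1 := by
  simp [Coord.change, h, Matrix.mulVec_smul]

lemma Coord.pt_change_eq (A : GL (Fin 2) k) {z z' : Coord k} (h : z.pt = z'.pt) :
    (z.change A).pt = (z'.change A).pt := by
  obtain ⟨c, hc⟩ := Coord.pt_eq_iff.1 h
  exact Coord.pt_eq_iff.2 ⟨c, Coord.change_smul A hc⟩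

lemma Coord.change_inv_change (A : GL (Fin 2) k) (z : Coord k) : (z.change A⁻¹).change A = z := by
  rw [← Coord.change_mul, inv_mul_cancel, Coord.change_one]

lemma Coord.change_change_inv (A : GL (Fin 2) k) (z : Coord k) : (z.change A).change A⁻¹ = z := by
  rw [← Coord.change_mul, mul_inv_cancel, Coord.change_one]

/-- The change of coordinates by `A`, on the points of the projective line. -/
noncomputable def P1.change (A : GL (Fin 2) k) (p : P1 k) : P1 k :=
  ((Coord.exists_pt p).choose.change A).pt

lemma P1.change_pt (A : GL (Fin 2) k) (z : Coord k) : P1.change A z.pt = (z.change A).pt :=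
  Coord.pt_change_eq A (Coord.exists_pt z.pt).choose_spec

lemma eval_subst (A : GL (Fin 2) k) (P : MvPolynomial (Fin 2) k) (z : Coord k) :
    eval z.1 (subst A.1 P) = eval (z.change A).1 P := by
  have : (aeval z.1 : MvPolynomial (Fin 2) k →ₐ[k] k).comp (subst A.1) =
      aeval (z.change A).1 := by
    ext j
    simp [subst, Coord.change_apply, Fin.sum_univ_two]
  have := DFunLike.congr_fun this P
  simpa [aeval_eq_eval] using this

lemma eval_symRep (A : GL (Fin 2) k) (P : sym k n) (z : Coord k) :
    eval z.1 (symRep k n A P).1 = eval (z.change A).1 P.1 := eval_subst A P.1 z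

lemma subst_isHomogeneous (A : GL (Fin 2) k) {P : MvPolynomial (Fin 2) k} {a : ℕ}
    (hP : P.IsHomogeneous a) : (subst A.1 P).IsHomogeneous a :=
  (symRep k a A ⟨P, hP⟩).2

lemma eventually_change (A : GL (Fin 2) k) {z : Coord k} {p : Coord k → Prop}
    (h : ∀ᶠ y in 𝓝 (z.change A), p y) : ∀ᶠ y in 𝓝 z, p (y.change A) := by
  obtain ⟨b, R, hR, h0, h1⟩ := eventually_nhds_iff_exists_form.1 h
  exact eventually_nhds_iff_exists_form.2 ⟨b, _, subst_isHomogeneous A hR,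
    by rwa [eval_subst], fun z' h => h1 _ (by rwa [eval_subst] at h)⟩

lemma comp_change_mem_homFun (A : GL (Fin 2) k) {F : Coord k → k} (hF : F ∈ homFun k n) :
    (fun z => F (z.change A)) ∈ homFun k n := fun _ _ c h => hF _ _ c (Coord.change_smul A h)

lemma comp_change_mem_regAt (A : GL (Fin 2) k) {F : Coord k → k} {z : Coord k}
    (hF : F ∈ regAt n (z.change A)) : (fun z => F (z.change A)) ∈ regAt n z := by
  obtain ⟨a, b, P, Q, hP, hQ, hab, h0, hF⟩ := hF
  refine ⟨a, b, _, _, subst_isHomogeneous A hP, subst_isHomogeneous A hQ, hab,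
    by rwa [eval_subst], ?_⟩
  filter_upwards [eventually_change A hF] with y hy
  rw [eval_subst, eval_subst, hy]

lemma comp_change_mem_regAt_iff (A : GL (Fin 2) k) {F : Coord k → k} {z : Coord k} :
    (fun z => F (z.change A)) ∈ regAt n z ↔ F ∈ regAt n (z.change A) := by
  refine ⟨fun h => ?_, comp_change_mem_regAt A⟩
  have := comp_change_mem_regAt A⁻¹ (F := fun z => F (z.change A)) (z := z.change A)
    (by rwa [Coord.change_change_inv])
  simpa only [Coord.change_inv_change] using this

lemma comp_change_mem_cocycles (A : GL (Fin 2) k) {D : P1 k → Coord k → k}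
    (hD : D ∈ cocycles k n) : (fun p z => D (p.change A) (z.change A)) ∈ cocycles k n := by
  refine ⟨fun p => comp_change_mem_homFun A (hD.1 _), fun z₀ => ?_⟩
  filter_upwards [eventually_change A (hD.2 (z₀.change A))] with y hy
  simp only [P1.change_pt]
  exact comp_change_mem_regAt A hy

/-- The residue transforms under changes of coordinates by the inverse of the determinant. -/
lemma HasResidue.comp_change (A : GL (Fin 2) k) {D : P1 k → Coord k → k}
    {P : MvPolynomial (Fin 2) k} {c : k} (h : HasResidue D P c) :
    HasResidue (fun p z => D (p.change A) (z.change A)) (subst A.1 P) (A.1.det⁻¹ * c) := by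
  obtain ⟨e, he, hr, hc⟩ := h
  have hdet : A.1.det ≠ 0 := ((Matrix.isUnit_iff_isUnit_det _).1 A.isUnit).ne_zero
  have hinv : ∀ (y : Coord k) (i : Fin 2),
      y.1 i = A⁻¹.1 0 i * (y.change A).1 0 + A⁻¹.1 1 i * (y.change A).1 1 := fun y i => by
    rw [← Coord.change_apply, Coord.change_change_inv]
  refine ⟨fun i z => A⁻¹.1 0 i * e 0 (z.change A) + A⁻¹.1 1 i * e 1 (z.change A), fun i => ?_,
    fun i z => ?_, fun z => ?_⟩
  · exact add_mem (Submodule.smul_mem _ (A⁻¹.1 0 i) (comp_change_mem_homFun A (he 0)))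
      (Submodule.smul_mem _ (A⁻¹.1 1 i) (comp_change_mem_homFun A (he 1)))
  · convert add_mem
      (Submodule.smul_mem _ (A⁻¹.1 0 i) (comp_change_mem_regAt A (hr 0 (z.change A))))
      (Submodule.smul_mem _ (A⁻¹.1 1 i) (comp_change_mem_regAt A (hr 1 (z.change A)))) using 1
    funext y
    simp only [Pi.sub_apply, Pi.add_apply, Pi.smul_apply, smul_eq_mul, eval_subst, P1.change_pt]
    rw [hinv y i]
    ring
  · rw [← hc (z.change A)]
    have e1 : A.1.det = A.1 0 0 * A.1 1 1 - A.1 0 1 * A.1 1 0 := Matrix.det_fin_two _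
    simp only [Matrix.coe_units_inv, Matrix.inv_def, Matrix.adjugate_fin_two, Matrix.smul_apply,
      Ring.inverse_eq_inv', smul_eq_mul, Coord.change_apply, Matrix.of_apply, Matrix.cons_val_zero,
      Matrix.cons_val_one]
    ring

variable [IsAlgClosed k]

lemma residue_comp_change (A : GL (Fin 2) k) (D : cocycles k n) :
    residue k n ⟨_, comp_change_mem_cocycles A D.2⟩ =
      (A.1.det⁻¹ : k) • (symRep k (-2 - n)).dual A (residue k n D) := by
  ext P
  refine (hasResidue_residue _ P).unique ?_
  have h := (hasResidue_residue D (symRep k (-2 - n) A⁻¹ P)).comp_change A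
  have e : subst A.1 (symRep k (-2 - n) A⁻¹ P).1 = P.1 := by
    change (symRep k (-2 - n) A (symRep k (-2 - n) A⁻¹ P)).1 = P.1
    rw [← Module.End.mul_apply, ← map_mul, mul_inv_cancel, map_one, Module.End.one_apply]
  rw [e] at h
  exact h

end Change

/-! ### Interpolation by sections of the Serre twists -/

section Interpolation

open MvPolynomial Filter Topology

variable {k : Type*} [Field k] [IsAlgClosed k] {n : ℤ} {ι : Type*} [Fintype ι] {b : ι → Coord k}

/-- Lagrange interpolation: a section of `𝒪(n)` on a finite set of points extends to a section that
is regular near these points, and to a form of degree `n` if there are at most `n + 1` points. -/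
lemma exists_interpolation (hb : Function.Injective fun i => (b i).pt) {E : Coord k → k}
    (hE : E ∈ homFun k n) : ∃ F ∈ homFun k n, (∀ i, F (b i) = E (b i)) ∧
      (∀ i, F ∈ regAt n (b i)) ∧
      (Fintype.card ι ≤ n + 1 → ∃ P ∈ sym k n, ∀ z : Coord k, F z = eval z.1 P) := by
  classical
  obtain ⟨v, hv, -⟩ := exists_ne_zero_nhds (Set.finite_range fun i => (b i).pt) (nodeCoord (k := k))
    (p := fun _ => True) (by simp)
  have hl : ∀ i, eval (b i).1 (linForm v.1) ≠ 0 := fun i h =>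
    hv ⟨i, eval_linForm_eq_zero.1 h⟩
  -- `L i` vanishes at the points other than `b i`. A power of a linear form vanishing at none of
  -- the points corrects the degree `N` of `L i` to `n`; it is a polynomial if `N ≤ n`.
  set L : ι → MvPolynomial (Fin 2) k := fun i => ∏ j ∈ Finset.univ.erase i, linForm (b j).1 with hL
  rcases isEmpty_or_nonempty ι with hι | hι
  · exact ⟨0, zero_mem _, fun i => hι.elim i, fun i => hι.elim i,
      fun _ => ⟨0, zero_mem _, fun z => by simp⟩⟩
  obtain ⟨N, hN⟩ : ∃ N : ℕ, Fintype.card ι = N + 1 := ⟨_, (Nat.succ_pred Fintype.card_ne_zero).symm⟩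
  have hLh : ∀ i, (L i).IsHomogeneous N := fun i => by
    have := IsHomogeneous.prod (Finset.univ.erase i) (fun j => linForm (b j).1) (fun _ => 1)
      fun j _ => linForm_isHomogeneous _
    simpa [Finset.card_erase_of_mem, hN] using this
  have hLi : ∀ i, eval (b i).1 (L i) ≠ 0 := fun i => by
    rw [hL, map_prod]
    refine Finset.prod_ne_zero_iff.2 fun j hj h => ?_
    exact (Finset.ne_of_mem_erase hj).symm (hb (eval_linForm_eq_zero.1 h))
  have hLj : ∀ i j, i ≠ j → eval (b j).1 (L i) = 0 := fun i j hij => by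
    rw [hL, map_prod]
    exact Finset.prod_eq_zero (Finset.mem_erase.2 ⟨hij.symm, Finset.mem_univ j⟩)
      (eval_linForm_eq_zero.2 rfl)
  set t : ι → k := fun i => E (b i) /
    (eval (b i).1 (L i) * eval (b i).1 (linForm v.1) ^ (n - N)) with ht
  refine ⟨fun z => ∑ i, t i * (eval z.1 (L i) * eval z.1 (linForm v.1) ^ (n - N)), ?_, fun i => ?_,
    fun i => ?_, fun hn => ?_⟩
  · have : ∀ i, (fun z : Coord k => eval z.1 (L i) * eval z.1 (linForm v.1) ^ (n - N)) ∈
        homFun k n := fun i => by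
      have := mul_mem_homFun (form_mem_homFun (hLh i))
        (zpow_mem_homFun (form_mem_homFun (linForm_isHomogeneous v.1)) (n - N))
      simpa using this
    convert Submodule.sum_mem _ fun i (_ : i ∈ Finset.univ) => Submodule.smul_mem _ (t i) (this i)
      using 1
    funext z
    simp
  · beta_reduce
    rw [Finset.sum_eq_single i]
    · rw [ht]
      exact div_mul_cancel₀ _ (mul_ne_zero (hLi i) (zpow_ne_zero _ (hl i)))
    · intro j _ hj
      rw [hLj j i hj, zero_mul, mul_zero]
    · simp
  · have : ∀ j, (fun z : Coord k => eval z.1 (L j) * eval z.1 (linForm v.1) ^ (n - N)) ∈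
        regAt n (b i) := fun j => by
      have := mul_mem_regAt (form_mem_regAt (hLh j) (b i))
        (zpow_mem_regAt (form_mem_regAt (linForm_isHomogeneous v.1) (b i)) (hl i) (n - N))
      simpa using this
    convert Submodule.sum_mem _ fun j (_ : j ∈ Finset.univ) => Submodule.smul_mem _ (t j) (this j)
      using 1
    funext z
    simp
  · obtain ⟨d, hd⟩ : ∃ d : ℕ, n - N = d := ⟨(n - N).toNat, by omega⟩
    refine ⟨∑ i, t i • (L i * linForm v.1 ^ d), Submodule.sum_mem _ fun i _ =>
      Submodule.smul_mem _ _ ?_, fun z => ?_⟩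
    · obtain rfl : n = ((N + 1 * d : ℕ) : ℤ) := by push_cast; omega
      exact (hLh i).mul ((linForm_isHomogeneous v.1).pow d)
    · simp [hd, map_sum, smul_eval]

omit [IsAlgClosed k] in
/-- A form vanishing at given points is divisible by the product of the corresponding linear
forms. -/
lemma exists_eq_prod_linForm_mul (hb : Function.Injective fun i => (b i).pt)
    {P : MvPolynomial (Fin 2) k}
    {a : ℕ} (hP : P.IsHomogeneous a) (h : ∀ i, eval (b i).1 P = 0) :
    P = 0 ∨ ∃ (a' : ℕ) (P' : MvPolynomial (Fin 2) k), P'.IsHomogeneous a' ∧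
      a = Fintype.card ι + a' ∧ P = (∏ i, linForm (b i).1) * P' := by
  classical
  by_cases hP0 : P = 0
  · exact Or.inl hP0
  refine Or.inr ?_
  suffices H : ∀ s : Finset ι, ∃ (a' : ℕ) (P' : MvPolynomial (Fin 2) k), P'.IsHomogeneous a' ∧
      a = s.card + a' ∧ P = (∏ i ∈ s, linForm (b i).1) * P' from H Finset.univ
  intro s
  induction s using Finset.induction_on with
  | empty => exact ⟨a, P, hP, by simp, by simp⟩
  | insert i s hi ih =>
    obtain ⟨a', P', hP', ha, e⟩ := ih
    have hev : eval (b i).1 P' = 0 := by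
      have := h i
      rw [e, map_mul, map_prod, mul_eq_zero] at this
      refine this.resolve_left (Finset.prod_ne_zero_iff.2 fun j hj h0 => ?_)
      exact hi (hb (eval_linForm_eq_zero.1 h0) ▸ hj)
    rcases a' with _ | a'
    · obtain ⟨c, rfl⟩ := exists_eq_C hP'
      rw [eval_C] at hev
      exact absurd (by rw [e, hev]; simp) hP0
    · obtain ⟨P'', hP'', rfl⟩ := linForm_dvd hP' hev
      refine ⟨a', P'', hP'', by rw [Finset.card_insert_of_notMem hi]; omega, ?_⟩
      rw [e, Finset.prod_insert hi]; ring

end Interpolation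


/-! ### Vertices, stabilizers and the Iwahori subgroup -/

/-- An equivariant function on `G` for a free action of `H` by left translations may be prescribed
arbitrarily on representatives of the orbits. -/
lemma exists_equivariant {H G V : Type*} [Group H] [Group G] {φ : H →* G}
    (hφ : Function.Injective φ) {act : H → V → V}
    (hact : ∀ h h' v, act (h * h') v = act h (act h' v))
    {p : G → V → Prop} (hp : ∀ h γ v, p γ v → p (φ h * γ) (act h v)) (hex : ∀ γ, ∃ v, p γ v) :
    ∃ F : G → V, (∀ h γ, F (φ h * γ) = act h (F γ)) ∧ ∀ γ, p γ (F γ) := by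
  classical
  choose v hv using hex
  let s := QuotientGroup.rightRel φ.range
  let rep : G → G := fun γ => (Quotient.mk s γ).out
  have hrep : ∀ γ, ∃ h, γ = φ h * rep γ := fun γ => by
    have : s (rep γ) γ := Quotient.exact (Quotient.out_eq (Quotient.mk s γ))
    rw [QuotientGroup.rightRel_apply] at this
    obtain ⟨h, hh⟩ := this
    exact ⟨h, by rw [hh]; group⟩
  have hrep' : ∀ h γ, rep (φ h * γ) = rep γ := fun h γ => by
    have : Quotient.mk s (φ h * γ) = Quotient.mk s γ := Quotient.sound (by
      change s _ _
      rw [QuotientGroup.rightRel_apply]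
      exact ⟨h⁻¹, by rw [map_inv]; group⟩)
    change (Quotient.mk s (φ h * γ)).out = _
    rw [this]
  -- By freeness, the `h` with `γ = φ h * rep γ` is unique, hence depends equivariantly on `γ`.
  choose h hh using hrep
  have hmul : ∀ a γ, h (φ a * γ) = a * h γ := fun a γ => hφ (by
    have e := hh (φ a * γ)
    rw [hrep'] at e
    have e' := hh γ
    rw [map_mul]
    refine mul_right_cancel (b := rep γ) ?_
    rw [← e, mul_assoc, ← e'])
  refine ⟨fun γ => act (h γ) (v (rep γ)), fun a γ => ?_, fun γ => ?_⟩
  · simp only [hmul, hrep', hact]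
  · have := hp (h γ) _ _ (hv (rep γ))
    rwa [← hh γ] at this

section Groups

open Matrix (GeneralLinearGroup)

variable {K : Type*} [Field K] [ValuativeRel K] [TopologicalSpace K]
  [IsNonarchimedeanLocalField K] (ϖ : Uniformizer K)

omit [TopologicalSpace K] [IsNonarchimedeanLocalField K] in
lemma Uniformizer.coe_unit : (ϖ.unit : K) = algebraMap 𝒪[K] K ϖ.1 := rfl

lemma exists_unit_mul_pow {x : 𝒪[K]} (hx : x ≠ 0) : ∃ (n : ℕ) (u : 𝒪[K]ˣ), x = u * ϖ.1 ^ n :=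
  IsDiscreteValuationRing.eq_unit_mul_pow_irreducible hx ϖ.2

lemma exists_zpow_mul_unit (c : Kˣ) : ∃ (n : ℤ) (u : 𝒪[K]ˣ),
    c = ϖ.unit ^ n * Units.map (algebraMap 𝒪[K] K).toMonoidHom u := by
  obtain ⟨x, y, hy, e⟩ := IsFractionRing.div_surjective 𝒪[K] (c : K)
  have hy0 := nonZeroDivisors.ne_zero hy
  have hx0 : x ≠ 0 := by
    rintro rfl
    rw [map_zero, zero_div] at e
    exact c.ne_zero e.symm
  obtain ⟨n, u, rfl⟩ := exists_unit_mul_pow ϖ hx0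
  obtain ⟨m, v, rfl⟩ := exists_unit_mul_pow ϖ hy0
  refine ⟨n - m, u * v⁻¹, ?_⟩
  have hϖ : (algebraMap 𝒪[K] K) ϖ.1 ≠ 0 := ϖ.unit.ne_zero
  have hv : (algebraMap 𝒪[K] K) (v : 𝒪[K]) ≠ 0 :=
    (Units.map (algebraMap 𝒪[K] K).toMonoidHom v).ne_zero
  have hvi : (algebraMap 𝒪[K] K) (v⁻¹ : 𝒪[K]ˣ) = ((algebraMap 𝒪[K] K) v)⁻¹ := by
    refine eq_inv_of_mul_eq_one_left ?_
    rw [← map_mul, Units.inv_mul, map_one]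
  ext
  rw [← e]
  simp only [map_mul, map_pow, Units.val_mul, Units.val_zpow_eq_zpow_val, Units.coe_map,
    RingHom.toMonoidHom_eq_coe, MonoidHom.coe_coe, hvi]
  rw [zpow_sub₀ (by exact hϖ), zpow_natCast, zpow_natCast, Uniformizer.coe_unit]
  field_simp

omit [TopologicalSpace K] [IsNonarchimedeanLocalField K] in
lemma eq_zero_of_zpow_eq_unit {n : ℤ} {u : 𝒪[K]ˣ}
    (h : ϖ.unit ^ n = Units.map (algebraMap 𝒪[K] K).toMonoidHom u) : n = 0 := by
  have key : ∀ (m : ℕ) (v : 𝒪[K]ˣ), ϖ.unit ^ (m + 1) ≠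
      Units.map (algebraMap 𝒪[K] K).toMonoidHom v := fun m v h => by
    have e : ϖ.1 ^ (m + 1) = (v : 𝒪[K]) := by
      refine Subtype.ext ?_
      have := congrArg Units.val h
      rw [Units.val_pow_eq_pow_val] at this
      exact this
    exact ϖ.2.not_isUnit ((isUnit_pow_iff (Nat.succ_ne_zero m)).1 (e ▸ v.isUnit))
  rcases n with (_ | m) | m
  · rfl
  · exact absurd (by exact_mod_cast h) (key m u)
  · refine absurd ?_ (key m u⁻¹)
    rw [map_inv, ← h, zpow_negSucc, inv_inv]

omit [TopologicalSpace K] [IsNonarchimedeanLocalField K] in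
lemma mem_evenGroup_iff {g : GL (Fin 2) K} : g ∈ evenGroup ϖ ↔ ∃ (n : ℤ) (u : 𝒪[K]ˣ),
    GeneralLinearGroup.det g = ϖ.unit ^ (2 * n) * Units.map (algebraMap 𝒪[K] K).toMonoidHom u := by
  rw [evenGroup, Subgroup.mem_comap, Subgroup.mem_sup]
  constructor
  · rintro ⟨_, ⟨n, rfl⟩, _, ⟨u, rfl⟩, e⟩
    exact ⟨n, u, by rw [← e, zpow_mul]; rfl⟩
  · rintro ⟨n, u, e⟩
    exact ⟨_, ⟨n, rfl⟩, _, ⟨u, rfl⟩, by rw [e, zpow_mul]; rfl⟩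

omit [TopologicalSpace K] [IsNonarchimedeanLocalField K] in
lemma det_wMat : GeneralLinearGroup.det (wMat ϖ) = ϖ.unit * -1 := by
  ext
  simp [wMat, GeneralLinearGroup.val_det_apply, GeneralLinearGroup.mkOfDetNeZero,
    Matrix.det_fin_two]

omit [TopologicalSpace K] [IsNonarchimedeanLocalField K] in
lemma neg_one_eq_map : (-1 : Kˣ) = Units.map (algebraMap 𝒪[K] K).toMonoidHom (-1) := by
  ext; simp

omit [TopologicalSpace K] [IsNonarchimedeanLocalField K] in
lemma wMat_notMem : wMat ϖ ∉ evenGroup ϖ := by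
  rw [mem_evenGroup_iff]
  rintro ⟨n, u, e⟩
  rw [det_wMat, neg_one_eq_map] at e
  have : ϖ.unit ^ (1 - 2 * n) = Units.map (algebraMap 𝒪[K] K).toMonoidHom (u * (-1)⁻¹) := by
    rw [zpow_sub, zpow_one, map_mul, map_inv, ← div_eq_mul_inv, ← div_eq_mul_inv,
      div_eq_div_iff_mul_eq_mul, e, mul_comm]
  have := eq_zero_of_zpow_eq_unit ϖ this
  omega

/-- Every vertex is in the orbit of one of the two standard vertices. -/
lemma exists_eq_mul_toVertex (g : GL (Fin 2) K) :
    ∃ (γ : evenGroup ϖ) (i : Fin 2), g = γ * toVertex ϖ i := by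
  obtain ⟨n, u, e⟩ := exists_zpow_mul_unit ϖ (GeneralLinearGroup.det g)
  rcases Int.even_or_odd' n with ⟨m, rfl | rfl⟩
  · exact ⟨⟨g, (mem_evenGroup_iff ϖ).2 ⟨m, u, e⟩⟩, 1, by simp [toVertex]⟩
  · refine ⟨⟨g * (wMat ϖ)⁻¹, (mem_evenGroup_iff ϖ).2 ⟨m, u * (-1)⁻¹, ?_⟩⟩, 0, by simp [toVertex]⟩
    rw [map_mul, map_inv, det_wMat, e, neg_one_eq_map, map_mul, map_inv, zpow_add, zpow_one,
      mul_inv_eq_iff_eq_mul]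
    set b := Units.map (algebraMap 𝒪[K] K).toMonoidHom (-1)
    set a := Units.map (algebraMap 𝒪[K] K).toMonoidHom u
    calc _ = ϖ.unit ^ (2 * m) * ϖ.unit * a * (b⁻¹ * b) := by rw [inv_mul_cancel, mul_one]
      _ = _ := by ac_rfl

omit [TopologicalSpace K] [IsNonarchimedeanLocalField K] in
lemma toVertex_inj {γ γ' : evenGroup ϖ} {i i' : Fin 2}
    (h : (γ : GL (Fin 2) K) * toVertex ϖ i = γ' * toVertex ϖ i') : γ = γ' ∧ i = i' := by
  have hw := wMat_notMem ϖ
  fin_cases i <;> fin_cases i' <;> simp [toVertex] at h ⊢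
  · exact h
  · exact hw ((Subgroup.mul_mem_cancel_left _ γ.2).1 (h ▸ γ'.2))
  · exact hw ((Subgroup.mul_mem_cancel_left _ γ'.2).1 (h ▸ γ.2))
  · exact h

omit [TopologicalSpace K] [IsNonarchimedeanLocalField K] in
lemma wMat_mul_wMat : wMat ϖ * wMat ϖ = GeneralLinearGroup.scalar (Fin 2) ϖ.unit := by
  ext i j
  fin_cases i <;> fin_cases j <;>
    simp [wMat, GeneralLinearGroup.mkOfDetNeZero, GeneralLinearGroup.coe_scalar, Matrix.mul_apply,
      Fin.sum_univ_two]

omit [TopologicalSpace K] [IsNonarchimedeanLocalField K] in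
lemma coe_stabHom (i : Fin 2) (h : GL (Fin 2) 𝒪[K]) (n : Multiplicative ℤ) :
    (stabHom ϖ i (h, n) : GL (Fin 2) K) = toVertex ϖ i * emb h * (toVertex ϖ i)⁻¹ *
      GeneralLinearGroup.scalar (Fin 2) (ϖ.unit ^ n.toAdd) := rfl

omit [TopologicalSpace K] [IsNonarchimedeanLocalField K] in
lemma coe_stabHom_mul_toVertex (i : Fin 2) (h : GL (Fin 2) 𝒪[K]) (n : Multiplicative ℤ) :
    (stabHom ϖ i (h, n) : GL (Fin 2) K) * toVertex ϖ i = toVertex ϖ i * emb h *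
      GeneralLinearGroup.scalar (Fin 2) (ϖ.unit ^ n.toAdd) := by
  rw [coe_stabHom, mul_assoc, GeneralLinearGroup.scalar_commute]
  group

omit [TopologicalSpace K] [IsNonarchimedeanLocalField K] in
lemma emb_injective : Function.Injective (emb (K := K)) := fun h h' e => by
  ext i j
  have := congrArg (fun g : GL (Fin 2) K => g.1 i j) e
  simp only [emb, GeneralLinearGroup.map_apply] at this
  exact this

omit [TopologicalSpace K] [IsNonarchimedeanLocalField K] in
lemma emb_scalar (u : 𝒪[K]ˣ) : emb (GeneralLinearGroup.scalar (Fin 2) u) =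
    GeneralLinearGroup.scalar (Fin 2) (Units.map (algebraMap 𝒪[K] K).toMonoidHom u) :=
  GeneralLinearGroup.map_scalar _ _

omit [TopologicalSpace K] [IsNonarchimedeanLocalField K] in
lemma stabHom_injective (i : Fin 2) : Function.Injective (stabHom ϖ i) := by
  rw [injective_iff_map_eq_one]
  rintro ⟨h, n⟩ e
  have e1 : toVertex ϖ i * emb h * (toVertex ϖ i)⁻¹ *
      GeneralLinearGroup.scalar (Fin 2) (ϖ.unit ^ n.toAdd) = 1 := congrArg Subtype.val e
  have hdet : Units.map (algebraMap 𝒪[K] K).toMonoidHom (GeneralLinearGroup.det h) *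
      (ϖ.unit ^ n.toAdd) ^ 2 = 1 := by
    have e2 := congrArg GeneralLinearGroup.det e1
    have e3 : GeneralLinearGroup.det (emb h) =
        Units.map (algebraMap 𝒪[K] K).toMonoidHom (GeneralLinearGroup.det h) := by
      ext
      exact (RingHom.map_det (algebraMap 𝒪[K] K) h.1).symm
    rw [map_mul, map_mul, map_mul, map_inv, GeneralLinearGroup.det_scalar, Fintype.card_fin,
      mul_comm (GeneralLinearGroup.det (toVertex ϖ i)), mul_inv_cancel_right, map_one, e3] at e2
    exact e2
  -- The determinant `det h * ϖ ^ (2n)` has valuation `2n`.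
  have hn : n.toAdd = 0 := by
    have := eq_zero_of_zpow_eq_unit ϖ (n := n.toAdd * 2) (u := (GeneralLinearGroup.det h)⁻¹) (by
      rw [zpow_mul, map_inv, eq_inv_iff_mul_eq_one, mul_comm, ← hdet]; rfl)
    omega
  have hh : h = 1 := emb_injective (by
    rw [hn, zpow_zero, map_one, mul_one, mul_inv_eq_one] at e1
    rw [map_one]
    exact mul_left_cancel (e1.trans (mul_one _).symm))
  exact Prod.ext hh (toAdd_eq_zero.1 hn)

omit [TopologicalSpace K] [IsNonarchimedeanLocalField K] in
lemma toVertex_zero : toVertex ϖ 0 = wMat ϖ := if_pos rfl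

omit [TopologicalSpace K] [IsNonarchimedeanLocalField K] in
lemma toVertex_one : toVertex ϖ 1 = 1 := if_neg one_ne_zero

/-- Conjugation by `w` preserves the Iwahori subgroup, i.e. the stabilizer of the standard edge, and
exchanges the diagonal entries. -/
lemma exists_iwahori_conj (h : iwahori K) : ∃ h' : iwahori K,
    (∀ n, stabHom ϖ 1 (h.1, n) = stabHom ϖ 0 (h'.1, n)) ∧
    (∀ n, stabHom ϖ 0 (h.1, n) = stabHom ϖ 1 (h'.1, n)) ∧
    h'.1.1 0 0 = h.1.1 1 1 ∧ h'.1.1 1 1 = h.1.1 0 0 := by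
  have hm : 𝓂[K] = Ideal.span {ϖ.1} := ϖ.2.maximalIdeal_eq
  obtain ⟨c, hc⟩ : ∃ c, h.1.1 1 0 = ϖ.1 * c := by
    have : h.1.1 1 0 ∈ 𝓂[K] := h.2
    rwa [hm, Ideal.mem_span_singleton] at this
  -- For `h = (a b; ϖc d)` the conjugate is `(d c; ϖb a)`.
  have hdet : IsUnit (!![h.1.1 1 1, c; ϖ.1 * h.1.1 0 1, h.1.1 0 0]).det := by
    have : (!![h.1.1 1 1, c; ϖ.1 * h.1.1 0 1, h.1.1 0 0]).det = h.1.1.det := by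
      rw [Matrix.det_fin_two_of, Matrix.det_fin_two, hc]; ring
    rw [this]
    exact (Matrix.isUnit_iff_isUnit_det _).1 h.1.isUnit
  set h' := GeneralLinearGroup.mk'' _ hdet with hh'
  have hv : h'.1 = !![h.1.1 1 1, c; ϖ.1 * h.1.1 0 1, h.1.1 0 0] := rfl
  have e1 : emb h.1 * wMat ϖ = wMat ϖ * emb h' := by
    ext i j
    fin_cases i <;> fin_cases j <;>
      simp [wMat, emb, GeneralLinearGroup.mkOfDetNeZero, Matrix.mul_apply, Fin.sum_univ_two, hv, hc,
        Uniformizer.coe_unit, mul_comm]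
  have e2 : wMat ϖ * emb h.1 = emb h' * wMat ϖ := by
    ext i j
    fin_cases i <;> fin_cases j <;>
      simp [wMat, emb, GeneralLinearGroup.mkOfDetNeZero, Matrix.mul_apply, Fin.sum_univ_two, hv, hc,
        Uniformizer.coe_unit, mul_comm]
  refine ⟨⟨h', ?_⟩, fun n => Subtype.ext ?_, fun n => Subtype.ext ?_, rfl, rfl⟩
  · change ϖ.1 * h.1.1 0 1 ∈ 𝓂[K]
    rw [hm]
    exact Ideal.mul_mem_right _ _ (Ideal.subset_span rfl)
  · rw [coe_stabHom, coe_stabHom, toVertex_zero, toVertex_one, ← e1]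
    simp
  · rw [coe_stabHom, coe_stabHom, toVertex_zero, toVertex_one, e2]
    simp

end Groups

section Nodes

open Matrix (GeneralLinearGroup)

variable {K : Type*} [Field K] [ValuativeRel K] {k : Type*} [Field k] [Algebra 𝓀[K] k]

lemma red_apply (h : GL (Fin 2) 𝒪[K]) (i j : Fin 2) : (red k h).1 i j = redHom k (h.1 i j) :=
  GeneralLinearGroup.map_apply _ _ _ _

lemma redHom_eq_zero_iff {x : 𝒪[K]} : redHom k x = 0 ↔ x ∈ 𝓂[K] := by
  rw [redHom, RingHom.comp_apply, map_eq_zero, IsLocalRing.residue_eq_zero_iff]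

lemma redHom_iwahori (β : iwahori K) : redHom k (β.1.1 1 0) = 0 := redHom_eq_zero_iff.2 β.2

lemma change_nodeCoord_apply (h : GL (Fin 2) 𝒪[K]) (j : Fin 2) :
    ((nodeCoord (k := k)).change (red k h)).1 j = redHom k (h.1 1 j) := by
  rw [Coord.change_apply, red_apply, red_apply]
  simp [nodeCoord]

/-- The Iwahori subgroup fixes the node. -/
lemma change_iwahori (β : iwahori K) :
    ((nodeCoord (k := k)).change (red k β.1)).1 = redHom k (β.1.1 1 1) • nodeCoord.1 := by
  ext j
  rw [change_nodeCoord_apply]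
  fin_cases j
  · simpa [nodeCoord] using redHom_iwahori β
  · simp [nodeCoord]

lemma pt_change_iwahori (β : iwahori K) :
    ((nodeCoord (k := k)).change (red k β.1)).pt = nodeCoord.pt :=
  Coord.pt_eq_iff.2 ⟨_, change_iwahori β⟩

/-- Homogeneous coordinates of the rational points of the projective line: `(0, 1)` and
the `(1, a)`. -/
noncomputable def nodeVec (k : Type*) [Field k] [Algebra 𝓀[K] k] : Option 𝓀[K] → Coord k
  | none => nodeCoord
  | some a => ⟨![1, algebraMap 𝓀[K] k a], fun h => one_ne_zero (congrFun h 0)⟩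

/-- Elements of `GL₂(𝒪_K)` carrying the standard node to the rational points. -/
noncomputable def nodeRep : Option 𝓀[K] → GL (Fin 2) 𝒪[K]
  | none => 1
  | some a => GeneralLinearGroup.mk'' !![0, 1; 1, (IsLocalRing.residue_surjective a).choose]
      (by simp [Matrix.det_fin_two_of])

lemma residue_nodeRep (a : 𝓀[K]) :
    IsLocalRing.residue 𝒪[K] ((nodeRep (some a)).1 1 1) = a :=
  (IsLocalRing.residue_surjective a).choose_spec

lemma change_nodeRep (j : Option 𝓀[K]) :
    (nodeCoord (k := k)).change (red k (nodeRep j)) = nodeVec k j := by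
  refine Subtype.ext (funext fun i => ?_)
  rw [change_nodeCoord_apply]
  rcases j with _ | a
  · fin_cases i <;> simp [nodeRep, nodeVec, nodeCoord]
  · fin_cases i
    · change redHom k 1 = 1
      exact map_one _
    · exact congrArg (algebraMap 𝓀[K] k) (residue_nodeRep a)

/-- The elements `nodeRep j` represent the cosets of the Iwahori subgroup, which correspond to the
rational points of the projective line. -/
lemma exists_iwahori_mul_nodeRep (h : GL (Fin 2) 𝒪[K]) :
    ∃ (β : iwahori K) (j : Option 𝓀[K]), h = β * nodeRep j := by
  by_cases hc : h.1 1 0 ∈ 𝓂[K]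
  · exact ⟨⟨h, hc⟩, none, by simp [nodeRep]⟩
  · obtain ⟨u, hu⟩ : IsUnit (h.1 1 0) := by
      by_contra hn
      exact hc ((IsLocalRing.mem_maximalIdeal _).2 hn)
    set a := IsLocalRing.residue 𝒪[K] (h.1 1 1 * u⁻¹) with ha
    refine ⟨⟨h * (nodeRep (some a))⁻¹, ?_⟩, some a, by simp⟩
    change (h * (nodeRep (some a))⁻¹).1 1 0 ∈ 𝓂[K]
    have hr : (nodeRep (some a)).1 = !![0, 1; 1, (nodeRep (some a)).1 1 1] := rfl
    have e : (h * (nodeRep (some a))⁻¹).1 1 0 = h.1 1 1 - h.1 1 0 * (nodeRep (some a)).1 1 1 := by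
      rw [Units.val_mul, Matrix.coe_units_inv, hr]
      simp [Matrix.inv_def, Matrix.mul_apply, Fin.sum_univ_two, Matrix.adjugate_fin_two,
        Matrix.det_fin_two_of]
      rw [show Ring.inverse (-1 : 𝒪[K]) = -1 from Ring.inverse_unit (-1)]
      ring
    rw [e, ← IsLocalRing.residue_eq_zero_iff, map_sub, map_mul, residue_nodeRep, ha, ← hu,
      ← map_mul, mul_left_comm, Units.mul_inv, mul_one, sub_self]

variable (K k) in
/-- The rational points of the projective line, i.e. the double points on each component. -/
def nodeSet : Set (P1 k) := Set.range fun j : Option 𝓀[K] => (nodeVec k j).pt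

lemma pt_change_mem_nodeSet (h : GL (Fin 2) 𝒪[K]) :
    (nodeCoord.change (red k h)).pt ∈ nodeSet K k := by
  obtain ⟨β, j, rfl⟩ := exists_iwahori_mul_nodeRep h
  refine ⟨j, ?_⟩
  rw [map_mul, Coord.change_mul, Coord.pt_change_eq _ (pt_change_iwahori β), change_nodeRep]

lemma mem_nodeSet_iff {p : P1 k} :
    p ∈ nodeSet K k ↔ ∃ h : GL (Fin 2) 𝒪[K], (nodeCoord.change (red k h)).pt = p := by
  constructor
  · rintro ⟨j, rfl⟩
    exact ⟨nodeRep j, by rw [change_nodeRep]⟩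
  · rintro ⟨h, rfl⟩
    exact pt_change_mem_nodeSet h

lemma pt_change_mem_nodeSet_iff (h : GL (Fin 2) 𝒪[K]) {z : Coord k} :
    (z.change (red k h)).pt ∈ nodeSet K k ↔ z.pt ∈ nodeSet K k := by
  simp only [mem_nodeSet_iff]
  constructor
  · rintro ⟨h', e⟩
    refine ⟨h' * h⁻¹, ?_⟩
    rw [map_mul, Coord.change_mul, Coord.pt_change_eq _ e, map_inv, Coord.change_change_inv]
  · rintro ⟨h', e⟩
    exact ⟨h' * h, by rw [map_mul, Coord.change_mul, Coord.pt_change_eq _ e]⟩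

lemma nodeVec_injective : Function.Injective fun j : Option 𝓀[K] => (nodeVec k j).pt := by
  have key : ∀ a : 𝓀[K], (nodeVec (K := K) k (some a)).pt ≠ (nodeVec (K := K) k none).pt := by
    intro a h
    obtain ⟨c, hc⟩ := Coord.pt_eq_iff.1 h
    simpa [nodeVec, nodeCoord] using congrFun hc 0
  rintro (_ | a) (_ | a') h
  · rfl
  · exact absurd h.symm (key a')
  · exact absurd h (key a)
  · obtain ⟨c, hc⟩ := Coord.pt_eq_iff.1 h
    have h0 : (1 : k) = c * 1 := congrFun hc 0
    have h1 : algebraMap 𝓀[K] k a = c * algebraMap 𝓀[K] k a' := congrFun hc 1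
    rw [mul_one] at h0
    rw [← h0, one_mul] at h1
    rw [(algebraMap 𝓀[K] k).injective h1]

lemma nodeSet_finite [Finite 𝓀[K]] : (nodeSet K k).Finite := Set.finite_range _

end Nodes


/-! ### Points and regular sections of the special fibre -/

section Points

open MvPolynomial Filter Topology
open Matrix (GeneralLinearGroup)

variable {k : Type*} [Field k]

lemma isOpen_of_forall_eventually {V : Set (P1 k)}
    (h : ∀ z : Coord k, z.pt ∈ V → ∀ᶠ z' in 𝓝 z, z'.pt ∈ V) : IsOpen V := by
  have hR := fun z hz => eventually_nhds_iff_exists_form.1 (h z hz)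
  choose b R hRh h0 h1 using hR
  have : V = ⋃ (z : Coord k) (hz : z.pt ∈ V), nonvanishing (R z hz) := by
    ext p
    simp only [Set.mem_iUnion]
    constructor
    · intro hp
      obtain ⟨z, rfl⟩ := Coord.exists_pt p
      exact ⟨z, hp, (mem_nonvanishing (hRh z hp)).2 (h0 z hp)⟩
    · rintro ⟨z, hz, z', rfl, hne⟩
      exact h1 z hz z' hne
  rw [this]
  exact isOpen_iUnion fun z => isOpen_iUnion fun hz =>
    TopologicalSpace.isOpen_generateFrom_of_mem ⟨_, _, hRh z hz, rfl⟩

lemma eventually_of_isOpen {V : Set (P1 k)} (hV : IsOpen V) {z : Coord k} (hz : z.pt ∈ V) :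
    ∀ᶠ z' in 𝓝 z, z'.pt ∈ V := (isOpen_induced hV).mem_nhds hz

lemma exists_isOpen_of_eventually {p : Coord k → Prop} {z : Coord k} (h : ∀ᶠ z' in 𝓝 z, p z') :
    ∃ V : Set (P1 k), IsOpen V ∧ z.pt ∈ V ∧ ∀ z' : Coord k, z'.pt ∈ V → p z' := by
  obtain ⟨b, R, hR, h0, h1⟩ := eventually_nhds_iff_exists_form.1 h
  exact ⟨_, TopologicalSpace.isOpen_generateFrom_of_mem ⟨b, R, hR, rfl⟩,
    (mem_nonvanishing hR).2 h0, fun z' hz' => h1 z' ((mem_nonvanishing hR).1 hz')⟩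

variable {K : Type*} [Field K] [ValuativeRel K] {ϖ : Uniformizer K} [Algebra 𝓀[K] k]

lemma isOpen_preimage_chart {U : Set (HBar ϖ k)} (hU : IsOpen U) (g : GL (Fin 2) K) :
    IsOpen (chart ϖ g ⁻¹' U) := (isOpen_iff U).1 hU g

lemma exists_chart (x : HBar ϖ k) : ∃ (g : GL (Fin 2) K) (z : Coord k), chart ϖ g z.pt = x := by
  obtain ⟨⟨g, p⟩, rfl⟩ := Quot.exists_rep x
  obtain ⟨z, rfl⟩ := Coord.exists_pt p
  exact ⟨g, z, rfl⟩

lemma chart_coord (g : GL (Fin 2) K) (h : GL (Fin 2) 𝒪[K]) (z : Coord k) :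
    chart ϖ (g * emb h) (z.change (red k h)).pt = chart ϖ g z.pt :=
  (Quot.sound (Glue.coord g h z)).symm

lemma chart_homothety (g : GL (Fin 2) K) (c : Kˣ) (p : P1 k) :
    chart ϖ (g * GeneralLinearGroup.scalar (Fin 2) c) p = chart ϖ g p :=
  (Quot.sound (Glue.homothety g c p)).symm

lemma chart_node (g : GL (Fin 2) K) :
    chart ϖ (g * wMat ϖ) (nodeCoord (k := k)).pt = chart ϖ g nodeCoord.pt :=
  (Quot.sound (Glue.node g)).symm

/-- A predicate on pairs `(g, p)` that is invariant under the identifications only depends on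
the point of the special fibre. -/
lemma iff_of_chart_eq {Q : GL (Fin 2) K × P1 k → Prop} (hQ : ∀ a b, Glue ϖ k a b → (Q a ↔ Q b))
    {g g' : GL (Fin 2) K} {p p' : P1 k} (h : chart ϖ g p = chart ϖ g' p') :
    Q (g, p) ↔ Q (g', p') :=
  iff_of_eq (congrArg (Quot.lift Q fun a b hab => propext (hQ a b hab)) h)

/-- A point that is not a double point lies on a single component. -/
lemma exists_of_chart_eq {g g' : GL (Fin 2) K} {z z' : Coord k} (hz : z.pt ∉ nodeSet K k)
    (e : chart ϖ g z.pt = chart ϖ g' z'.pt) : ∃ (h : GL (Fin 2) 𝒪[K]) (c : Kˣ),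
      g' = g * emb h * GeneralLinearGroup.scalar (Fin 2) c ∧ z'.pt = (z.change (red k h)).pt := by
  let Q : GL (Fin 2) K × P1 k → Prop := fun a => ∃ (h : GL (Fin 2) 𝒪[K]) (c : Kˣ),
    a.1 = g * emb h * GeneralLinearGroup.scalar (Fin 2) c ∧ a.2 = (z.change (red k h)).pt
  refine (iff_of_chart_eq (Q := Q) ?_ e).1 ⟨1, 1, by simp, by simp [Coord.change_one]⟩
  have hn : ∀ g, ¬ Q (g, nodeCoord.pt) := by
    rintro g ⟨h, c, -, e⟩
    exact hz ((pt_change_mem_nodeSet_iff h).1 (e ▸ ⟨none, rfl⟩))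
  rintro _ _ (⟨g₁, h₁, z₁⟩ | ⟨g₁, c₁, p₁⟩ | ⟨g₁⟩)
  · constructor
    · rintro ⟨h, c, e1, e2⟩
      refine ⟨h * h₁, c, ?_, ?_⟩
      · simp only at e1 ⊢
        rw [e1, mul_assoc, GeneralLinearGroup.scalar_commute, map_mul]
        simp only [mul_assoc]
      · simp only at e2 ⊢
        rw [map_mul, Coord.change_mul, Coord.pt_change_eq _ e2]
    · rintro ⟨h, c, e1, e2⟩
      refine ⟨h * h₁⁻¹, c, ?_, ?_⟩
      · simp only at e1 ⊢
        have hc := GeneralLinearGroup.scalar_commute (n := Fin 2) c (emb h₁)⁻¹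
        rw [map_mul, map_inv, ← mul_assoc, mul_assoc, ← hc, ← mul_assoc, ← e1,
          mul_inv_cancel_right]
      · simp only at e2 ⊢
        rw [map_mul, Coord.change_mul, map_inv, ← Coord.pt_change_eq _ e2, Coord.change_change_inv]
  · constructor
    · rintro ⟨h, c, e1, e2⟩
      refine ⟨h, c * c₁, ?_, e2⟩
      simp only at e1 ⊢
      rw [e1, map_mul, mul_assoc]
    · rintro ⟨h, c, e1, e2⟩
      refine ⟨h, c * c₁⁻¹, ?_, e2⟩
      simp only at e1 ⊢
      rw [map_mul, map_inv, ← mul_assoc, ← e1, mul_inv_cancel_right]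
  · exact ⟨fun h => absurd h (hn _), fun h => absurd h (hn _)⟩

lemma mem_nodeSet_of_chart_eq {g g' : GL (Fin 2) K} {z z' : Coord k}
    (e : chart ϖ g z.pt = chart ϖ g' z'.pt) (hz' : z'.pt ∈ nodeSet K k) :
    z.pt ∈ nodeSet K k := by
  by_contra hz
  obtain ⟨h, c, -, e⟩ := exists_of_chart_eq hz e
  exact hz ((pt_change_mem_nodeSet_iff h).1 (e ▸ hz'))

lemma pt_eq_of_chart_eq {g : GL (Fin 2) K} {z z' : Coord k} (hz : z.pt ∉ nodeSet K k)
    (e : chart ϖ g z.pt = chart ϖ g z'.pt) : z.pt = z'.pt := by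
  -- The change of coordinates is given by a scalar matrix, which acts trivially on points.
  obtain ⟨h, c, e1, e2⟩ := exists_of_chart_eq hz e
  rw [mul_assoc, left_eq_mul, mul_eq_one_iff_eq_inv, ← map_inv] at e1
  generalize c⁻¹ = c at e1
  have hent : ∀ i j, ((h.1 i j : 𝒪[K]) : K) = (GeneralLinearGroup.scalar (Fin 2) c).1 i j :=
    fun i j => by rw [← e1]; rfl
  have h01 : h.1 0 1 = 0 := Subtype.ext (by rw [hent]; simp)
  have h10 : h.1 1 0 = 0 := Subtype.ext (by rw [hent]; simp)
  have h11 : h.1 1 1 = h.1 0 0 := Subtype.ext (by rw [hent, hent]; simp)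
  rw [e2, eq_comm, Coord.pt_eq_iff]
  refine ⟨redHom k (h.1 0 0), ?_⟩
  ext j
  rw [Coord.change_apply, red_apply, red_apply]
  fin_cases j <;> simp [h01, h10, h11]

end Points

section Sections

open MvPolynomial Filter Topology
open Matrix (GeneralLinearGroup)

universe v

variable {K : Type*} [Field K] [ValuativeRel K] {ϖ : Uniformizer K}
variable {k : Type*} [Field k] [Algebra 𝓀[K] k]

lemma isRegularOn_iff {U : Set (HBar ϖ k)} (hU : IsOpen U) {f : HBar ϖ k → k} :
    IsRegularOn U f ↔ ∀ (g : GL (Fin 2) K) (z : Coord k), chart ϖ g z.pt ∈ U →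
      (fun z : Coord k => f (chart ϖ g z.pt)) ∈ regAt 0 z :=
  forall_congr' fun g => isTwistRegular_iff (isOpen_preimage_chart hU g)

namespace LineBundle

variable (L : LineBundle.{v} ϖ k)

open Classical in
/-- The coefficient of a section in the frame attached to the point `x` (zero outside the domain of
the frame). -/
noncomputable def frameCoeff (x : HBar ϖ k) (s : ∀ x, L.fiber x) (y : HBar ϖ k) : k :=
  if h : y ∈ L.base x then (L.exists_unique_coeff x y h (s y)).choose else 0

variable {L}

lemma frameCoeff_smul {x y : HBar ϖ k} (h : y ∈ L.base x) (s : ∀ x, L.fiber x) :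
    s y = L.frameCoeff x s y • L.frame x y := by
  rw [frameCoeff, dif_pos h]
  exact (L.exists_unique_coeff x y h (s y)).choose_spec.1

lemma frameCoeff_eq {x y : HBar ϖ k} (h : y ∈ L.base x) {s : ∀ x, L.fiber x} {c : k}
    (e : s y = c • L.frame x y) : L.frameCoeff x s y = c :=
  (L.exists_unique_coeff x y h (s y)).unique (frameCoeff_smul h s) e

variable (L) in
/-- The restriction of `s` to the component of `[g 𝒪_K²]` is regular at the point with coordinates
`z`. -/
def IsRegularOnComponentAt (g : GL (Fin 2) K) (z : Coord k) (s : ∀ x, L.fiber x) : Prop :=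
  (fun y : Coord k => L.frameCoeff (chart ϖ g z.pt) s (chart ϖ g y.pt)) ∈ regAt 0 z

variable {g : GL (Fin 2) K} {z : Coord k} {s : ∀ x, L.fiber x}

lemma eventually_mem_base {x : HBar ϖ k} (h : chart ϖ g z.pt ∈ L.base x) :
    ∀ᶠ y : Coord k in 𝓝 z, chart ϖ g y.pt ∈ L.base x :=
  eventually_of_isOpen (isOpen_preimage_chart (L.isOpen_base x) g) h

lemma frameCoeff_mem_regAt_of {x x' : HBar ϖ k} (h : chart ϖ g z.pt ∈ L.base x)
    (h' : chart ϖ g z.pt ∈ L.base x')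
    (hs : (fun y : Coord k => L.frameCoeff x s (chart ϖ g y.pt)) ∈ regAt 0 z) :
    (fun y : Coord k => L.frameCoeff x' s (chart ϖ g y.pt)) ∈ regAt 0 z := by
  obtain ⟨c, hc, hcf⟩ := L.transition x' x
  have hc' := (isRegularOn_iff ((L.isOpen_base x').inter (L.isOpen_base x))).1 hc g z ⟨h', h⟩
  refine (regAt_congr ?_).1 (by simpa using mul_mem_regAt hs hc')
  filter_upwards [eventually_mem_base h, eventually_mem_base h'] with y hy hy'
  refine (frameCoeff_eq hy' ?_).symm
  rw [mul_smul, ← hcf _ ⟨hy', hy⟩, ← frameCoeff_smul hy]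

lemma isRegularOnComponentAt_iff {x : HBar ϖ k} (h : chart ϖ g z.pt ∈ L.base x) :
    L.IsRegularOnComponentAt g z s ↔
      (fun y : Coord k => L.frameCoeff x s (chart ϖ g y.pt)) ∈ regAt 0 z :=
  ⟨frameCoeff_mem_regAt_of (L.mem_base _) h, frameCoeff_mem_regAt_of h (L.mem_base _)⟩

lemma eventually_isRegularOnComponentAt (h : L.IsRegularOnComponentAt g z s) :
    ∀ᶠ y in 𝓝 z, L.IsRegularOnComponentAt g y s := by
  filter_upwards [eventually_mem_base (L.mem_base (chart ϖ g z.pt)), eventually_mem_regAt h]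
    with y h1 h2 using (isRegularOnComponentAt_iff h1).2 h2

lemma isRegular_iff {U : Set (HBar ϖ k)} (hU : IsOpen U) :
    L.IsRegular U s ↔ ∀ (g : GL (Fin 2) K) (z : Coord k), chart ϖ g z.pt ∈ U →
      L.IsRegularOnComponentAt g z s := by
  constructor
  · intro h g z hz
    obtain ⟨f, hf, hs⟩ := h (chart ϖ g z.pt)
    have hU' := hU.inter (L.isOpen_base (chart ϖ g z.pt))
    refine (regAt_congr ?_).1 ((isRegularOn_iff hU').1 hf g z ⟨hz, L.mem_base _⟩)
    filter_upwards [eventually_of_isOpen (isOpen_preimage_chart hU' g) ⟨hz, L.mem_base _⟩] with y hy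
    exact (frameCoeff_eq hy.2 (hs _ hy)).symm
  · intro h x
    exact ⟨L.frameCoeff x s, (isRegularOn_iff (hU.inter (L.isOpen_base x))).2 fun g z hz =>
      (isRegularOnComponentAt_iff hz.2).1 (h g z hz.1), fun y hy => frameCoeff_smul hy.2 s⟩

lemma isRegular_frame (x : HBar ϖ k) : L.IsRegular (L.base x) (L.frame x) := fun x' => by
  obtain ⟨c, hc, h⟩ := L.transition x' x
  rw [Set.inter_comm] at hc h
  exact ⟨c, hc, h⟩

lemma isRegularOnComponent_iff {V : Set (P1 k)} (hV : IsOpen V) :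
    L.IsRegularOnComponent g V (fun p => s (chart ϖ g p)) ↔
      ∀ z : Coord k, z.pt ∈ V → L.IsRegularOnComponentAt g z s := by
  have hV' : ∀ x, IsOpen (V ∩ chart ϖ g ⁻¹' L.base x) := fun x =>
    hV.inter (isOpen_preimage_chart (L.isOpen_base x) g)
  constructor
  · intro h z hz
    obtain ⟨f, hf, hs⟩ := h (chart ϖ g z.pt)
    refine (regAt_congr ?_).1 ((isTwistRegular_iff (hV' _)).1 hf z ⟨hz, L.mem_base _⟩)
    filter_upwards [eventually_of_isOpen (hV' _) ⟨hz, L.mem_base _⟩] with y hy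
    exact (frameCoeff_eq hy.2 (hs _ hy)).symm
  · intro h x
    exact ⟨fun p => L.frameCoeff x s (chart ϖ g p), (isTwistRegular_iff (hV' x)).2 fun z hz =>
      (isRegularOnComponentAt_iff hz.2).1 (h z hz.1), fun p hp => frameCoeff_smul hp.2 s⟩

lemma ComponentIso.isRegularOnComponentAt_iff {n : ℤ} (θ : L.ComponentIso g n) :
    L.IsRegularOnComponentAt g z s ↔ θ.coeff s ∈ regAt n z := by
  constructor
  · intro h
    obtain ⟨V, hV, hz, hV'⟩ := exists_isOpen_of_eventually (eventually_isRegularOnComponentAt h)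
    exact (isTwistRegular_iff hV).1
      ((θ.isRegular_iff V hV _).1 ((isRegularOnComponent_iff hV).2 hV')) z hz
  · intro h
    obtain ⟨V, hV, hz, hV'⟩ := exists_isOpen_of_eventually (eventually_mem_regAt h)
    exact (isRegularOnComponent_iff hV).1
      ((θ.isRegular_iff V hV _).2 ((isTwistRegular_iff hV).2 hV')) z hz

lemma isRegularOnComponentAt_coord (h : GL (Fin 2) 𝒪[K]) :
    L.IsRegularOnComponentAt (g * emb h) (z.change (red k h)) s ↔
      L.IsRegularOnComponentAt g z s := by
  unfold IsRegularOnComponentAt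
  rw [← comp_change_mem_regAt_iff]
  simp only [chart_coord]

lemma isRegularOnComponentAt_homothety (c : Kˣ) :
    L.IsRegularOnComponentAt (g * GeneralLinearGroup.scalar (Fin 2) c) z s ↔
      L.IsRegularOnComponentAt g z s := by
  unfold IsRegularOnComponentAt
  simp only [chart_homothety]

lemma isRegularOnComponentAt_of_pt_eq {z' : Coord k} (h : z.pt = z'.pt)
    (hs : L.IsRegularOnComponentAt g z s) : L.IsRegularOnComponentAt g z' s := by
  unfold IsRegularOnComponentAt at hs ⊢
  rw [← h]
  exact regAt_of_pt_eq h hs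

lemma isRegularOnComponentAt_of_notMem (hz : z.pt ∉ nodeSet K k)
    (h : L.IsRegularOnComponentAt g z s) {g' : GL (Fin 2) K} {z' : Coord k}
    (e : chart ϖ g' z'.pt = chart ϖ g z.pt) : L.IsRegularOnComponentAt g' z' s := by
  obtain ⟨a, c, rfl, hz'⟩ := exists_of_chart_eq hz e.symm
  exact isRegularOnComponentAt_of_pt_eq hz'.symm ((isRegularOnComponentAt_homothety c).2
    ((isRegularOnComponentAt_coord a).2 h))

/-- Regularity at a point can be tested on the components containing it. -/
lemma isRegularAt_iff [Finite 𝓀[K]] {x : HBar ϖ k} : L.IsRegularAt s x ↔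
    ∀ (g : GL (Fin 2) K) (z : Coord k), chart ϖ g z.pt = x → L.IsRegularOnComponentAt g z s := by
  constructor
  · rintro ⟨U, hU, hx, h⟩ g z rfl
    exact (isRegular_iff hU).1 h g z hx
  · intro h
    let U : Set (HBar ϖ k) := {y | ∀ (g : GL (Fin 2) K) (z : Coord k), chart ϖ g z.pt = y →
      L.IsRegularOnComponentAt g z s}
    -- Near a point all other points of a component lie on no other component, where regularity on
    -- the component is enough.
    have hU : IsOpen U := by
      refine (isOpen_iff U).2 fun g => isOpen_of_forall_eventually fun z hz => ?_
      filter_upwards [eventually_isRegularOnComponentAt (hz g z rfl),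
        eventually_eq_or_notMem (nodeSet_finite (K := K) (k := k)) z] with y hy hy'
      rcases hy' with hy' | hy'
      · rw [hy']; exact hz
      · exact fun g' z' e => isRegularOnComponentAt_of_notMem hy' hy e
    exact ⟨U, hU, h, (isRegular_iff hU).2 fun g z hz => hz g z rfl⟩

lemma isRegularAt_of_notMem [Finite 𝓀[K]] (hz : z.pt ∉ nodeSet K k)
    (h : L.IsRegularOnComponentAt g z s) : L.IsRegularAt s (chart ϖ g z.pt) :=
  isRegularAt_iff.2 fun _ _ e => isRegularOnComponentAt_of_notMem hz h e

lemma mem_H0_iff : s ∈ L.H0 ↔ ∀ (g : GL (Fin 2) K) (z : Coord k), L.IsRegularOnComponentAt g z s :=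
  (isRegular_iff isOpen_univ).trans (forall₂_congr fun _ _ => by simp)

end LineBundle

end Sections


/-! ### Gluing over the special fibre, and characters of the stabilizers -/

section Gluing

open MvPolynomial Filter Topology
open Matrix (GeneralLinearGroup)

variable {K : Type*} [Field K] [ValuativeRel K] {ϖ : Uniformizer K}
variable {k : Type*} [Field k] [Algebra 𝓀[K] k]

lemma chart_mul_stabHom (γ : evenGroup ϖ) (i : Fin 2) (h : GL (Fin 2) 𝒪[K]) (n : Multiplicative ℤ)
    (z : Coord k) : chart ϖ ((γ * stabHom ϖ i (h, n) : evenGroup ϖ) * toVertex ϖ i)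
      (z.change (red k h)).pt = chart ϖ (γ * toVertex ϖ i) z.pt := by
  rw [Subgroup.coe_mul, mul_assoc, coe_stabHom_mul_toVertex, ← mul_assoc, ← mul_assoc,
    chart_homothety, chart_coord]

lemma Coord.pt_change_scalar (u : kˣ) (z : Coord k) :
    (z.change (GeneralLinearGroup.scalar (Fin 2) u)).pt = z.pt := by
  refine Coord.pt_eq_iff.2 ⟨u, ?_⟩
  ext j
  rw [Coord.change_apply]
  fin_cases j <;> simp

lemma red_scalar (u : 𝒪[K]ˣ) : red k (GeneralLinearGroup.scalar (Fin 2) u) =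
    GeneralLinearGroup.scalar (Fin 2) (Units.map (redHom k).toMonoidHom u) := by
  ext i j
  rw [red_apply]
  fin_cases i <;> fin_cases j <;> simp

variable [TopologicalSpace K] [IsNonarchimedeanLocalField K]

/-- Predicates on triples `(γ, i, z)`, standing for the point `γ [z]` of the component of
`γ s_i`, that only depend on this point: it is enough to check compatibility with the stabilizers
of the two standard vertices and with the standard edge. -/
lemma iff_of_chart_mul_toVertex_eq {Q : evenGroup ϖ → Fin 2 → Coord k → Prop}
    (hpt : ∀ γ i z z', z.pt = z'.pt → Q γ i z → Q γ i z')
    (hstab : ∀ γ i h n z, Q (γ * stabHom ϖ i (h, n)) i (z.change (red k h)) ↔ Q γ i z)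
    (hnode : ∀ γ, Q γ 0 nodeCoord ↔ Q γ 1 nodeCoord)
    {γ γ' : evenGroup ϖ} {i i' : Fin 2} {z z' : Coord k}
    (h : chart ϖ (γ * toVertex ϖ i) z.pt = chart ϖ (γ' * toVertex ϖ i') z'.pt) :
    Q γ i z ↔ Q γ' i' z' := by
  have hpt' : ∀ γ i z z', z.pt = z'.pt → (Q γ i z ↔ Q γ i z') := fun γ i z z' e =>
    ⟨hpt γ i z z' e, hpt γ i z' z e.symm⟩
  -- Each `g` is uniquely of the form `γ * toVertex ϖ i`, so that `Q` is a predicate on pairs; its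
  -- invariance is checked for each kind of identification.
  let R : GL (Fin 2) K × P1 k → Prop := fun a =>
    ∃ (γ : evenGroup ϖ) (i : Fin 2) (z : Coord k), a = ((γ : GL (Fin 2) K) * toVertex ϖ i, z.pt) ∧
      Q γ i z
  have hR : ∀ (γ : evenGroup ϖ) i z, R ((γ : GL (Fin 2) K) * toVertex ϖ i, z.pt) ↔ Q γ i z := by
    intro γ i z
    constructor
    · rintro ⟨γ₁, i₁, z₁, e, hq⟩
      obtain ⟨rfl, rfl⟩ := toVertex_inj ϖ (Prod.ext_iff.1 e).1
      exact (hpt' _ _ _ _ (Prod.ext_iff.1 e).2).2 hq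
    · exact fun hq => ⟨γ, i, z, rfl, hq⟩
  rw [← hR, ← hR]
  refine iff_of_chart_eq ?_ h
  have hhom : ∀ (g : GL (Fin 2) K) (c : Kˣ) (z : Coord k),
      R (g, z.pt) ↔ R (g * GeneralLinearGroup.scalar (Fin 2) c, z.pt) := by
    intro g c z
    obtain ⟨γ, i, rfl⟩ := exists_eq_mul_toVertex ϖ g
    obtain ⟨n, u, rfl⟩ := exists_zpow_mul_unit ϖ c
    have e : (γ : GL (Fin 2) K) * toVertex ϖ i * GeneralLinearGroup.scalar (Fin 2)
        (ϖ.unit ^ n * Units.map (algebraMap 𝒪[K] K).toMonoidHom u) =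
        (γ * stabHom ϖ i (GeneralLinearGroup.scalar (Fin 2) u, Multiplicative.ofAdd n) :
          evenGroup ϖ) * toVertex ϖ i := by
      rw [Subgroup.coe_mul, mul_assoc (γ : GL (Fin 2) K) (stabHom ϖ i _ : GL (Fin 2) K),
        coe_stabHom_mul_toVertex, mul_comm, map_mul, emb_scalar, toAdd_ofAdd]
      simp only [mul_assoc]
    rw [e, hR, hR, ← hstab γ i (GeneralLinearGroup.scalar (Fin 2) u) (Multiplicative.ofAdd n) z]
    refine hpt' _ _ _ _ ?_
    rw [red_scalar, Coord.pt_change_scalar]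
  rintro _ _ (⟨g, h, z⟩ | ⟨g, c, p⟩ | ⟨g⟩)
  · obtain ⟨γ, i, rfl⟩ := exists_eq_mul_toVertex ϖ g
    have e : (γ : GL (Fin 2) K) * toVertex ϖ i * emb h =
        (γ * stabHom ϖ i (h, 1) : evenGroup ϖ) * toVertex ϖ i := by
      rw [Subgroup.coe_mul, mul_assoc (γ : GL (Fin 2) K) (stabHom ϖ i _ : GL (Fin 2) K),
        coe_stabHom_mul_toVertex]
      simp [mul_assoc]
    rw [e, hR, hR, hstab]
  · obtain ⟨z, rfl⟩ := Coord.exists_pt p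
    exact hhom g c z
  · have h1 : ∀ γ : evenGroup ϖ, R ((γ : GL (Fin 2) K), nodeCoord.pt) ↔
        R ((γ : GL (Fin 2) K) * wMat ϖ, nodeCoord.pt) := by
      intro γ
      have := hR γ 1 nodeCoord
      rw [toVertex_one, mul_one] at this
      rw [this, ← toVertex_zero, hR, hnode]
    obtain ⟨γ, i, rfl⟩ := exists_eq_mul_toVertex ϖ g
    fin_cases i
    · change R ((γ : GL (Fin 2) K) * toVertex ϖ 0, _) ↔ R (γ * toVertex ϖ 0 * wMat ϖ, _)
      rw [toVertex_zero, mul_assoc, wMat_mul_wMat, ← hhom, h1]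
    · change R ((γ : GL (Fin 2) K) * toVertex ϖ 1, _) ↔ R (γ * toVertex ϖ 1 * wMat ϖ, _)
      rw [toVertex_one, mul_one, h1]

/-- A character of `G°ϖ^ℤ` that is given on `Iϖ^ℤ` by `(a, b; c, d) ↦ a^m d^{m'}` is `det^m`. -/
lemma eq_det_zpow (χ : MaxCompactMod K →* k) {m m' : ℤ} (hχ : ∀ (β : iwahori K) n,
    χ (β.1, n) = redHom k (β.1.1 0 0) ^ m * redHom k (β.1.1 1 1) ^ m') (x : MaxCompactMod K) :
    χ x = ((GeneralLinearGroup.det (red k x.1) ^ m : kˣ) : k) := by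
  have key : ∀ (h : GL (Fin 2) 𝒪[K]) (h0 : h.1 1 0 = 0) n,
      χ (h, n) = redHom k (h.1 0 0) ^ m * redHom k (h.1 1 1) ^ m' := fun h h0 n =>
    hχ ⟨h, show h.1 1 0 ∈ 𝓂[K] from h0 ▸ zero_mem _⟩ n
  -- A reflection, unipotent and diagonal matrices. Conjugation by `S` exchanges the diagonal
  -- entries, hence `a ^ m = a ^ m'` on units; and `S` is a product of conjugates of elements of
  -- `I`.
  let S : GL (Fin 2) 𝒪[K] := GeneralLinearGroup.mk'' !![0, 1; 1, 0]
    (by simp [Matrix.det_fin_two_of])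
  let U : 𝒪[K] → GL (Fin 2) 𝒪[K] := fun a => GeneralLinearGroup.mk'' !![1, a; 0, 1]
    (by simp [Matrix.det_fin_two_of])
  let T : 𝒪[K]ˣ → 𝒪[K]ˣ → GL (Fin 2) 𝒪[K] := fun a d => GeneralLinearGroup.mk'' !![a, 0; 0, d]
    (by simp [Matrix.det_fin_two_of])
  have eS : S.1 = !![0, 1; 1, 0] := rfl
  have eU : ∀ a, (U a).1 = !![1, a; 0, 1] := fun _ => rfl
  have eT : ∀ a d, (T a d).1 = !![(a : 𝒪[K]), 0; 0, (d : 𝒪[K])] := fun _ _ => rfl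
  have hU : ∀ a, χ (U a, 1) = 1 := fun a => by rw [key _ rfl]; simp [eU]
  have hT : ∀ a d : 𝒪[K]ˣ, χ (T a d, 1) = redHom k (a : 𝒪[K]) ^ m * redHom k (d : 𝒪[K]) ^ m' :=
    fun a d => by rw [key _ rfl]; simp [eT]
  have hSS : χ (S, 1) * χ (S, 1) = 1 := by
    rw [← map_mul, ← map_one χ]
    congr 1
    refine Prod.ext ?_ rfl
    ext i j
    fin_cases i <;> fin_cases j <;> simp [eS, Matrix.mul_apply]
  have hconj : ∀ h n, χ (S * h * S, n) = χ (h, n) := by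
    intro h n
    have : ((S * h * S, n) : MaxCompactMod K) = (S, 1) * (h, n) * (S, 1) := by simp
    rw [this, map_mul, map_mul, mul_right_comm, hSS, one_mul]
  have hexp : ∀ a : 𝒪[K]ˣ, redHom k (a : 𝒪[K]) ^ m = redHom k (a : 𝒪[K]) ^ m' := by
    intro a
    have h1 := hT a 1
    have h2 := hT 1 a
    rw [← hconj] at h1
    have : S * T a 1 * S = T 1 a := by
      ext i j
      fin_cases i <;> fin_cases j <;>
        simp [eS, eT, Matrix.mul_apply]
    rw [this, h2] at h1
    simpa using h1.symm
  have hS : χ (S, 1) = redHom k (-1 : 𝒪[K]) ^ m := by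
    have h1 : ((S, 1) : MaxCompactMod K) =
        (U 1, 1) * (S * U (-1) * S, 1) * (U 1, 1) * (T (-1) 1, 1) := by
      refine Prod.ext ?_ rfl
      ext i j
      fin_cases i <;> fin_cases j <;>
        simp [eS, eU, eT, Matrix.mul_apply]
    rw [h1, map_mul, map_mul, map_mul, hconj, hU, hU, hT]
    simp
  have hI : ∀ (β : iwahori K) n, χ (β.1, n) =
      ((GeneralLinearGroup.det (red k β.1) ^ m : kˣ) : k) := by
    intro β n
    have hd : redHom k (β.1.1 0 0) * redHom k (β.1.1 1 1) = (red k β.1).1.det := by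
      rw [Matrix.det_fin_two, red_apply, red_apply, red_apply, red_apply, redHom_iwahori]
      ring
    have hu : IsUnit (β.1.1 1 1) := by
      by_contra hu
      have h0 : redHom k (β.1.1 1 1) = 0 :=
        redHom_eq_zero_iff.2 ((IsLocalRing.mem_maximalIdeal _).2 hu)
      rw [h0, mul_zero] at hd
      exact (red k β.1).det.ne_zero (by simpa using hd.symm)
    obtain ⟨d, hd'⟩ := hu
    rw [hχ, ← hd', ← hexp, hd', ← mul_zpow, hd]
    simp
  -- It remains to compare the characters on representatives of the cosets of `I`.
  obtain ⟨h, n⟩ := x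
  obtain ⟨β, j, rfl⟩ := exists_iwahori_mul_nodeRep h
  have e1 : ((β.1 * nodeRep j, n) : MaxCompactMod K) = (β.1, n) * (nodeRep j, 1) := by simp
  have e2 : χ (nodeRep j, 1) = ((GeneralLinearGroup.det (red k (nodeRep j)) ^ m : kˣ) : k) := by
    cases j with
    | none => exact hI 1 1
    | some a =>
      obtain ⟨b, hb⟩ : ∃ b, (nodeRep (some a) : GL (Fin 2) 𝒪[K]) = S * U b := by
        refine ⟨(IsLocalRing.residue_surjective a).choose, ?_⟩
        have eN : (nodeRep (some a)).1 =
          !![0, 1; 1, (IsLocalRing.residue_surjective a).choose] := rfl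
        ext i j
        fin_cases i <;> fin_cases j <;> simp [eS, eU, eN, Matrix.mul_apply]
      have e3 : ((S * U b, 1) : MaxCompactMod K) = (S, 1) * (U b, 1) := by simp
      have e4 : (GeneralLinearGroup.det (red k (S * U b)) : k) = redHom k (-1 : 𝒪[K]) := by
        rw [GeneralLinearGroup.val_det_apply, Matrix.det_fin_two]
        simp only [red_apply]
        simp [eS, eU, Matrix.mul_apply]
      rw [hb, e3, map_mul, hS, hU, mul_one, Units.val_zpow_eq_zpow_val, e4]
  rw [e1, map_mul, hI, e2]
  simp [mul_zpow]

end Gluing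


/-! ### Trivializations on the components of the standard vertices -/

section Trivializations

open MvPolynomial Filter Topology
open Matrix (GeneralLinearGroup)

universe v

variable {K : Type*} [Field K] [ValuativeRel K] {ϖ : Uniformizer K}
variable {k : Type*} [Field k] [Algebra 𝓀[K] k]

namespace LineBundle.ComponentIso

variable {L : LineBundle.{v} ϖ k} {g : GL (Fin 2) K} {n : ℤ} (θ : L.ComponentIso g n)

lemma coeff_mem_homFun (s : ∀ x, L.fiber x) : θ.coeff s ∈ homFun k n := by
  intro z z' c h
  have e : z'.pt = z.pt := Coord.pt_eq_iff.2 ⟨c, h⟩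
  have : ∀ (p : P1 k) (e' : z'.pt = p), (θ.fiberEquiv z'.pt (s (chart ϖ g z'.pt))).1 ⟨z', rfl⟩ =
      (θ.fiberEquiv p (s (chart ϖ g p))).1 ⟨z', e'⟩ := by
    rintro _ rfl; rfl
  change (θ.fiberEquiv z'.pt _).1 _ = c ^ n * (θ.fiberEquiv z.pt _).1 _
  rw [this _ e]
  exact (θ.fiberEquiv z.pt (s (chart ϖ g z.pt))).2 ⟨z, rfl⟩ ⟨z', e⟩ c h

lemma coeff_congr {s s' : ∀ x, L.fiber x} {z : Coord k}
    (h : s (chart ϖ g z.pt) = s' (chart ϖ g z.pt)) : θ.coeff s z = θ.coeff s' z := by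
  rw [coeff, coeff, h]

lemma coeff_add (s s' : ∀ x, L.fiber x) : θ.coeff (s + s') = θ.coeff s + θ.coeff s' := by
  funext z
  simp [coeff]

lemma coeff_smul (c : k) (s : ∀ x, L.fiber x) : θ.coeff (c • s) = c • θ.coeff s := by
  funext z
  simp [coeff]

lemma eq_zero_of_coeff_eq_zero {s : ∀ x, L.fiber x} {z : Coord k} (h : θ.coeff s z = 0) :
    s (chart ϖ g z.pt) = 0 := by
  refine (LinearEquiv.map_eq_zero_iff (θ.fiberEquiv z.pt)).1 (Subtype.ext (funext fun y => ?_))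
  obtain ⟨c, hc⟩ := Coord.pt_eq_iff.1 y.2
  rw [(θ.fiberEquiv z.pt (s (chart ϖ g z.pt))).2 ⟨z, rfl⟩ y c hc]
  change c ^ n * θ.coeff s z = 0
  rw [h, mul_zero]

lemma exists_coeff_eq (z : Coord k) (c : k) : ∃ s, θ.coeff s z = c := by
  classical
  obtain ⟨j, hj⟩ := exists_coord_ne_zero z
  have hX := zpow_mem_homFun (form_mem_homFun (isHomogeneous_X k j)) n
  have hE : (fun y : Coord k => c * (z.1 j ^ n)⁻¹ * y.1 j ^ n) ∈ homFun k n := by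
    have := (homFun k n).smul_mem (c * (z.1 j ^ n)⁻¹) (by simpa using hX)
    simpa [Pi.smul_def, mul_assoc] using this
  let u : twistFiber n z.pt := ⟨fun y => c * (z.1 j ^ n)⁻¹ * y.1.1 j ^ n,
    fun y y' a h => hE y.1 y'.1 a h⟩
  refine ⟨Function.update 0 (chart ϖ g z.pt) ((θ.fiberEquiv z.pt).symm u), ?_⟩
  rw [coeff, Function.update_self, LinearEquiv.apply_symm_apply]
  exact inv_mul_cancel_right₀ (zpow_ne_zero n hj) c

lemma eq_of_coeff_eq {s s' : ∀ x, L.fiber x} {z : Coord k} (h : θ.coeff s z = θ.coeff s' z) :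
    s (chart ϖ g z.pt) = s' (chart ϖ g z.pt) := by
  have : θ.coeff (s + (-1 : k) • s') z = 0 := by
    rw [coeff_add, coeff_smul, Pi.add_apply, Pi.smul_apply, h]
    simp
  have := θ.eq_zero_of_coeff_eq_zero this
  simpa [← sub_eq_add_neg, sub_eq_zero] using this

end LineBundle.ComponentIso

namespace EquivariantLineBundle

variable {L : EquivariantLineBundle.{v} ϖ k} {s s' : ∀ x, L.fiber x}

/-- The value of a translate of a section at `x` only depends on the value of the section at the
translate of `x`: this is the semilinearity of the action, applied to an indicator function. -/
lemma ρ_congr {γ : evenGroup ϖ} {x : HBar ϖ k}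
    (h : s ((γ : GL (Fin 2) K)⁻¹ • x) = s' ((γ : GL (Fin 2) K)⁻¹ • x)) :
    L.ρ γ s x = L.ρ γ s' x := by
  classical
  have key : ∀ s : ∀ x, L.fiber x, L.ρ γ s x = L.ρ γ (fun y =>
      (if y = (γ : GL (Fin 2) K)⁻¹ • x then (1 : k) else 0) • s y) x := fun s => by
    rw [L.ρ_smul]
    simp
  rw [key s, key s']
  refine congrFun (congrArg (L.ρ γ) (funext fun y => ?_)) x
  split_ifs with hy
  · subst hy; rw [h]
  · simp

lemma inv_smul_chart (γ g : GL (Fin 2) K) (p : P1 k) :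
    γ⁻¹ • chart ϖ (γ * g) p = chart ϖ g p := by
  rw [smul_chart, inv_mul_cancel_left]

lemma isRegularOnComponentAt_ρ (γ : evenGroup ϖ) {g : GL (Fin 2) K} {z : Coord k}
    (h : L.IsRegularOnComponentAt g z s) : L.IsRegularOnComponentAt (γ * g) z (L.ρ γ s) := by
  set x := chart ϖ g z.pt with hx
  set x' := chart ϖ ((γ : GL (Fin 2) K) * g) z.pt with hx'
  have hU := isOpen_preimage_smul ((γ : GL (Fin 2) K)⁻¹) (L.isOpen_base x)
  have hf : L.IsRegularOnComponentAt (γ * g) z (L.ρ γ (L.frame x)) :=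
    (LineBundle.isRegular_iff hU).1 (L.ρ_isRegular γ _ _ (L.isOpen_base x)
      (LineBundle.isRegular_frame x)) _ z (by
        rw [Set.mem_preimage, inv_smul_chart]; exact L.mem_base x)
  refine (regAt_congr ?_).1 (mul_mem_regAt h hf)
  filter_upwards [LineBundle.eventually_mem_base (L.mem_base x),
    LineBundle.eventually_mem_base (L.mem_base x')] with y hy hy'
  refine (LineBundle.frameCoeff_eq hy' ?_).symm
  have e : L.ρ γ s (chart ϖ (γ * g) y.pt) =
      L.ρ γ (fun w => L.frameCoeff x s w • L.frame x w) (chart ϖ (γ * g) y.pt) := by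
    refine ρ_congr ?_
    rw [inv_smul_chart, ← LineBundle.frameCoeff_smul hy]
  rw [e, L.ρ_smul, mul_smul, ← LineBundle.frameCoeff_smul hy']
  simp only [inv_smul_chart, hx]

lemma isRegularOnComponentAt_ρ_iff (γ : evenGroup ϖ) {g : GL (Fin 2) K} {z : Coord k} :
    L.IsRegularOnComponentAt (γ * g) z s ↔ L.IsRegularOnComponentAt g z (L.ρ γ⁻¹ s) := by
  constructor
  · intro h
    have := isRegularOnComponentAt_ρ γ⁻¹ h
    rwa [Subgroup.coe_inv, inv_mul_cancel_left] at this
  · intro h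
    have := isRegularOnComponentAt_ρ γ h
    rwa [Representation.self_inv_apply] at this

lemma inv_smul_chart_toVertex (i : Fin 2) (h : GL (Fin 2) 𝒪[K]) (n : Multiplicative ℤ)
    (z : Coord k) : (stabHom ϖ i (h, n) : GL (Fin 2) K)⁻¹ • chart ϖ (toVertex ϖ i) z.pt =
      chart ϖ (toVertex ϖ i) (z.change (red k h)).pt := by
  have := chart_mul_stabHom (ϖ := ϖ) 1 i h n z
  rw [one_mul, Subgroup.coe_one, one_mul] at this
  rw [← this, inv_smul_chart]

variable (L) in
/-- Trivializations of `L` on the components of the two standard vertices, compatible with the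
action of the stabilizers of these vertices and with each other at the double point:
`res i s` is the restriction of the section `s` to the component of `s_i`, as a homogeneous function
of degree `κ i` of the coordinates. -/
structure Trivialization (κ r : Fin 2 → ℤ) where
  res : Fin 2 → (∀ x, L.fiber x) →ₗ[k] (Coord k → k)
  res_mem : ∀ i s, res i s ∈ homFun k (κ i)
  res_eq_iff : ∀ i (s s' : ∀ x, L.fiber x) (z : Coord k), res i s z = res i s' z ↔
    s (chart ϖ (toVertex ϖ i) z.pt) = s' (chart ϖ (toVertex ϖ i) z.pt)
  exists_res_eq : ∀ i z c, ∃ s, res i s z = c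
  isRegular_iff : ∀ i s z, L.IsRegularOnComponentAt (toVertex ϖ i) z s ↔ res i s ∈ regAt (κ i) z
  res_stab : ∀ i (h : GL (Fin 2) 𝒪[K]) (n : Multiplicative ℤ) s z,
    res i (L.ρ (stabHom ϖ i (h, n)) s) z =
      ((GeneralLinearGroup.det (red k h) ^ r i : kˣ) : k) * res i s (z.change (red k h))
  res_node : ∀ s, res 0 s nodeCoord = res 1 s nodeCoord

variable {i : Fin 2} {n : ℤ}

/-- The action of an element of the stabilizer of `s_i` on the restriction of `L` to the
component of `s_i` is the natural action on `𝒪(n)` up to a constant: the ratio of the two actions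
is a regular function on the projective line. -/
lemma exists_coeff_ρ_eq [IsAlgClosed k] (θ : L.ComponentIso (toVertex ϖ i) n)
    (x : MaxCompactMod K) : ∃ c : k, ∀ s z,
      θ.coeff (L.ρ (stabHom ϖ i x) s) z = c * θ.coeff s (z.change (red k x.1)) := by
  obtain ⟨h, m⟩ := x
  -- The ratio `u` of the two actions is the coefficient of the translate of a section `t z` with
  -- coefficient `1`.
  choose t ht using fun z : Coord k => θ.exists_coeff_eq (z.change (red k h)) 1
  let u : Coord k → k := fun z => θ.coeff (L.ρ (stabHom ϖ i (h, m)) (t z)) z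
  have hu : ∀ s z, θ.coeff (L.ρ (stabHom ϖ i (h, m)) s) z =
      u z * θ.coeff s (z.change (red k h)) := by
    intro s z
    have e : θ.coeff (L.ρ (stabHom ϖ i (h, m)) s) z =
        θ.coeff (L.ρ (stabHom ϖ i (h, m)) (θ.coeff s (z.change (red k h)) • t z)) z := by
      refine θ.coeff_congr (ρ_congr ?_)
      rw [inv_smul_chart_toVertex]
      refine θ.eq_of_coeff_eq ?_
      rw [θ.coeff_smul, Pi.smul_apply, ht, smul_eq_mul, mul_one]
    rw [e, map_smul, θ.coeff_smul, Pi.smul_apply, smul_eq_mul, mul_comm]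
  have hreg : ∀ z, u ∈ regAt 0 z := by
    intro z
    set y := chart ϖ (toVertex ϖ i) (z.change (red k h)).pt with hy
    set s := L.frame y with hs
    have h1 : θ.coeff s ∈ regAt n (z.change (red k h)) :=
      (LineBundle.ComponentIso.isRegularOnComponentAt_iff θ).1
        ((LineBundle.isRegular_iff (L.isOpen_base y)).1 (LineBundle.isRegular_frame y) _ _
          (L.mem_base y))
    have h2 : θ.coeff (L.ρ (stabHom ϖ i (h, m)) s) ∈ regAt n z := by
      refine (LineBundle.ComponentIso.isRegularOnComponentAt_iff θ).1 ?_
      refine (LineBundle.isRegular_iff (isOpen_preimage_smul _ (L.isOpen_base y))).1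
        (L.ρ_isRegular (stabHom ϖ i (h, m)) _ _ (L.isOpen_base y)
          (LineBundle.isRegular_frame y)) _ z ?_
      rw [Set.mem_preimage, inv_smul_chart_toVertex]
      exact L.mem_base y
    have h0 : θ.coeff s (z.change (red k h)) ≠ 0 := by
      intro h0
      have e : s y = 0 := θ.eq_zero_of_coeff_eq_zero h0
      have := (L.exists_unique_coeff y y (L.mem_base y) 0).unique (y₁ := 0) (y₂ := 1)
        (by simp) (by rw [one_smul]; exact e.symm)
      exact zero_ne_one this
    have h3 := comp_change_mem_regAt (red k h) h1
    have h4 := mul_mem_regAt h2 (inv_mem_regAt h3 h0)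
    rw [add_neg_cancel] at h4
    refine (regAt_congr ?_).1 h4
    filter_upwards [eventually_ne_zero h3 h0] with z' hz'
    rw [hu, mul_inv_cancel_right₀ hz']
  obtain ⟨P, hP, hPu⟩ := exists_sym_of_forall_regAt hreg
  obtain ⟨c, rfl⟩ := exists_eq_C (isHomogeneous_of_mem_sym (a := 0) hP)
  exact ⟨c, fun s z => by rw [hu, hPu, eval_C]⟩

/-- The constants of `exists_coeff_ρ_eq` form a character. -/
lemma exists_character [IsAlgClosed k] (θ : L.ComponentIso (toVertex ϖ i) n) :
    ∃ χ : MaxCompactMod K →* k, ∀ x s z,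
      θ.coeff (L.ρ (stabHom ϖ i x) s) z = χ x * θ.coeff s (z.change (red k x.1)) := by
  choose c hc using exists_coeff_ρ_eq θ
  refine ⟨⟨⟨c, ?_⟩, ?_⟩, hc⟩
  · obtain ⟨s, hs⟩ := θ.exists_coeff_eq nodeCoord 1
    have := hc 1 s nodeCoord
    rw [map_one, map_one, Prod.fst_one, map_one, Coord.change_one, hs, mul_one,
      Module.End.one_apply, hs] at this
    exact this.symm
  · intro x y
    obtain ⟨s, hs⟩ := θ.exists_coeff_eq (nodeCoord.change (red k (x * y).1)) 1
    have := hc (x * y) s nodeCoord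
    rw [hs, mul_one, map_mul, map_mul, Module.End.mul_apply, hc, hc, ← Coord.change_mul,
      ← map_mul, ← Prod.fst_mul, hs, mul_one] at this
    exact this.symm

/-- On the component of `s₀` only the degree is given. The trivialization there may be rescaled to
agree at the double point with the one on the component of `s₁`. The character by which the
stabilizer of `s₀` acts is then determined on the Iwahori subgroup by comparison at the double
point, hence equals `det ^ r₀`. -/
lemma exists_trivialization [TopologicalSpace K] [IsNonarchimedeanLocalField K] [IsAlgClosed k]
    {κ r : Fin 2 → ℤ} (hr : r 0 = r 1 + κ 1) (hL : L.HasData (r 1) (κ 0) (κ 1)) :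
    Nonempty (L.Trivialization κ r) := by
  obtain ⟨⟨θ₀⟩, hθ⟩ := hL
  rw [← toVertex_zero] at θ₀
  obtain ⟨θ₁, hθ₁⟩ : ∃ θ : L.ComponentIso (toVertex ϖ 1) (κ 1), ∀ (h : GL (Fin 2) 𝒪[K])
      (n : Multiplicative ℤ) (s : ∀ x, L.fiber x) (z : Coord k),
      θ.coeff (L.ρ (stabHom ϖ 1 (h, n)) s) z =
        ((GeneralLinearGroup.det (red k h) ^ r 1 : kˣ) : k) *
          θ.coeff s (z.change (red k h)) := by
    rw [toVertex_one]; exact hθ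
  have hnode : chart ϖ (toVertex ϖ 0) (nodeCoord (k := k)).pt =
      chart ϖ (toVertex ϖ 1) nodeCoord.pt := by
    have := chart_node (ϖ := ϖ) (k := k) 1
    rwa [one_mul, ← toVertex_zero, ← toVertex_one ϖ] at this
  have hval : ∀ {x y : HBar ϖ k} (s s' : ∀ x, L.fiber x), x = y → (s x = s' x ↔ s y = s' y) := by
    rintro x _ s s' rfl; rfl
  obtain ⟨t, ht⟩ := θ₁.exists_coeff_eq nodeCoord 1
  -- The factor between the two trivializations at the double point.
  set a := θ₀.coeff t nodeCoord with ha
  have hscale : ∀ s, θ₀.coeff s nodeCoord = a * θ₁.coeff s nodeCoord := by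
    intro s
    have e : s (chart ϖ (toVertex ϖ 0) nodeCoord.pt) =
        (θ₁.coeff s nodeCoord • t) (chart ϖ (toVertex ϖ 0) nodeCoord.pt) := by
      refine (hval _ _ hnode).2 (θ₁.eq_of_coeff_eq ?_)
      rw [θ₁.coeff_smul, Pi.smul_apply, ht, smul_eq_mul, mul_one]
    rw [θ₀.coeff_congr e, θ₀.coeff_smul, Pi.smul_apply, smul_eq_mul, mul_comm]
  have ha0 : a ≠ 0 := by
    obtain ⟨s, hs⟩ := θ₀.exists_coeff_eq nodeCoord 1
    intro h0
    rw [hscale, h0, zero_mul] at hs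
    exact zero_ne_one hs
  obtain ⟨χ, hχ⟩ := exists_character θ₀
  have hχdet : ∀ x, χ x = ((GeneralLinearGroup.det (red k x.1) ^ r 0 : kˣ) : k) := by
    refine eq_det_zpow χ (m' := r 1 - κ 0) fun β n => ?_
    obtain ⟨β', -, hβ', h00, h11⟩ := exists_iwahori_conj ϖ β
    obtain ⟨s, hs⟩ := θ₀.exists_coeff_eq nodeCoord 1
    have hs1 : a * θ₁.coeff s nodeCoord = 1 := by rw [← hscale, hs]
    have e1 := hχ (β.1, n) s nodeCoord
    have e2 := hscale (L.ρ (stabHom ϖ 0 (β.1, n)) s)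
    rw [hβ', hθ₁] at e2
    rw [hβ', e2] at e1
    rw [θ₀.coeff_mem_homFun s nodeCoord _ _ (change_iwahori β),
      θ₁.coeff_mem_homFun s nodeCoord _ _ (change_iwahori β'), hs, h11] at e1
    have hdet : redHom k (β.1.1 0 0) * redHom k (β.1.1 1 1) = (red k β'.1).1.det := by
      rw [Matrix.det_fin_two, red_apply, red_apply, red_apply, red_apply, redHom_iwahori, h00, h11]
      ring
    have hne : redHom k (β.1.1 0 0) * redHom k (β.1.1 1 1) ≠ 0 := by
      rw [hdet]; exact (red k β'.1).det.ne_zero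
    have hne0 := left_ne_zero_of_mul hne
    have hne1 := right_ne_zero_of_mul hne
    rw [Units.val_zpow_eq_zpow_val, GeneralLinearGroup.val_det_apply, ← hdet, mul_zpow] at e1
    rw [hr, zpow_add₀ hne0, zpow_sub₀ hne1, ← mul_div_assoc, eq_div_iff (zpow_ne_zero _ hne1)]
    linear_combination -e1 + redHom k (β.1.1 0 0) ^ r 1 * redHom k (β.1.1 1 1) ^ r 1 *
      redHom k (β.1.1 0 0) ^ κ 1 * hs1
  let θ : ∀ i, L.ComponentIso (toVertex ϖ i) (κ i) := Fin.cons θ₀ (Fin.cons θ₁ finZeroElim)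
  let b : Fin 2 → k := ![a⁻¹, 1]
  have hb : ∀ i, b i ≠ 0 := by
    intro i
    fin_cases i
    · exact inv_ne_zero ha0
    · exact one_ne_zero
  refine ⟨{
    res i :=
      { toFun s := b i • (θ i).coeff s
        map_add' s s' := by rw [(θ i).coeff_add, smul_add]
        map_smul' c s := by rw [(θ i).coeff_smul, smul_comm, RingHom.id_apply] }
    res_mem i s := (homFun k _).smul_mem _ ((θ i).coeff_mem_homFun s)
    res_eq_iff i s s' z := ?_
    exists_res_eq i z c := ?_
    isRegular_iff i s z := ?_
    res_stab i h n s z := ?_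
    res_node s := ?_ }⟩
  · simp only [LinearMap.coe_mk, AddHom.coe_mk, Pi.smul_apply, smul_eq_mul,
      mul_right_inj' (hb i)]
    exact ⟨(θ i).eq_of_coeff_eq, (θ i).coeff_congr⟩
  · obtain ⟨s, hs⟩ := (θ i).exists_coeff_eq z ((b i)⁻¹ * c)
    refine ⟨s, ?_⟩
    simp only [LinearMap.coe_mk, AddHom.coe_mk, Pi.smul_apply, smul_eq_mul, hs]
    exact mul_inv_cancel_left₀ (hb i) c
  · rw [LineBundle.ComponentIso.isRegularOnComponentAt_iff (θ i)]
    exact (Submodule.smul_mem_iff _ (hb i)).symm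
  · simp only [LinearMap.coe_mk, AddHom.coe_mk, Pi.smul_apply, smul_eq_mul]
    rw [mul_left_comm]
    congr 1
    fin_cases i
    · exact (hχ (h, n) s z).trans (by rw [hχdet]; rfl)
    · exact hθ₁ h n s z
  · change a⁻¹ * θ₀.coeff s nodeCoord = 1 * θ₁.coeff s nodeCoord
    rw [hscale, inv_mul_cancel_left₀ ha0, one_mul]

namespace Trivialization

variable {κ r : Fin 2 → ℤ}

/-- The two actions of `diag(1, u)` on the fibre at the double point coincide. -/
lemma weight (T : L.Trivialization κ r) [TopologicalSpace K] [IsNonarchimedeanLocalField K]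
    (u : 𝒪[K]ˣ) : redHom k (u : 𝒪[K]) ^ (r 0 + κ 0) = redHom k (u : 𝒪[K]) ^ r 1 := by
  let β : iwahori K := ⟨GeneralLinearGroup.mk'' !![1, 0; 0, (u : 𝒪[K])]
    (by simp [Matrix.det_fin_two_of]), show (0 : 𝒪[K]) ∈ 𝓂[K] from zero_mem _⟩
  obtain ⟨β', -, hβ', h00, h11⟩ := exists_iwahori_conj ϖ β
  have hβ00 : β.1.1 0 0 = 1 := rfl
  have hβ11 : β.1.1 1 1 = u := rfl
  have hβ10 : β.1.1 1 0 = 0 := rfl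
  obtain ⟨s, hs⟩ := T.exists_res_eq 0 nodeCoord 1
  have hs1 : T.res 1 s nodeCoord = 1 := by rw [← T.res_node, hs]
  have e := T.res_node (L.ρ (stabHom ϖ 0 (β.1, 1)) s)
  have hd : (red k β.1).1.det = redHom k (u : 𝒪[K]) := by
    rw [Matrix.det_fin_two, red_apply, red_apply, red_apply, red_apply, hβ00, hβ11, hβ10]
    simp
  have hd' : (red k β'.1).1.det = redHom k (u : 𝒪[K]) := by
    rw [Matrix.det_fin_two, red_apply, red_apply, red_apply, red_apply, redHom_iwahori, h00, h11,
      hβ00, hβ11]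
    simp
  have hu : redHom k (u : 𝒪[K]) ≠ 0 := by rw [← hd]; exact (red k β.1).det.ne_zero
  rw [T.res_stab, hβ', T.res_stab, T.res_mem 0 s nodeCoord _ _ (change_iwahori β),
    T.res_mem 1 s nodeCoord _ _ (change_iwahori β'), hs, hs1, h11, hβ00, hβ11,
    Units.val_zpow_eq_zpow_val, Units.val_zpow_eq_zpow_val, GeneralLinearGroup.val_det_apply,
    GeneralLinearGroup.val_det_apply, hd, hd'] at e
  rw [zpow_add₀ hu]
  simpa using e

end Trivialization

end EquivariantLineBundle

end Trivializations


/-! ### Sections as equivariant families of homogeneous functions -/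

section TwistedAction

open MvPolynomial Filter Topology
open Matrix (GeneralLinearGroup)

variable {K : Type*} [Field K] [ValuativeRel K] {k : Type*} [Field k] [Algebra 𝓀[K] k]

/-- The action of `G°ϖ^ℤ` on functions of the homogeneous coordinates that corresponds to
`det^r ⊗ 𝒪(n)`. -/
noncomputable def twistAct (r : ℤ) (x : MaxCompactMod K) (F : Coord k → k) : Coord k → k := fun z =>
  ((GeneralLinearGroup.det (red k x.1) ^ r : kˣ) : k) * F (z.change (red k x.1))

variable {r n : ℤ} {x : MaxCompactMod K} {F : Coord k → k}

lemma twistAct_mul (x y : MaxCompactMod K) (F : Coord k → k) :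
    twistAct r (x * y) F = twistAct r x (twistAct r y F) := by
  funext z
  simp only [twistAct, Prod.fst_mul, map_mul, mul_zpow, Units.val_mul, Coord.change_mul, mul_assoc]

lemma twistAct_add (F F' : Coord k → k) :
    twistAct r x (F + F') = twistAct r x F + twistAct r x F' := by
  funext z
  simp [twistAct, mul_add]

lemma twistAct_sub (F F' : Coord k → k) :
    twistAct r x (F - F') = twistAct r x F - twistAct r x F' := by
  funext z
  simp [twistAct, mul_sub]

lemma twistAct_mem_homFun (hF : F ∈ homFun k n) : twistAct r x F ∈ homFun k n :=
  (homFun k n).smul_mem _ (comp_change_mem_homFun _ hF)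

lemma twistAct_mem_regAt_iff {z : Coord k} :
    twistAct r x F ∈ regAt n z ↔ F ∈ regAt n (z.change (red k x.1)) :=
  ((regAt n z).smul_mem_iff (x := fun z => F (z.change (red k x.1)))
    (Units.ne_zero (GeneralLinearGroup.det (red k x.1) ^ r))).trans (comp_change_mem_regAt_iff _)

end TwistedAction

namespace EquivariantLineBundle.Trivialization

open MvPolynomial Filter Topology
open Matrix (GeneralLinearGroup)

universe v

variable {K : Type*} [Field K] [ValuativeRel K] {ϖ : Uniformizer K}
variable {k : Type*} [Field k] [Algebra 𝓀[K] k]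
variable {L : EquivariantLineBundle.{v} ϖ k} {κ r : Fin 2 → ℤ}
variable (T : L.Trivialization κ r)

lemma res_stabHom (i : Fin 2) (x : MaxCompactMod K) (s : ∀ x, L.fiber x) :
    T.res i (L.ρ (stabHom ϖ i x) s) = twistAct (r i) x (T.res i s) :=
  funext fun z => T.res_stab i x.1 x.2 s z

lemma res_stabHom_mul (i : Fin 2) (x : MaxCompactMod K) (γ : evenGroup ϖ) (s : ∀ x, L.fiber x) :
    T.res i (L.ρ (stabHom ϖ i x * γ) s) = twistAct (r i) x (T.res i (L.ρ γ s)) := by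
  rw [map_mul, Module.End.mul_apply, T.res_stabHom]

lemma res_ρ_eq_iff (i : Fin 2) (γ : evenGroup ϖ) (s s' : ∀ x, L.fiber x) (z : Coord k) :
    T.res i (L.ρ γ⁻¹ s) z = T.res i (L.ρ γ⁻¹ s') z ↔
      s (chart ϖ (γ * toVertex ϖ i) z.pt) = s' (chart ϖ (γ * toVertex ϖ i) z.pt) := by
  rw [T.res_eq_iff]
  constructor
  · intro h
    have := ρ_congr (L := L) (γ := γ) (x := chart ϖ (γ * toVertex ϖ i) z.pt)
      (s := L.ρ γ⁻¹ s) (s' := L.ρ γ⁻¹ s') (by rwa [inv_smul_chart])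
    rwa [Representation.self_inv_apply, Representation.self_inv_apply] at this
  · intro h
    refine ρ_congr ?_
    rwa [Subgroup.coe_inv, inv_inv, smul_chart]

lemma exists_chart_eq [TopologicalSpace K] [IsNonarchimedeanLocalField K] (x : HBar ϖ k) :
    ∃ (γ : evenGroup ϖ) (i : Fin 2) (z : Coord k), chart ϖ (γ * toVertex ϖ i) z.pt = x := by
  obtain ⟨g, z, rfl⟩ := exists_chart x
  obtain ⟨γ, i, rfl⟩ := exists_eq_mul_toVertex ϖ g
  exact ⟨γ, i, z, rfl⟩

variable [TopologicalSpace K] [IsNonarchimedeanLocalField K]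

/-- A section of `L` amounts to a pair of equivariant families of homogeneous functions that agree
at the node. -/
lemma exists_section {F : Fin 2 → evenGroup ϖ → Coord k → k} (hF : ∀ i γ, F i γ ∈ homFun k (κ i))
    (hstab : ∀ i x γ, F i (stabHom ϖ i x * γ) = twistAct (r i) x (F i γ))
    (hnode : ∀ γ, F 0 γ nodeCoord = F 1 γ nodeCoord) :
    ∃ s, ∀ i γ, T.res i (L.ρ γ s) = F i γ := by
  -- At a given point, the section is determined by any one of the components containing it; the
  -- hypotheses say that the choice does not matter.
  have hx : ∀ x : HBar ϖ k, ∃ s : ∀ x, L.fiber x, ∀ (γ : evenGroup ϖ) (i : Fin 2) (z : Coord k),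
      chart ϖ (γ * toVertex ϖ i) z.pt = x → T.res i (L.ρ γ⁻¹ s) z = F i γ⁻¹ z := by
    intro x
    obtain ⟨γ, i, z, rfl⟩ := exists_chart_eq x
    obtain ⟨t, ht⟩ := T.exists_res_eq i z (F i γ⁻¹ z)
    refine ⟨L.ρ γ t, fun γ' i' z' h => ?_⟩
    refine (iff_of_chart_mul_toVertex_eq
      (Q := fun γ' i' z' => T.res i' (L.ρ γ'⁻¹ (L.ρ γ t)) z' = F i' γ'⁻¹ z')
      ?_ ?_ ?_ h).2 ?_
    · intro γ i z z' e h
      obtain ⟨c, hc⟩ := Coord.pt_eq_iff.1 e.symm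
      rw [T.res_mem _ _ _ _ _ hc, hF _ _ _ _ _ hc, h]
    · intro γ' i' h n z'
      rw [mul_inv_rev, ← map_inv, T.res_stabHom_mul, hstab, twistAct, twistAct,
        mul_right_inj' (Units.ne_zero _), Prod.fst_inv, map_inv (red k), Coord.change_change_inv]
    · intro γ'
      rw [T.res_node, hnode]
    · rwa [Representation.inv_self_apply]
  choose s hs using hx
  refine ⟨fun x => s x x, fun i γ => funext fun z => ?_⟩
  rw [← inv_inv γ, ← hs _ γ⁻¹ i z rfl, T.res_ρ_eq_iff]

lemma ext {s s' : ∀ x, L.fiber x} (h : ∀ i γ, T.res i (L.ρ γ s) = T.res i (L.ρ γ s')) :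
    s = s' := by
  funext x
  obtain ⟨γ, i, z, rfl⟩ := exists_chart_eq x
  rw [← T.res_ρ_eq_iff, h]

lemma isRegularAt_iff {s : ∀ x, L.fiber x} {x : HBar ϖ k} : L.IsRegularAt s x ↔
    ∀ (γ : evenGroup ϖ) (i : Fin 2) (z : Coord k), chart ϖ (γ * toVertex ϖ i) z.pt = x →
      T.res i (L.ρ γ⁻¹ s) ∈ regAt (κ i) z := by
  rw [LineBundle.isRegularAt_iff]
  simp only [← T.isRegular_iff, ← isRegularOnComponentAt_ρ_iff]
  constructor
  · exact fun h γ i z e => h _ z e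
  · intro h g z e
    obtain ⟨γ, i, rfl⟩ := exists_eq_mul_toVertex ϖ g
    exact h γ i z e

lemma mem_H0_iff {s : ∀ x, L.fiber x} : s ∈ L.H0 ↔
    ∀ γ i z, T.res i (L.ρ γ s) ∈ regAt (κ i) z := by
  rw [LineBundle.mem_H0_iff]
  constructor
  · intro h γ i z
    rw [← T.isRegular_iff, ← inv_inv γ, ← isRegularOnComponentAt_ρ_iff]
    exact h _ z
  · intro h g z
    obtain ⟨γ, i, rfl⟩ := exists_eq_mul_toVertex ϖ g
    rw [isRegularOnComponentAt_ρ_iff, T.isRegular_iff]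
    exact h _ i z

end EquivariantLineBundle.Trivialization


/-! ### Intertwining maps given by relations -/

section Relations

variable {k G V W : Type*} [Field k] [Group G] [AddCommMonoid V] [Module k V]
  [AddCommMonoid W] [Module k W] {ρ : Representation k G V} {σ : Representation k G W}

lemma add_neg_one_smul (v : V) : v + (-1 : k) • v = 0 := by
  rw [← one_smul k v, smul_smul, mul_one, ← add_smul, add_neg_cancel, zero_smul]

lemma eq_of_add_neg_one_smul {v v' : V} (h : v + (-1 : k) • v' = 0) : v = v' := by
  rw [← add_zero v, ← add_neg_one_smul (k := k) v', add_comm v', ← add_assoc, h, zero_add]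

/-- A functional, linear and equivariant relation is the graph of an intertwining map. -/
lemma exists_intertwiningMap {R : V → W → Prop}
    (hadd : ∀ v v' w w', R v w → R v' w' → R (v + v') (w + w'))
    (hsmul : ∀ (c : k) v w, R v w → R (c • v) (c • w))
    (hG : ∀ g v w, R v w → R (ρ g v) (σ g w))
    (hex : ∀ v, ∃ w, R v w) (h0 : ∀ w, R 0 w → w = 0) :
    ∃ f : ρ.IntertwiningMap σ, ∀ v w, R v w ↔ f v = w := by
  have huniq : ∀ v w w', R v w → R v w' → w = w' := by
    intro v w w' h h'
    have := hadd _ _ _ _ h (hsmul (-1) _ _ h')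
    rw [add_neg_one_smul] at this
    exact eq_of_add_neg_one_smul (h0 _ this)
  choose f hf using hex
  refine ⟨⟨⟨⟨f, fun v v' => ?_⟩, fun c v => ?_⟩, fun g => LinearMap.ext fun v => ?_⟩,
    fun v w => ⟨fun h => huniq _ _ _ (hf v) h, fun h => h ▸ hf v⟩⟩
  · exact huniq _ _ _ (hf _) (hadd _ _ _ _ (hf v) (hf v'))
  · exact huniq _ _ _ (hf _) (hsmul _ _ _ (hf v))
  · exact huniq _ _ _ (hf _) (hG g _ _ (hf v))

lemma injective_of_forall_eq_zero (f : ρ.IntertwiningMap σ) (h : ∀ v, f v = 0 → v = 0) :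
    Function.Injective f := fun v v' e => by
  refine eq_of_add_neg_one_smul (k := k) (h _ ?_)
  rw [map_add, map_smul, e, add_neg_one_smul]

end Relations

/-! ### Sections over a component: the representations `σ` -/

section Sigma

open MvPolynomial Filter Topology
open Matrix (GeneralLinearGroup)

variable {K : Type*} [Field K] [ValuativeRel K] {ϖ : Uniformizer K}
variable {k : Type*} [Field k] [Algebra 𝓀[K] k] {i : Fin 2} {n r : ℤ}

/-- The underlying space of the representation `σ^{(i)}_{n,r}`. -/
noncomputable abbrev SigmaSpace (ϖ : Uniformizer K) (k : Type*) [Field k] [Algebra 𝓀[K] k]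
    (i : Fin 2) (n r : ℤ) : Submodule k (evenGroup ϖ → sym k n) :=
  Representation.coindV (stabHom ϖ i) (inflate (K := K) (detTwist r (symRep k n)))

/-- The underlying space of the representation `τ^{(i)}_{n,r}`. -/
noncomputable abbrev TauSpace (ϖ : Uniformizer K) (k : Type*) [Field k] [Algebra 𝓀[K] k] (i : Fin 2)
    (n r : ℤ) : Submodule k (evenGroup ϖ → Module.Dual k (sym k n)) :=
  Representation.coindV (stabHom ϖ i) (inflate (K := K) (detTwist r (symRep k n).dual))

/-- The underlying space of the representation `I(m, m')`. -/
noncomputable abbrev IwahoriSpace (ϖ : Uniformizer K) (k : Type*) [Field k] [Algebra 𝓀[K] k]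
    (m m' : ℤ) : Submodule k (evenGroup ϖ → k) :=
  Representation.coindV (iwahoriHom ϖ) (iwahoriCharRep K k m m')

/-- The homogeneous function attached to a homogeneous polynomial. -/
noncomputable def symFun (P : sym k n) : Coord k → k := fun z => eval z.1 P.1

lemma symFun_add (P P' : sym k n) : symFun (P + P') = symFun P + symFun P' := by
  funext z; simp [symFun]

lemma symFun_smul (c : k) (P : sym k n) : symFun (c • P) = c • symFun P := by
  funext z; simp [symFun]

lemma symFun_injective [Infinite k] : Function.Injective (symFun (k := k) (n := n)) :=
  fun _ _ h => Subtype.ext (eq_of_eval_coord (congrFun h))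

lemma symFun_inflate (x : MaxCompactMod K) (P : sym k n) :
    symFun (inflate (detTwist r (symRep k n)) x P) = twistAct r x (symFun P) := by
  funext z
  change eval z.1 (((GeneralLinearGroup.det (red k x.1) ^ r : kˣ) : k) •
    (symRep k n (red k x.1) P).1) = _
  rw [smul_eval, eval_symRep]
  rfl

lemma symFun_stabHom_mul (φ : SigmaSpace ϖ k i n r) (x : MaxCompactMod K) (γ : evenGroup ϖ) :
    symFun (φ.1 (stabHom ϖ i x * γ)) = twistAct r x (symFun (φ.1 γ)) := by
  rw [φ.2, symFun_inflate]

lemma sigma_apply (g : evenGroup ϖ) (φ : SigmaSpace ϖ k i n r) (γ : evenGroup ϖ) :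
    (sigma ϖ k i n r g φ).1 γ = φ.1 (γ * g) := rfl

lemma exists_symFun_eq [IsAlgClosed k] {F : Coord k → k} (hF : ∀ z, F ∈ regAt n z) :
    ∃ P : sym k n, symFun P = F := by
  obtain ⟨P, hP, h⟩ := exists_sym_of_forall_regAt hF
  refine ⟨⟨P, hP⟩, funext fun z => ?_⟩
  rw [h z]
  rfl

lemma exists_sigma [IsAlgClosed k] {F : evenGroup ϖ → Coord k → k}
    (hF : ∀ γ z, F γ ∈ regAt n z)
    (hstab : ∀ x γ, F (stabHom ϖ i x * γ) = twistAct r x (F γ)) :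
    ∃ φ : SigmaSpace ϖ k i n r, ∀ γ, symFun (φ.1 γ) = F γ := by
  have : Infinite k := IsAlgClosed.instInfinite
  choose P hP using fun γ => exists_symFun_eq (hF γ)
  refine ⟨⟨P, (Representation.mem_coindV _ _ _).2 fun x γ => symFun_injective ?_⟩, hP⟩
  rw [symFun_inflate, hP, hP, hstab]

lemma symFun_mem_regAt (P : sym k n) (z : Coord k) : symFun P ∈ regAt n z := sym_mem_regAt P.2 z

lemma symFun_mem_homFun (P : sym k n) : symFun P ∈ homFun k n := sym_mem_homFun P.2

end Sigma

/-! ### Values at the double points: the representation `I` -/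

section Nodes

open MvPolynomial Filter Topology
open Matrix (GeneralLinearGroup)

variable {K : Type*} [Field K] [ValuativeRel K] {ϖ : Uniformizer K}
variable {k : Type*} [Field k] [Algebra 𝓀[K] k]

lemma det_red_iwahori (β : iwahori K) : ((GeneralLinearGroup.det (red k β.1) : kˣ) : k) =
    redHom k (β.1.1 0 0) * redHom k (β.1.1 1 1) := by
  rw [GeneralLinearGroup.val_det_apply, Matrix.det_fin_two, red_apply, red_apply, red_apply,
    red_apply, redHom_iwahori]
  ring

lemma redHom_diag_ne_zero (β : iwahori K) :
    redHom k (β.1.1 0 0) ≠ 0 ∧ redHom k (β.1.1 1 1) ≠ 0 := by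
  rw [← mul_ne_zero_iff, ← det_red_iwahori]
  exact Units.ne_zero _

lemma isUnit_of_redHom_ne_zero {a : 𝒪[K]} (h : redHom k a ≠ 0) : IsUnit a := by
  by_contra hu
  exact h (redHom_eq_zero_iff.2 ((IsLocalRing.mem_maximalIdeal _).2 hu))

variable (K k) in
/-- The relations between the degrees and the characters of `I` that hold for the restrictions of
an equivariant line bundle to the components of `s₀` and `s₁`. -/
structure IsCompatible (κ r : Fin 2 → ℤ) : Prop where
  r_eq : r 0 = r 1 + κ 1
  weight (u : 𝒪[K]ˣ) : redHom k (u : 𝒪[K]) ^ (r 0 + κ 0) = redHom k (u : 𝒪[K]) ^ r 1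

lemma nodeCoord_pt_mem : (nodeCoord (k := k)).pt ∈ nodeSet K k := ⟨none, rfl⟩

lemma exists_homFun_supported (n : ℤ) (b : Coord k) (c : k) : ∃ E ∈ homFun k n, E b = c ∧
    ∀ z : Coord k, z.pt ≠ b.pt → E z = 0 := by
  classical
  obtain ⟨j, hj⟩ := exists_coord_ne_zero b
  have hX := zpow_mem_homFun (form_mem_homFun (isHomogeneous_X k j)) n
  have hE : (fun y : Coord k => c * (b.1 j ^ n)⁻¹ * y.1 j ^ n) ∈ homFun k n := by
    have := (homFun k n).smul_mem (c * (b.1 j ^ n)⁻¹) (by simpa using hX)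
    simpa [Pi.smul_def, mul_assoc] using this
  refine ⟨_, indicator_mem_homFun hE (fun p => p = b.pt), ?_, fun z hz => if_neg hz⟩
  rw [if_pos rfl]
  exact inv_mul_cancel_right₀ (zpow_ne_zero n hj) c

variable [TopologicalSpace K] [IsNonarchimedeanLocalField K]
variable {κ r : Fin 2 → ℤ}

/-- The action of `I` on the fibres of the twisted line bundles at the node is given by the
character `μ_{r₁, r₀}`. -/
lemma apply_stabHom_iwahori (hc : IsCompatible K k κ r)
    (ψ : IwahoriSpace ϖ k (r 1) (r 0)) (i : Fin 2) (β : iwahori K)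
    (n : Multiplicative ℤ) (γ : evenGroup ϖ) : ψ.1 (stabHom ϖ i (β.1, n) * γ) =
      ((GeneralLinearGroup.det (red k β.1) ^ r i : kˣ) : k) * redHom k (β.1.1 1 1) ^ κ i *
        ψ.1 γ := by
  obtain ⟨ha, hd⟩ := redHom_diag_ne_zero (k := k) β
  obtain ⟨d, hd'⟩ := isUnit_of_redHom_ne_zero hd
  have h1 : ∀ (β : iwahori K) n, ψ.1 (stabHom ϖ 1 (β.1, n) * γ) =
      redHom k (β.1.1 0 0) ^ r 1 * redHom k (β.1.1 1 1) ^ r 0 * ψ.1 γ :=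
    fun β n => ψ.2 (β, n) γ
  rw [Units.val_zpow_eq_zpow_val, det_red_iwahori, mul_zpow]
  fin_cases i
  · obtain ⟨β', -, hβ', h00, h11⟩ := exists_iwahori_conj ϖ β
    have hw := hc.weight d
    rw [hd', zpow_add₀ hd] at hw
    change ψ.1 (stabHom ϖ 0 (β.1, n) * γ) = _ ^ r 0 * _ ^ r 0 * _ ^ κ 0 * _
    rw [hβ', h1, h00, h11, ← hw]
    ring
  · change ψ.1 (stabHom ϖ 1 (β.1, n) * γ) = _ ^ r 1 * _ ^ r 1 * _ ^ κ 1 * _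
    have e : redHom k (β.1.1 1 1) ^ r 0 =
        redHom k (β.1.1 1 1) ^ r 1 * redHom k (β.1.1 1 1) ^ κ 1 := by
      rw [hc.r_eq, zpow_add₀ hd]
    rw [h1, e]
    ring

/-- The values at the node of an equivariant family of homogeneous functions form an element of
`I(r₁, r₀)`. -/
lemma exists_node_values (hc : IsCompatible K k κ r) (i : Fin 2)
    {F : evenGroup ϖ → Coord k → k}
    (hF : ∀ γ, F γ ∈ homFun k (κ i))
    (hstab : ∀ x γ, F (stabHom ϖ i x * γ) = twistAct (r i) x (F γ)) :
    ∃ ψ : IwahoriSpace ϖ k (r 1) (r 0), ∀ γ, ψ.1 γ = F γ nodeCoord := by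
  refine ⟨⟨fun γ => F γ nodeCoord, ?_⟩, fun _ => rfl⟩
  rintro ⟨β, n⟩ γ
  change F (stabHom ϖ 1 (β.1, n) * γ) nodeCoord =
    redHom k (β.1.1 0 0) ^ r 1 * redHom k (β.1.1 1 1) ^ r 0 * F γ nodeCoord
  obtain ⟨ha, hd⟩ := redHom_diag_ne_zero (k := k) β
  obtain ⟨a, ha'⟩ := isUnit_of_redHom_ne_zero ha
  fin_cases i
  · obtain ⟨β', hβ', -, h00, h11⟩ := exists_iwahori_conj ϖ β
    have hw := hc.weight a
    rw [ha', zpow_add₀ ha] at hw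
    change ∀ x γ, F (stabHom ϖ 0 x * γ) = twistAct (r 0) x (F γ) at hstab
    rw [hβ', hstab, twistAct, hF γ nodeCoord _ _ (change_iwahori β'), Units.val_zpow_eq_zpow_val,
      det_red_iwahori, mul_zpow, h00, h11, ← hw]
    change _ * (_ ^ κ 0 * _) = _
    ring
  · change ∀ x γ, F (stabHom ϖ 1 x * γ) = twistAct (r 1) x (F γ) at hstab
    rw [hstab, twistAct, hF γ nodeCoord _ _ (change_iwahori β), Units.val_zpow_eq_zpow_val,
      det_red_iwahori, mul_zpow, hc.r_eq, zpow_add₀ hd]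
    change _ * (_ ^ κ 1 * _) = _
    ring

/-- An element of `I` gives a family of homogeneous functions on the component of `s_i`, supported
on the double points. -/
lemma exists_nodeFamily (hc : IsCompatible K k κ r) (i : Fin 2)
    (ψ : IwahoriSpace ϖ k (r 1) (r 0)) :
    ∃ F : evenGroup ϖ → Coord k → k, (∀ γ, F γ ∈ homFun k (κ i)) ∧
      (∀ x γ, F (stabHom ϖ i x * γ) = twistAct (r i) x (F γ)) ∧
      (∀ γ, F γ nodeCoord = ψ.1 γ) ∧ ∀ γ z, z.pt ∉ nodeSet K k → F γ z = 0 := by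
  classical
  have := Fintype.ofFinite 𝓀[K]
  -- The values of `F γ` at the rational points are prescribed by those of `ψ`. This determines `F
  -- γ`, and the equivariance follows from uniqueness.
  let p : evenGroup ϖ → (Coord k → k) → Prop := fun γ E => E ∈ homFun k (κ i) ∧
    (∀ h : GL (Fin 2) 𝒪[K], ((GeneralLinearGroup.det (red k h) ^ r i : kˣ) : k) *
      E (nodeCoord.change (red k h)) = ψ.1 (stabHom ϖ i (h, 1) * γ)) ∧
    ∀ z, z.pt ∉ nodeSet K k → E z = 0
  have huniq : ∀ γ E E', p γ E → p γ E' → E = E' := by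
    rintro γ E E' ⟨h1, h2, h3⟩ ⟨h1', h2', h3'⟩
    funext z
    by_cases hz : z.pt ∈ nodeSet K k
    · obtain ⟨h, hh⟩ := mem_nodeSet_iff.1 hz
      obtain ⟨c, e⟩ := Coord.pt_eq_iff.1 hh.symm
      rw [h1 _ _ _ e, h1' _ _ _ e]
      congr 1
      refine mul_left_cancel₀ (Units.ne_zero (GeneralLinearGroup.det (red k h) ^ r i)) ?_
      rw [h2, h2']
    · rw [h3 z hz, h3' z hz]
  have hex : ∀ γ, ∃ E, p γ E := by
    intro γ
    choose e he he1 he0 using fun j : Option 𝓀[K] => exists_homFun_supported (κ i) (nodeVec k j)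
      (((GeneralLinearGroup.det (red k (nodeRep j)) ^ r i : kˣ) : k)⁻¹ *
        ψ.1 (stabHom ϖ i (nodeRep j, 1) * γ))
    have hsum : ∀ z : Coord k, (∑ j, e j) z = ∑ j, e j z := fun z => by simp
    have hval : ∀ j, (∑ j, e j) (nodeVec k j) =
        ((GeneralLinearGroup.det (red k (nodeRep j)) ^ r i : kˣ) : k)⁻¹ *
          ψ.1 (stabHom ϖ i (nodeRep j, 1) * γ) := by
      intro j
      rw [hsum, Finset.sum_eq_single_of_mem j (Finset.mem_univ j) fun j' _ hj' => he0 j' _ fun h =>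
        hj' (nodeVec_injective h).symm, he1]
    have hmem : (∑ j, e j) ∈ homFun k (κ i) := Submodule.sum_mem _ fun j _ => he j
    refine ⟨∑ j, e j, hmem, fun h => ?_, fun z hz => ?_⟩
    · obtain ⟨β, j, rfl⟩ := exists_iwahori_mul_nodeRep h
      have e1 : ((β.1 * nodeRep j, 1) : MaxCompactMod K) = (β.1, 1) * (nodeRep j, 1) := by simp
      rw [map_mul, Coord.change_mul, e1, map_mul (stabHom ϖ i), mul_assoc,
        apply_stabHom_iwahori hc, hmem _ _ _ (Coord.change_smul _ (change_iwahori β)),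
        change_nodeRep, hval, map_mul, mul_zpow, Units.val_mul]
      have := Units.ne_zero (GeneralLinearGroup.det (red k (nodeRep j)) ^ r i)
      field_simp
    · rw [hsum]
      exact Finset.sum_eq_zero fun j _ => he0 j z fun h => hz ⟨j, h.symm⟩
  choose F hF using hex
  refine ⟨F, fun γ => (hF γ).1, fun x γ => huniq _ _ _ (hF _) ?_, fun γ => ?_, fun γ => (hF γ).2.2⟩
  · refine ⟨twistAct_mem_homFun (hF γ).1, fun h => ?_, fun z hz => ?_⟩
    · have e1 : ((h, 1) : MaxCompactMod K) * x = ((1 : iwahori K).1, x.2) * (h * x.1, 1) := by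
        ext <;> simp
      rw [← mul_assoc, ← map_mul, e1, map_mul, mul_assoc, apply_stabHom_iwahori hc,
        ← (hF γ).2.1, twistAct, map_mul, map_mul, mul_zpow, Coord.change_mul]
      simp [mul_assoc]
    · rw [twistAct, (hF γ).2.2 _ fun h => hz ((pt_change_mem_nodeSet_iff _).1 h), mul_zero]
  · have := (hF γ).2.1 1
    simpa [Coord.change_one, ← Prod.one_eq_mk] using this

end Nodes


/-! ### The evaluation maps from `σ` to `I` -/

section Evaluation

open MvPolynomial Filter Topology
open Matrix (GeneralLinearGroup)

variable {K : Type*} [Field K] [ValuativeRel K] {ϖ : Uniformizer K}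
variable {k : Type*} [Field k]

/-- The form `z₀^q z₁ - z₀ z₁^q`, whose zeros are the rational points of the projective line. -/
noncomputable def dicksonForm (K : Type*) [Field K] [ValuativeRel K] (k : Type*) [Field k] :
    MvPolynomial (Fin 2) k :=
  X 0 ^ Nat.card 𝓀[K] * X 1 - X 0 * X 1 ^ Nat.card 𝓀[K]

lemma dicksonForm_isHomogeneous : (dicksonForm K k).IsHomogeneous (Nat.card 𝓀[K] + 1) := by
  refine IsHomogeneous.sub ?_ ?_
  · simpa using ((isHomogeneous_X k (0 : Fin 2)).pow (Nat.card 𝓀[K])).mul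
      (isHomogeneous_X k (1 : Fin 2))
  · simpa [add_comm] using (isHomogeneous_X k (0 : Fin 2)).mul
      ((isHomogeneous_X k (1 : Fin 2)).pow (Nat.card 𝓀[K]))

lemma eval_dicksonForm (z : Coord k) : eval z.1 (dicksonForm K k) =
    z.1 0 ^ Nat.card 𝓀[K] * z.1 1 - z.1 0 * z.1 1 ^ Nat.card 𝓀[K] := by
  simp [dicksonForm]

lemma dicksonForm_ne_zero [Finite 𝓀[K]] : dicksonForm K k ≠ 0 := by
  intro h0
  have hq : 1 < Nat.card 𝓀[K] := Finite.one_lt_card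
  have hc := congrArg (coeff (Finsupp.single (0 : Fin 2) (Nat.card 𝓀[K]) + Finsupp.single 1 1)) h0
  have e : ∀ a b : ℕ, (X 0 ^ a * X 1 ^ b : MvPolynomial (Fin 2) k) =
      monomial (Finsupp.single 0 a + Finsupp.single 1 b) 1 := by
    intro a b
    rw [X_pow_eq_monomial, X_pow_eq_monomial, monomial_mul, one_mul]
  have e1 := e (Nat.card 𝓀[K]) 1
  have e2 := e 1 (Nat.card 𝓀[K])
  rw [pow_one] at e1 e2
  rw [dicksonForm, e1, e2, coeff_sub, coeff_monomial, coeff_monomial, if_pos rfl, if_neg] at hc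
  · simp at hc
  · intro h
    have := DFunLike.congr_fun h 0
    simp at this
    omega

lemma mul_mem_sym {a : ℕ} {m : ℤ} {Q P : MvPolynomial (Fin 2) k} (hQ : Q.IsHomogeneous a)
    (hP : P ∈ sym k m) : Q * P ∈ sym k (a + m) := by
  rcases mem_sym_cases hP with ⟨b, rfl, hPb⟩ | ⟨-, rfl⟩
  · exact hQ.mul hPb
  · rw [mul_zero]; exact zero_mem _

variable [Algebra 𝓀[K] k]

lemma isEvaluation_iff {i : Fin 2} {n r m m' : ℤ}
    {f : (sigma ϖ k i n r).IntertwiningMap (iwahoriInd ϖ k m m')} : IsEvaluation f ↔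
      ∀ φ γ, (f φ).1 γ = symFun (φ.1 γ) nodeCoord := Iff.rfl

variable {i : Fin 2} {n r : ℤ} {m m' : ℤ}
  {f : (sigma ϖ k i n r).IntertwiningMap (iwahoriInd ϖ k m m')}

/-- A family of forms in the kernel of the evaluation map vanishes at all the double points. -/
lemma eq_zero_iff_forall_nodeSet (hf : IsEvaluation f) (φ : SigmaSpace ϖ k i n r) :
    f φ = 0 ↔ ∀ γ z, z.pt ∈ nodeSet K k → symFun (φ.1 γ) z = 0 := by
  rw [isEvaluation_iff] at hf
  constructor
  · intro h γ z hz
    obtain ⟨a, ha⟩ := mem_nodeSet_iff.1 hz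
    rw [eq_zero_iff_of_mem_homFun (symFun_mem_homFun _) ha.symm]
    have e := hf φ (stabHom ϖ i (a, 1) * γ)
    rw [h, symFun_stabHom_mul] at e
    exact (mul_eq_zero.1 e.symm).resolve_left (Units.ne_zero _)
  · intro h
    refine Subtype.ext (funext fun γ => ?_)
    rw [hf, h γ _ nodeCoord_pt_mem]
    rfl

variable [TopologicalSpace K] [IsNonarchimedeanLocalField K]

/-- The evaluation maps `f_i : σ^{(i)}_{κ_i, r_i} → I(r₁, r₀)`. -/
lemma exists_isEvaluation {κ r : Fin 2 → ℤ} (hc : IsCompatible K k κ r) (i : Fin 2) :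
    ∃ f : (sigma ϖ k i (κ i) (r i)).IntertwiningMap (iwahoriInd ϖ k (r 1) (r 0)),
      IsEvaluation f := by
  obtain ⟨f, hf⟩ := exists_intertwiningMap (ρ := sigma ϖ k i (κ i) (r i))
    (σ := iwahoriInd ϖ k (r 1) (r 0))
    (R := fun (φ : SigmaSpace ϖ k i (κ i) (r i)) (ψ : IwahoriSpace ϖ k (r 1) (r 0)) =>
      ∀ γ, ψ.1 γ = symFun (φ.1 γ) nodeCoord)
    (fun φ φ' ψ ψ' h h' γ => by
      change ψ.1 γ + ψ'.1 γ = symFun (φ.1 γ + φ'.1 γ) nodeCoord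
      rw [h, h', symFun_add, Pi.add_apply])
    (fun c φ ψ h γ => by
      change c * ψ.1 γ = symFun (c • φ.1 γ) nodeCoord
      rw [h, symFun_smul, Pi.smul_apply, smul_eq_mul])
    (fun g φ ψ h γ => h (γ * g))
    (fun φ => exists_node_values hc i (fun γ => symFun_mem_homFun (φ.1 γ))
      (symFun_stabHom_mul φ))
    (fun ψ h => Subtype.ext (funext fun γ => (h γ).trans (map_zero _)))
  exact ⟨f, fun φ => (hf φ _).2 rfl⟩

/-- The form is semi-invariant under `GL₂(𝔽_q)` because the matrix entries are fixed by the `q`-th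
power map. -/
lemma eval_change_dicksonForm (h : GL (Fin 2) 𝒪[K]) (z : Coord k) :
    eval (z.change (red k h)).1 (dicksonForm K k) =
      (GeneralLinearGroup.det (red k h) : k) * eval z.1 (dicksonForm K k) := by
  have := Fintype.ofFinite 𝓀[K]
  have hF : ∀ x : k, FiniteField.frobeniusAlgHom 𝓀[K] k x = x ^ Nat.card 𝓀[K] := fun x => by
    rw [FiniteField.frobeniusAlgHom_apply, Nat.card_eq_fintype_card]
  have hr : ∀ i j, FiniteField.frobeniusAlgHom 𝓀[K] k ((red k h).1 i j) = (red k h).1 i j :=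
    fun i j => by rw [red_apply]; exact AlgHom.commutes _ _
  rw [eval_dicksonForm, eval_dicksonForm, GeneralLinearGroup.val_det_apply, Matrix.det_fin_two]
  simp only [← hF, Coord.change_apply, map_add, map_mul, hr]
  ring

lemma eval_dicksonForm_of_mem {z : Coord k} (hz : z.pt ∈ nodeSet K k) :
    eval z.1 (dicksonForm K k) = 0 := by
  obtain ⟨h, hh⟩ := mem_nodeSet_iff.1 hz
  refine (eq_zero_iff_of_mem_homFun (form_mem_homFun dicksonForm_isHomogeneous) hh).1 ?_
  rw [eval_change_dicksonForm, eval_dicksonForm]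
  simp [nodeCoord, Nat.card_pos.ne']

variable [IsAlgClosed k]

/-- A form that vanishes at the rational points is divisible by `z₀^q z₁ - z₀ z₁^q`. -/
lemma eq_dicksonForm_mul {P : MvPolynomial (Fin 2) k} (hP : P ∈ sym k n)
    (h : ∀ z : Coord k, z.pt ∈ nodeSet K k → eval z.1 P = 0) :
    ∃ P' ∈ sym k (n - Nat.card 𝓀[K] - 1), P = dicksonForm K k * P' := by
  have : Infinite k := IsAlgClosed.instInfinite
  have := Fintype.ofFinite 𝓀[K]
  have hcard : Fintype.card (Option 𝓀[K]) = Nat.card 𝓀[K] + 1 := by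
    rw [Fintype.card_option, Nat.card_eq_fintype_card]
  obtain ⟨c, hc0, hc⟩ : ∃ c ≠ 0, dicksonForm K k = (∏ j, linForm (nodeVec k j).1) * C c := by
    rcases exists_eq_prod_linForm_mul (nodeVec_injective (K := K) (k := k))
      dicksonForm_isHomogeneous (fun j => eval_dicksonForm_of_mem ⟨j, rfl⟩)
      with h0 | ⟨a, P', hP', ha, e⟩
    · exact absurd h0 dicksonForm_ne_zero
    · obtain rfl : a = 0 := by omega
      obtain ⟨c, rfl⟩ := exists_eq_C hP'
      refine ⟨c, ?_, e⟩
      rintro rfl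
      rw [C_0, mul_zero] at e
      exact dicksonForm_ne_zero e
  rcases mem_sym_cases hP with ⟨a, rfl, hPa⟩ | ⟨-, rfl⟩
  · rcases exists_eq_prod_linForm_mul (nodeVec_injective (K := K) (k := k)) hPa
      (fun j => h _ ⟨j, rfl⟩) with rfl | ⟨b, P', hP', ha, e⟩
    · exact ⟨0, zero_mem _, by simp⟩
    · refine ⟨C c⁻¹ * P', ?_, ?_⟩
      · have e1 : (a : ℤ) - Nat.card 𝓀[K] - 1 = b := by omega
        rw [e1]
        have := (isHomogeneous_C (Fin 2) c⁻¹).mul hP'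
        rwa [zero_add] at this
      · rw [hc, e, mul_assoc, ← mul_assoc (C c), ← C_mul, mul_inv_cancel₀ hc0, C_1, one_mul]
  · exact ⟨0, zero_mem _, by simp⟩

/-- A form of degree at most `q` vanishing at the `q + 1` rational points is zero. -/
lemma injective_of_isEvaluation (hf : IsEvaluation f) (hn : n ≤ Nat.card 𝓀[K]) :
    Function.Injective f := by
  have : Infinite k := IsAlgClosed.instInfinite
  refine injective_of_forall_eq_zero f fun φ h => ?_
  refine Subtype.ext (funext fun γ => Subtype.ext ?_)
  obtain ⟨P', hP', e⟩ := eq_dicksonForm_mul (φ.1 γ).2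
    ((eq_zero_iff_forall_nodeSet hf φ).1 h γ)
  rcases mem_sym_cases hP' with ⟨a, ha, -⟩ | ⟨-, rfl⟩
  · omega
  · rw [e, mul_zero]
    rfl

/-- Forms of degree at least `q` interpolate arbitrary values at the `q + 1` rational points. -/
lemma surjective_of_isEvaluation {κ r : Fin 2 → ℤ} (hc : IsCompatible K k κ r)
    {f : (sigma ϖ k i (κ i) (r i)).IntertwiningMap (iwahoriInd ϖ k (r 1) (r 0))}
    (hf : IsEvaluation f) (hn : Nat.card 𝓀[K] ≤ κ i) : Function.Surjective f := by
  intro ψ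
  have := Fintype.ofFinite 𝓀[K]
  obtain ⟨F, hF, hstab, hnode, h0⟩ := exists_nodeFamily hc i ψ
  obtain ⟨φ, hφ, hφF⟩ := exists_equivariant (stabHom_injective ϖ i)
    (act := fun x P => inflate (K := K) (detTwist (r i) (symRep k (κ i))) x P)
    (p := fun γ P => ∀ z, z.pt ∈ nodeSet K k → symFun P z = F γ z)
    (fun x y P => by rw [map_mul]; rfl)
    (fun x γ P hP z hz => by
      rw [symFun_inflate, hstab, twistAct, twistAct, hP _ ((pt_change_mem_nodeSet_iff _).2 hz)])
    (fun γ => by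
      obtain ⟨E, -, hE, -, hP⟩ := exists_interpolation (nodeVec_injective (K := K) (k := k)) (hF γ)
      obtain ⟨P, hP, hPE⟩ := hP (by
        rw [Fintype.card_option, ← Nat.card_eq_fintype_card]; push_cast; omega)
      refine ⟨⟨P, hP⟩, fun z hz => ?_⟩
      obtain ⟨j, hj⟩ := hz
      obtain ⟨c, e⟩ := Coord.pt_eq_iff.1 hj.symm
      rw [symFun_mem_homFun _ _ _ _ e, hF γ _ _ _ e]
      congr 1
      exact (hPE _).symm.trans (hE j))
  refine ⟨⟨φ, hφ⟩, Subtype.ext (funext fun γ => ?_)⟩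
  exact (hf ⟨φ, hφ⟩ γ).trans ((hφF γ _ nodeCoord_pt_mem).trans (hnode γ))

/-- The kernel of the evaluation map, by division by `z₀^q z₁ - z₀ z₁^q`. -/
lemma exists_kernel_of_isEvaluation (hf : IsEvaluation f) :
    ∃ j : (sigma ϖ k i (n - Nat.card 𝓀[K] - 1) (1 + r)).IntertwiningMap (sigma ϖ k i n r),
      Function.Injective j ∧ Function.Exact j f := by
  have : Infinite k := IsAlgClosed.instInfinite
  have hdeg : ((Nat.card 𝓀[K] + 1 : ℕ) : ℤ) + (n - Nat.card 𝓀[K] - 1) = n := by push_cast; ring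
  let μ : sym k (n - Nat.card 𝓀[K] - 1) → sym k n := fun P =>
    ⟨dicksonForm K k * P.1, by
      have := mul_mem_sym (dicksonForm_isHomogeneous (K := K)) P.2
      rwa [hdeg] at this⟩
  have hμ : ∀ P z, symFun (μ P) z = eval z.1 (dicksonForm K k) * symFun P z := fun P z =>
    map_mul _ _ _
  have hμstab : ∀ x P, μ (inflate (K := K) (detTwist (1 + r) (symRep k _)) x P) =
      inflate (K := K) (detTwist r (symRep k n)) x (μ P) := by
    intro x P
    refine symFun_injective (funext fun z => ?_)
    rw [hμ, symFun_inflate, symFun_inflate, twistAct, twistAct, hμ, eval_change_dicksonForm,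
      zpow_add, zpow_one, Units.val_mul]
    ring
  have hμinj : Function.Injective μ := fun P P' h =>
    Subtype.ext (mul_left_cancel₀ (dicksonForm_ne_zero (K := K)) (congrArg Subtype.val h))
  let j : (sigma ϖ k i (n - Nat.card 𝓀[K] - 1) (1 + r)).IntertwiningMap (sigma ϖ k i n r) :=
    ⟨⟨⟨fun φ => ⟨fun γ => μ (φ.1 γ), fun x γ => by
      change μ (φ.1 (stabHom ϖ i x * γ)) = _
      rw [φ.2, hμstab]⟩,
      fun φ φ' => Subtype.ext (funext fun γ => Subtype.ext (mul_add _ _ _))⟩,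
      fun c φ => Subtype.ext (funext fun γ => Subtype.ext (mul_smul_comm _ _ _))⟩, fun g => rfl⟩
  have hj : ∀ φ γ, (j φ).1 γ = μ (φ.1 γ) := fun φ γ => rfl
  refine ⟨j, fun φ φ' h => Subtype.ext (funext fun γ => hμinj ?_), fun φ => ?_⟩
  · rw [← hj, ← hj, h]
  · rw [eq_zero_iff_forall_nodeSet hf]
    constructor
    · intro h
      choose P' hP' e using fun γ => eq_dicksonForm_mul (φ.1 γ).2 (h γ)
      have e' : ∀ γ, μ ⟨P' γ, hP' γ⟩ = φ.1 γ := fun γ => Subtype.ext (e γ).symm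
      refine ⟨⟨fun γ => ⟨P' γ, hP' γ⟩, fun x γ => hμinj ?_⟩, Subtype.ext (funext e')⟩
      rw [e', hμstab, e', φ.2]
    · rintro ⟨φ', rfl⟩ γ z hz
      rw [hj, hμ, eval_dicksonForm_of_mem hz, zero_mul]

end Evaluation


/-! ### Global sections as a fibre product -/

section FibreProduct

variable {k G : Type*} [Field k] [Group G] {H I : Type*} {V : Fin 2 → Type*}
  [AddCommMonoid H] [Module k H] [AddCommMonoid I] [Module k I]
  [∀ i, AddCommMonoid (V i)] [∀ i, Module k (V i)]
  {ρH : Representation k G H} {ρI : Representation k G I} {ρ : ∀ i, Representation k G (V i)}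

/-- The representation `H` is the fibre product of `V 0` and `V 1` over `I`. -/
structure IsFibreProduct (a : ∀ i, ρH.IntertwiningMap (ρ i)) (f : ∀ i, (ρ i).IntertwiningMap ρI) :
    Prop where
  comm (s : H) : f 0 (a 0 s) = f 1 (a 1 s)
  eq_zero (s : H) : (∀ i, a i s = 0) → s = 0
  exists_eq (x : ∀ i, V i) : f 0 (x 0) = f 1 (x 1) → ∃ s, ∀ i, a i s = x i

variable {a : ∀ i, ρH.IntertwiningMap (ρ i)} {f : ∀ i, (ρ i).IntertwiningMap ρI}

namespace IsFibreProduct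

variable (h : IsFibreProduct a f)
include h

lemma comm' (i : Fin 2) (s : H) : f i (a i s) = f (i + 1) (a (i + 1) s) := by
  fin_cases i
  · exact h.comm s
  · exact (h.comm s).symm

lemma ext (i : Fin 2) {s s' : H} (h1 : a i s = a i s') (h2 : a (i + 1) s = a (i + 1) s') :
    s = s' := by
  refine eq_of_add_neg_one_smul (k := k) (h.eq_zero _ fun j => ?_)
  have : j = i ∨ j = i + 1 := by omega
  rcases this with rfl | rfl
  · rw [map_add, map_smul, h1, add_neg_one_smul]
  · rw [map_add, map_smul, h2, add_neg_one_smul]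

lemma exists_eq' (i : Fin 2) (x : V i) (y : V (i + 1)) (e : f i x = f (i + 1) y) :
    ∃ s, a i s = x ∧ a (i + 1) s = y := by
  fin_cases i
  · obtain ⟨s, hs⟩ := h.exists_eq (Fin.cons x (Fin.cons y finZeroElim)) e
    exact ⟨s, hs 0, hs 1⟩
  · obtain ⟨s, hs⟩ := h.exists_eq (Fin.cons y (Fin.cons x finZeroElim)) e.symm
    exact ⟨s, hs 1, hs 0⟩

/-- If both maps to `I` are surjective, the fibre product is an extension of `I` by the product of
their kernels. -/
lemma hasShortExact_prod {W : Fin 2 → Type*} [∀ i, AddCommMonoid (W i)] [∀ i, Module k (W i)]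
    {ρ' : ∀ i, Representation k G (W i)} {j : ∀ i, (ρ' i).IntertwiningMap (ρ i)}
    (hj : ∀ i, Function.Injective (j i)) (hex : ∀ i, Function.Exact (j i) (f i))
    (hf : ∀ i, Function.Surjective (f i)) : HasShortExact ((ρ' 0).prod (ρ' 1)) ρH ρI := by
  have hj0 : ∀ i y, f i (j i y) = 0 := fun i y => (hex i _).2 ⟨y, rfl⟩
  obtain ⟨g, hg⟩ := exists_intertwiningMap (ρ := (ρ' 0).prod (ρ' 1)) (σ := ρH)
    (R := fun y s => a 0 s = j 0 y.1 ∧ a 1 s = j 1 y.2)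
    (fun y y' s s' h h' => by simp only [map_add, h, h', Prod.fst_add, Prod.snd_add, and_self])
    (fun c y s h => by simp only [map_smul, h, Prod.smul_fst, Prod.smul_snd, and_self])
    (fun g y s h => by
      rw [Representation.IntertwiningMap.isIntertwining,
        Representation.IntertwiningMap.isIntertwining, h.1, h.2,
        ← Representation.IntertwiningMap.isIntertwining,
        ← Representation.IntertwiningMap.isIntertwining]
      exact ⟨rfl, rfl⟩)
    (fun y => h.exists_eq' 0 _ _ (by rw [hj0]; exact (hj0 1 _).symm))
    (fun s hs => h.ext 0 (by rw [hs.1, map_zero]; exact map_zero _)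
      (by rw [map_zero]; exact hs.2.trans (map_zero _)))
  have hg' := fun y => (hg y _).2 rfl
  refine ⟨g, (f 0).comp (a 0), fun y y' e => ?_, fun s => ⟨fun hs => ?_, ?_⟩, fun ψ => ?_⟩
  · refine Prod.ext (hj 0 ?_) (hj 1 ?_)
    · rw [← (hg' y).1, ← (hg' y').1, e]
    · rw [← (hg' y).2, ← (hg' y').2, e]
  · rw [Representation.IntertwiningMap.comp_apply] at hs
    obtain ⟨y, hy⟩ := (hex 0 _).1 hs
    obtain ⟨y', hy'⟩ := (hex 1 _).1 ((h.comm s).symm.trans hs)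
    exact ⟨(y, y'), (hg _ _).1 ⟨hy.symm, hy'.symm⟩⟩
  · rintro ⟨y, rfl⟩
    rw [Representation.IntertwiningMap.comp_apply, (hg' y).1, hj0]
  · obtain ⟨x, hx⟩ := hf 0 ψ
    obtain ⟨y, hy⟩ := hf 1 ψ
    obtain ⟨s, hs, -⟩ := h.exists_eq' 0 x y (hx.trans hy.symm)
    exact ⟨s, by rw [Representation.IntertwiningMap.comp_apply, hs, hx]⟩

/-- If one map to `I` is surjective, the kernel of the projection to the other factor is the
kernel of that map. -/
lemma hasShortExact (i : Fin 2) {W : Type*} [AddCommMonoid W] [Module k W]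
    {ρ' : Representation k G W} {j : ρ'.IntertwiningMap (ρ (i + 1))}
    (hj : Function.Injective j) (hex : Function.Exact j (f (i + 1)))
    (hf : Function.Surjective (f (i + 1))) : HasShortExact ρ' ρH (ρ i) := by
  have hj0 : ∀ y, f (i + 1) (j y) = 0 := fun y => (hex _).2 ⟨y, rfl⟩
  obtain ⟨g, hg⟩ := exists_intertwiningMap (ρ := ρ') (σ := ρH)
    (R := fun y s => a i s = 0 ∧ a (i + 1) s = j y)
    (fun y y' s s' h h' => by simp only [map_add, h, h', add_zero, and_self])
    (fun c y s h => by simp only [map_smul, h, smul_zero, and_self])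
    (fun g y s h => by
      rw [Representation.IntertwiningMap.isIntertwining,
        Representation.IntertwiningMap.isIntertwining, h.1, h.2, map_zero,
        Representation.IntertwiningMap.isIntertwining]
      exact ⟨rfl, rfl⟩)
    (fun y => h.exists_eq' i _ _ (by rw [hj0, map_zero]))
    (fun s hs => h.ext i (by rw [hs.1, map_zero]) (by rw [hs.2, map_zero, map_zero]))
  have hg' := fun y => (hg y _).2 rfl
  refine ⟨g, a i, fun y y' e => hj ?_, fun s => ⟨fun hs => ?_, ?_⟩, fun x => ?_⟩
  · rw [← (hg' y).2, ← (hg' y').2, e]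
  · obtain ⟨y, hy⟩ := (hex (a (i + 1) s)).1 (by rw [← h.comm', hs, map_zero])
    exact ⟨y, (hg _ _).1 ⟨hs, hy.symm⟩⟩
  · rintro ⟨y, rfl⟩
    exact (hg' y).1
  · obtain ⟨y, hy⟩ := hf (f i x)
    obtain ⟨s, hs, -⟩ := h.exists_eq' i x y hy.symm
    exact ⟨s, hs⟩

/-- If both maps to `I` are injective, the fibre product is the intersection of their images. -/
lemma nonempty_equiv_imageInter (hf : ∀ i, Function.Injective (f i)) :
    Nonempty (ρH.Equiv (imageInter (f 0) (f 1)).toRepresentation) := by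
  have hmem : ∀ s, f 0 (a 0 s) ∈ (imageInter (f 0) (f 1)).toSubmodule := fun s =>
    ⟨⟨a 0 s, rfl⟩, ⟨a 1 s, (h.comm s).symm⟩⟩
  let e : H →ₗ[k] (imageInter (f 0) (f 1)).toSubmodule :=
    ((f 0).toLinearMap ∘ₗ (a 0).toLinearMap).codRestrict _ hmem
  have he : Function.Bijective e := by
    constructor
    · intro s s' e
      have e0 : f 0 (a 0 s) = f 0 (a 0 s') := congrArg Subtype.val e
      refine h.ext 0 (hf 0 e0) (hf 1 ?_)
      exact (h.comm s).symm.trans (e0.trans (h.comm s'))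
    · rintro ⟨_, ⟨x, rfl⟩, ⟨y, hy⟩⟩
      obtain ⟨s, hs, -⟩ := h.exists_eq' 0 x y hy.symm
      exact ⟨s, Subtype.ext (congrArg (f 0) hs)⟩
  refine ⟨Representation.Equiv.mk (LinearEquiv.ofBijective e he) fun g => LinearMap.ext fun s =>
    Subtype.ext ?_⟩
  change f 0 (a 0 (ρH g s)) = ρI g (f 0 (a 0 s))
  rw [Representation.IntertwiningMap.isIntertwining,
    Representation.IntertwiningMap.isIntertwining]

end IsFibreProduct

end FibreProduct

lemma nonempty_equiv_of_bijective {k G V W : Type*} [Field k] [Group G] [AddCommMonoid V]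
    [Module k V] [AddCommMonoid W] [Module k W] {ρ : Representation k G V}
    {σ : Representation k G W} (f : ρ.IntertwiningMap σ) (hf : Function.Bijective f) :
    Nonempty (ρ.Equiv σ) :=
  ⟨Representation.Equiv.mk (LinearEquiv.ofBijective f.toLinearMap hf) f.isIntertwining'⟩

namespace EquivariantLineBundle.Trivialization

open MvPolynomial Filter Topology
open Matrix (GeneralLinearGroup)

universe v

variable {K : Type*} [Field K] [ValuativeRel K] {ϖ : Uniformizer K}
variable {k : Type*} [Field k] [Algebra 𝓀[K] k] {L : EquivariantLineBundle.{v} ϖ k}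

lemma coe_H0Rep (g : evenGroup ϖ) (s : L.H0) : (L.H0Rep g s).1 = L.ρ g s.1 := rfl

variable [IsAlgClosed k] [TopologicalSpace K] [IsNonarchimedeanLocalField K]
variable {κ r : Fin 2 → ℤ} (T : L.Trivialization κ r)

/-- Restriction of global sections to the components of the translates of `s_i`. -/
lemma exists_restriction (i : Fin 2) :
    ∃ a : L.H0Rep.IntertwiningMap (sigma ϖ k i (κ i) (r i)),
      ∀ s γ, symFun ((a s).1 γ) = T.res i (L.ρ γ s.1) := by
  have : Infinite k := IsAlgClosed.instInfinite
  obtain ⟨a, ha⟩ := exists_intertwiningMap (ρ := L.H0Rep) (σ := sigma ϖ k i (κ i) (r i))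
    (R := fun (s : L.H0) (φ : SigmaSpace ϖ k i (κ i) (r i)) =>
      ∀ γ, symFun (φ.1 γ) = T.res i (L.ρ γ s.1))
    (fun s s' φ φ' h h' γ => by
      change symFun (φ.1 γ + φ'.1 γ) = T.res i (L.ρ γ (s.1 + s'.1))
      rw [map_add, map_add, symFun_add, h, h'])
    (fun c s φ h γ => by
      change symFun (c • φ.1 γ) = T.res i (L.ρ γ (c • s.1))
      rw [map_smul, map_smul, symFun_smul, h])
    (fun g s φ h γ => by
      rw [sigma_apply, coe_H0Rep, h, map_mul, Module.End.mul_apply])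
    (fun s => exists_sigma (fun γ z => T.mem_H0_iff.1 s.2 γ i z) fun x γ =>
      T.res_stabHom_mul i x γ s.1)
    (fun φ h => Subtype.ext (funext fun γ => symFun_injective ((h γ).trans (by
      rw [Submodule.coe_zero, map_zero, map_zero]
      funext z
      exact (map_zero _).symm))))
  exact ⟨a, fun s => (ha s _).2 rfl⟩

/-- Global sections of `L` are pairs of families of forms, on the components of the translates of
`s₀` and `s₁`, that agree at the double points. -/
lemma exists_isFibreProduct
    {f : ∀ i, (sigma ϖ k i (κ i) (r i)).IntertwiningMap (iwahoriInd ϖ k (r 1) (r 0))}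
    (hf : ∀ i, IsEvaluation (f i)) :
    ∃ a : ∀ i, L.H0Rep.IntertwiningMap (sigma ϖ k i (κ i) (r i)),
      (∀ i s γ, symFun ((a i s).1 γ) = T.res i (L.ρ γ s.1)) ∧ IsFibreProduct a f := by
  have : Infinite k := IsAlgClosed.instInfinite
  choose a ha using T.exists_restriction
  have hfa : ∀ i φ γ, (f i φ).1 γ = symFun (φ.1 γ) nodeCoord := fun i =>
    isEvaluation_iff.1 (hf i)
  refine ⟨a, ha, ⟨fun s => Subtype.ext (funext fun γ => ?_), fun s hs => Subtype.ext (T.ext ?_),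
    fun φ h => ?_⟩⟩
  · rw [hfa, hfa, ha, ha, T.res_node]
  · intro i γ
    rw [← ha, hs i]
    change symFun 0 = T.res i (L.ρ γ 0)
    rw [map_zero, map_zero]
    funext z
    exact map_zero _
  · obtain ⟨s, hs⟩ := T.exists_section (F := fun i γ => symFun ((φ i).1 γ))
      (fun i γ => symFun_mem_homFun _) (fun i => symFun_stabHom_mul (φ i))
      (fun γ => by rw [← hfa, ← hfa, h])
    refine ⟨⟨s, T.mem_H0_iff.2 fun γ i z => ?_⟩, fun i => Subtype.ext (funext fun γ =>
      symFun_injective ?_)⟩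
    · rw [hs]; exact symFun_mem_regAt _ _
    · rw [ha, hs]

end EquivariantLineBundle.Trivialization


/-! ### Cohomology classes of an equivariant line bundle in coordinates -/

section TwistedFamilies

open MvPolynomial Filter Topology
open Matrix (GeneralLinearGroup)

variable {K : Type*} [Field K] [ValuativeRel K] {k : Type*} [Field k] [Algebra 𝓀[K] k]

/-- The action of `G°ϖ^ℤ` on families of functions of the homogeneous coordinates that corresponds
to `det^r ⊗ 𝒪(n)`. -/
noncomputable def twistFam (r : ℤ) (x : MaxCompactMod K) (D : P1 k → Coord k → k) :
    P1 k → Coord k → k := fun p => twistAct r x (D (p.change (red k x.1)))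

variable {r n : ℤ} {x : MaxCompactMod K} {D : P1 k → Coord k → k}

lemma P1.change_mul (A B : GL (Fin 2) k) (p : P1 k) :
    p.change (A * B) = (p.change A).change B := by
  obtain ⟨z, rfl⟩ := Coord.exists_pt p
  rw [P1.change_pt, P1.change_pt, P1.change_pt, Coord.change_mul]

lemma twistFam_mul (x y : MaxCompactMod K) (D : P1 k → Coord k → k) :
    twistFam r (x * y) D = twistFam r x (twistFam r y D) := by
  funext p
  rw [twistFam, twistAct_mul, Prod.fst_mul, map_mul, P1.change_mul]
  rfl

lemma twistFam_mem_cocycles (hD : D ∈ cocycles k n) : twistFam r x D ∈ cocycles k n :=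
  Submodule.smul_mem _ _ (comp_change_mem_cocycles _ hD)

lemma residue_twistFam [IsAlgClosed k] (D : cocycles k n) :
    residue k n ⟨_, twistFam_mem_cocycles (r := r) (x := x) D.2⟩ =
      inflate (K := K) (detTwist (r - 1) (symRep k (-2 - n)).dual) x (residue k n D) := by
  have e : (⟨_, twistFam_mem_cocycles (r := r) (x := x) D.2⟩ : cocycles k n) =
      ((GeneralLinearGroup.det (red k x.1) ^ r : kˣ) : k) •
        ⟨_, comp_change_mem_cocycles (red k x.1) D.2⟩ := rfl
  rw [e, map_smul, residue_comp_change, smul_smul]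
  have e' : inflate (K := K) (detTwist (r - 1) (symRep k (-2 - n)).dual) x (residue k n D) =
      ((GeneralLinearGroup.det (red k x.1) ^ (r - 1) : kˣ) : k) •
        (symRep k (-2 - n)).dual (red k x.1) (residue k n D) := rfl
  rw [e', zpow_sub_one, Units.val_mul, Units.val_inv_eq_inv_val,
    GeneralLinearGroup.val_det_apply]

end TwistedFamilies

namespace EquivariantLineBundle.Trivialization

open MvPolynomial Filter Topology
open Matrix (GeneralLinearGroup)

universe v

variable {K : Type*} [Field K] [ValuativeRel K] {ϖ : Uniformizer K}
variable {k : Type*} [Field k] [Algebra 𝓀[K] k]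
variable {L : EquivariantLineBundle.{v} ϖ k} {κ r : Fin 2 → ℤ} (T : L.Trivialization κ r)

/-- The restriction of a family of sections to the component of `s_i`. -/
noncomputable def fam (i : Fin 2) :
    (HBar ϖ k → ∀ y, L.fiber y) →ₗ[k] (P1 k → Coord k → k) where
  toFun d p := T.res i (d (chart ϖ (toVertex ϖ i) p))
  map_add' _ _ := funext fun _ => map_add _ _ _
  map_smul' c _ := funext fun _ => map_smul (T.res i) c _

lemma fam_familyRep (i : Fin 2) (γ : evenGroup ϖ) (d : HBar ϖ k → ∀ y, L.fiber y) (p : P1 k) :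
    T.fam i (L.familyRep γ d) p =
      T.res i (L.ρ γ (d (chart ϖ ((γ : GL (Fin 2) K)⁻¹ * toVertex ϖ i) p))) := rfl

lemma fam_mem_homFun (i : Fin 2) (d : HBar ϖ k → ∀ y, L.fiber y) (p : P1 k) :
    T.fam i d p ∈ homFun k (κ i) := T.res_mem _ _

lemma fam_stabHom_mul (i : Fin 2) (x : MaxCompactMod K) (γ : evenGroup ϖ)
    (d : HBar ϖ k → ∀ y, L.fiber y) :
    T.fam i (L.familyRep (stabHom ϖ i x * γ) d) = twistFam (r i) x (T.fam i (L.familyRep γ d)) := by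
  funext p
  obtain ⟨z, rfl⟩ := Coord.exists_pt p
  have e := chart_mul_stabHom (ϖ := ϖ) γ⁻¹ i x.1⁻¹ x.2⁻¹ (z.change (red k x.1))
  rw [map_inv (red k), Coord.change_change_inv, ← Prod.inv_mk, map_inv] at e
  rw [twistFam, P1.change_pt, fam_familyRep, fam_familyRep, T.res_stabHom_mul, ← Subgroup.coe_inv,
    ← Subgroup.coe_inv, mul_inv_rev, ← e]

/-- The family given by a single section at the double points and zero elsewhere. -/
lemma exists_fam_eq_indicator [DecidablePred (· ∈ nodeSet K k)] (t : ∀ y, L.fiber y) :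
    ∃ d, ∀ i γ p, T.fam i (L.familyRep γ d) p =
      if p ∈ nodeSet K k then T.res i (L.ρ γ t) else 0 := by
  classical
  refine ⟨fun x => if ∃ (g : GL (Fin 2) K) (z : Coord k),
    z.pt ∈ nodeSet K k ∧ chart ϖ g z.pt = x then t else 0, fun i γ p => ?_⟩
  obtain ⟨z, rfl⟩ := Coord.exists_pt p
  rw [fam_familyRep]
  split_ifs with h1 h2 h2
  · rfl
  · obtain ⟨g, z', hz', e⟩ := h1
    exact absurd (mem_nodeSet_of_chart_eq e.symm hz') h2
  · exact absurd ⟨_, z, h2, rfl⟩ h1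
  · rw [map_zero, map_zero]

variable [TopologicalSpace K] [IsNonarchimedeanLocalField K]

lemma isRegularAt_of_notMem {γ : evenGroup ϖ} {i : Fin 2} {z : Coord k} {s : ∀ y, L.fiber y}
    (hz : z.pt ∉ nodeSet K k) (h : T.res i (L.ρ γ⁻¹ s) ∈ regAt (κ i) z) :
    L.IsRegularAt s (chart ϖ (γ * toVertex ϖ i) z.pt) :=
  LineBundle.isRegularAt_of_notMem hz
    ((isRegularOnComponentAt_ρ_iff γ).2 ((T.isRegular_iff _ _ _).2 h))

lemma forall_isRegularAt_iff {d : HBar ϖ k → ∀ y, L.fiber y} :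
    (∀ x, L.IsRegularAt (d x) x) ↔
      ∀ (γ : evenGroup ϖ) i (z : Coord k), T.fam i (L.familyRep γ d) z.pt ∈ regAt (κ i) z := by
  constructor
  · intro h γ i z
    have := T.isRegularAt_iff.1 (h (chart ϖ ((γ : GL (Fin 2) K)⁻¹ * toVertex ϖ i) z.pt)) γ⁻¹ i z rfl
    rwa [inv_inv] at this
  · intro h x
    refine T.isRegularAt_iff.2 ?_
    rintro γ i z rfl
    have := h γ⁻¹ i z
    rwa [fam_familyRep, Subgroup.coe_inv, inv_inv] at this

lemma mem_boundaries_iff {d : HBar ϖ k → ∀ y, L.fiber y} : d ∈ L.boundaries ↔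
    ∃ e, ∀ γ i (z : Coord k),
      T.fam i (L.familyRep γ d) z.pt - T.res i (L.ρ γ e) ∈ regAt (κ i) z := by
  refine exists_congr fun e => ?_
  refine (T.forall_isRegularAt_iff (d := fun x => d x - e)).trans ?_
  refine forall₃_congr fun γ i z => ?_
  rw [fam_familyRep, fam_familyRep, map_sub, map_sub]

/-- A family of sections represents a global section of the quotient sheaf if and only if it does so
on each component: a condition involving two components only occurs at double points, which are
isolated. -/
lemma mem_quotientSections_iff {d : HBar ϖ k → ∀ y, L.fiber y} : d ∈ L.quotientSections ↔
    ∀ γ i, T.fam i (L.familyRep γ d) ∈ cocycles k (κ i) := by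
  constructor
  · intro hd γ i
    refine ⟨fun p => T.fam_mem_homFun _ _ _, fun z₀ => ?_⟩
    obtain ⟨U, hU, hx, h⟩ := hd (chart ϖ ((γ : GL (Fin 2) K)⁻¹ * toVertex ϖ i) z₀.pt)
    filter_upwards [eventually_of_isOpen (isOpen_preimage_chart hU _) hx] with z hz
    have := T.isRegularAt_iff.1 (h _ hz) γ⁻¹ i z rfl
    rwa [inv_inv, map_sub, map_sub] at this
  · intro hd x
    refine ⟨{y | L.IsRegularAt (d y - d x) y}, (isOpen_iff _).2 fun g => ?_,
      by simpa using LineBundle.IsRegularAt.zero x, fun y hy => hy⟩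
    obtain ⟨γ, i, rfl⟩ := exists_eq_mul_toVertex ϖ g
    refine isOpen_of_forall_eventually fun z₀ hz₀ => ?_
    have h1 := (hd γ⁻¹ i).2 z₀
    have h2 := T.isRegularAt_iff.1 hz₀ γ i z₀ rfl
    filter_upwards [h1, eventually_mem_regAt h2,
      eventually_eq_or_notMem (nodeSet_finite (K := K) (k := k)) z₀] with z hz hz' hz''
    rcases hz'' with e | hz''
    · rw [e]; exact hz₀
    · refine T.isRegularAt_of_notMem hz'' ?_
      rw [fam_familyRep, fam_familyRep, Subgroup.coe_inv, inv_inv] at hz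
      have := add_mem hz hz'
      rwa [← map_sub, ← map_sub, ← map_add, ← map_add, sub_add_sub_cancel] at this

/-- A family of sections may be prescribed on all components, if its values at the double points
vanish. -/
lemma exists_fam_eq {D : Fin 2 → evenGroup ϖ → P1 k → Coord k → k}
    (hD : ∀ i γ p, D i γ p ∈ homFun k (κ i))
    (hstab : ∀ i x γ, D i (stabHom ϖ i x * γ) = twistFam (r i) x (D i γ))
    (h0 : ∀ i γ, ∀ p ∈ nodeSet K k, D i γ p = 0)
    (hnode : ∀ i γ p (z : Coord k), z.pt ∈ nodeSet K k → D i γ p z = 0) :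
    ∃ d, ∀ i γ, T.fam i (L.familyRep γ d) = D i γ := by
  classical
  -- `F x i γ` is what the section `d x` has to restrict to. It is well defined because the
  -- charts are injective away from the double points, and `D` vanishes at the latter.
  let F : HBar ϖ k → Fin 2 → evenGroup ϖ → Coord k → k := fun x i γ =>
    if h : ∃ p, chart ϖ ((γ : GL (Fin 2) K)⁻¹ * toVertex ϖ i) p = x then D i γ h.choose else 0
  have hF : ∀ i (γ : evenGroup ϖ) p, F (chart ϖ ((γ : GL (Fin 2) K)⁻¹ * toVertex ϖ i) p) i γ =
      D i γ p := by
    intro i γ p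
    have h : ∃ p', chart ϖ ((γ : GL (Fin 2) K)⁻¹ * toVertex ϖ i) p' =
      chart ϖ ((γ : GL (Fin 2) K)⁻¹ * toVertex ϖ i) p := ⟨p, rfl⟩
    have hc := h.choose_spec
    have hFp : F (chart ϖ ((γ : GL (Fin 2) K)⁻¹ * toVertex ϖ i) p) i γ = D i γ h.choose := dif_pos h
    rw [hFp]
    generalize h.choose = p' at hc
    obtain ⟨z, rfl⟩ := Coord.exists_pt p
    obtain ⟨z', rfl⟩ := Coord.exists_pt p'
    by_cases hz : z.pt ∈ nodeSet K k
    · rw [h0 _ _ _ hz, h0 _ _ _ (mem_nodeSet_of_chart_eq hc hz)]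
    · rw [pt_eq_of_chart_eq hz hc.symm]
  have hF' : ∀ x i (γ : evenGroup ϖ), (¬ ∃ p, chart ϖ ((γ : GL (Fin 2) K)⁻¹ * toVertex ϖ i) p = x) →
      F x i γ = 0 := fun x i γ h => dif_neg h
  have hs : ∀ x, ∃ s, ∀ i γ, T.res i (L.ρ γ s) = F x i γ := by
    intro x
    refine T.exists_section (fun i γ => ?_) (fun i y γ => ?_) fun γ => ?_
    · by_cases h : ∃ p, chart ϖ ((γ : GL (Fin 2) K)⁻¹ * toVertex ϖ i) p = x
      · obtain ⟨p, rfl⟩ := h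
        rw [hF]; exact hD _ _ _
      · rw [hF' _ _ _ h]; exact zero_mem _
    · have e : ∀ z : Coord k, chart ϖ (((stabHom ϖ i y * γ : evenGroup ϖ) : GL (Fin 2) K)⁻¹ *
          toVertex ϖ i) z.pt =
          chart ϖ ((γ : GL (Fin 2) K)⁻¹ * toVertex ϖ i) (z.change (red k y.1)).pt := by
        intro z
        have e := chart_mul_stabHom (ϖ := ϖ) γ⁻¹ i y.1⁻¹ y.2⁻¹ (z.change (red k y.1))
        rw [map_inv (red k), Coord.change_change_inv, ← Prod.inv_mk, map_inv] at e
        rw [← Subgroup.coe_inv, ← Subgroup.coe_inv, mul_inv_rev, ← e]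
      by_cases h : ∃ p, chart ϖ ((γ : GL (Fin 2) K)⁻¹ * toVertex ϖ i) p = x
      · obtain ⟨p, rfl⟩ := h
        obtain ⟨z, rfl⟩ := Coord.exists_pt p
        rw [hF]
        have e' := e (z.change (red k y.1)⁻¹)
        rw [Coord.change_inv_change] at e'
        rw [← e', hF, hstab, twistFam, P1.change_pt, Coord.change_inv_change]
      · rw [hF' _ _ _ h, hF']
        · funext z; simp [twistAct]
        · rintro ⟨p, hp⟩
          obtain ⟨z, rfl⟩ := Coord.exists_pt p
          exact h ⟨_, (e z).symm.trans hp⟩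
    · have : ∀ i, F x i γ nodeCoord = 0 := fun i => by
        by_cases h : ∃ p, chart ϖ ((γ : GL (Fin 2) K)⁻¹ * toVertex ϖ i) p = x
        · obtain ⟨p, rfl⟩ := h
          rw [hF, hnode _ _ _ _ nodeCoord_pt_mem]
        · rw [hF' _ _ _ h]; rfl
      rw [this, this]
  choose d hd using hs
  refine ⟨d, fun i γ => funext fun p => ?_⟩
  rw [fam_familyRep, hd, hF]

end EquivariantLineBundle.Trivialization


/-! ### Residues and the connecting map -/

namespace EquivariantLineBundle.Trivialization

open MvPolynomial Filter Topology
open Matrix (GeneralLinearGroup)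

universe v

variable {K : Type*} [Field K] [ValuativeRel K] {ϖ : Uniformizer K}
variable {k : Type*} [Field k] [Algebra 𝓀[K] k]
variable {L : EquivariantLineBundle.{v} ϖ k} {κ r : Fin 2 → ℤ} (T : L.Trivialization κ r)
variable [IsAlgClosed k] [TopologicalSpace K] [IsNonarchimedeanLocalField K]

/-- The residues of a cohomology class on the component of `s_i` and its translates. -/
noncomputable def residueAt (i : Fin 2) (d : L.quotientSections) (γ : evenGroup ϖ) :
    Module.Dual k (sym k (-2 - κ i)) :=
  residue k (κ i) ⟨T.fam i (L.familyRep γ d.1), T.mem_quotientSections_iff.1 d.2 γ i⟩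

lemma residueAt_add (i : Fin 2) (d d' : L.quotientSections) (γ : evenGroup ϖ) :
    T.residueAt i (d + d') γ = T.residueAt i d γ + T.residueAt i d' γ := by
  rw [residueAt, residueAt, residueAt, ← map_add]
  congr 1
  refine Subtype.ext ?_
  change T.fam i (L.familyRep γ (d.1 + d'.1)) = _
  rw [map_add, map_add]
  rfl

lemma residueAt_smul (i : Fin 2) (c : k) (d : L.quotientSections) (γ : evenGroup ϖ) :
    T.residueAt i (c • d) γ = c • T.residueAt i d γ := by
  rw [residueAt, residueAt, ← map_smul]
  congr 1
  refine Subtype.ext ?_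
  change T.fam i (L.familyRep γ (c • d.1)) = _
  rw [map_smul, map_smul]
  rfl

lemma residueAt_stabHom_mul (i : Fin 2) (d : L.quotientSections) (x : MaxCompactMod K)
    (γ : evenGroup ϖ) : T.residueAt i d (stabHom ϖ i x * γ) =
      inflate (K := K) (detTwist (r i - 1) (symRep k (-2 - κ i)).dual) x (T.residueAt i d γ) := by
  rw [residueAt, residueAt, ← residue_twistFam]
  congr 1
  exact Subtype.ext (T.fam_stabHom_mul i x γ d.1)

lemma residueAt_eq_zero_iff (i : Fin 2) (d : L.quotientSections) (γ : evenGroup ϖ) :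
    T.residueAt i d γ = 0 ↔ T.fam i (L.familyRep γ d.1) ∈ coboundaries k (κ i) :=
  residue_eq_zero_iff _

/-- The relation underlying the connecting map `I → H¹`: on each component the family `d` comes from
a section `e` of the sheaf of all sections, and the function `ψ` measures by how much these fail
to agree at the double points. -/
def IsConnecting (ψ : IwahoriSpace ϖ k (r 1) (r 0)) (d : L.quotientSections) : Prop :=
  ∃ e : Fin 2 → evenGroup ϖ → Coord k → k, (∀ i γ, e i γ ∈ homFun k (κ i)) ∧
    (∀ i x γ, e i (stabHom ϖ i x * γ) = twistAct (r i) x (e i γ)) ∧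
    (∀ i γ (z : Coord k), T.fam i (L.familyRep γ d.1) z.pt - e i γ ∈ regAt (κ i) z) ∧
    ∀ γ, e 0 γ nodeCoord - e 1 γ nodeCoord = ψ.1 γ

variable {T}

lemma IsConnecting.add {ψ ψ' : IwahoriSpace ϖ k (r 1) (r 0)} {d d' : L.quotientSections}
    (h : T.IsConnecting ψ d) (h' : T.IsConnecting ψ' d') : T.IsConnecting (ψ + ψ') (d + d') := by
  obtain ⟨e, h1, h2, h3, h4⟩ := h
  obtain ⟨e', h1', h2', h3', h4'⟩ := h'
  refine ⟨e + e', fun i γ => add_mem (h1 i γ) (h1' i γ), fun i x γ => ?_, fun i γ z => ?_,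
    fun γ => ?_⟩
  · change e i _ + e' i _ = twistAct (r i) x (e i γ + e' i γ)
    rw [twistAct_add, h2, h2']
  · change T.fam i (L.familyRep γ (d.1 + d'.1)) z.pt - (e i γ + e' i γ) ∈ _
    rw [map_add, map_add, Pi.add_apply, add_sub_add_comm]
    exact add_mem (h3 i γ z) (h3' i γ z)
  · change e 0 γ nodeCoord + e' 0 γ nodeCoord - (e 1 γ nodeCoord + e' 1 γ nodeCoord) =
      ψ.1 γ + ψ'.1 γ
    rw [← h4, ← h4', add_sub_add_comm]

lemma IsConnecting.smul {ψ : IwahoriSpace ϖ k (r 1) (r 0)} {d : L.quotientSections} (c : k)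
    (h : T.IsConnecting ψ d) : T.IsConnecting (c • ψ) (c • d) := by
  obtain ⟨e, h1, h2, h3, h4⟩ := h
  refine ⟨c • e, fun i γ => Submodule.smul_mem _ c (h1 i γ), fun i x γ => ?_, fun i γ z => ?_,
    fun γ => ?_⟩
  · change c • e i _ = twistAct (r i) x (c • e i γ)
    rw [h2]
    funext z
    simp only [twistAct, Pi.smul_apply, smul_eq_mul]
    ring
  · change T.fam i (L.familyRep γ (c • d.1)) z.pt - c • e i γ ∈ _
    rw [map_smul, map_smul, Pi.smul_apply, ← smul_sub]
    exact Submodule.smul_mem _ c (h3 i γ z)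
  · change c * e 0 γ nodeCoord - c * e 1 γ nodeCoord = c * ψ.1 γ
    rw [← h4, mul_sub]

lemma IsConnecting.of_translate {ψ ψ' : IwahoriSpace ϖ k (r 1) (r 0)} {d d' : L.quotientSections}
    (g : evenGroup ϖ) (h : T.IsConnecting ψ d) (hψ : ∀ γ, ψ'.1 γ = ψ.1 (γ * g))
    (hd : d'.1 = L.familyRep g d.1) : T.IsConnecting ψ' d' := by
  obtain ⟨e, h1, h2, h3, h4⟩ := h
  refine ⟨fun i γ => e i (γ * g), fun i γ => h1 i _, fun i x γ => ?_, fun i γ z => ?_,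
    fun γ => ?_⟩
  · change e i (stabHom ϖ i x * γ * g) = twistAct (r i) x (e i (γ * g))
    rw [mul_assoc, h2]
  · rw [hd, ← Module.End.mul_apply, ← map_mul]
    exact h3 i _ z
  · rw [hψ, h4]

lemma IsConnecting.residueAt_eq_zero {ψ : IwahoriSpace ϖ k (r 1) (r 0)} {d : L.quotientSections}
    (h : T.IsConnecting ψ d) (i : Fin 2) (γ : evenGroup ϖ) : T.residueAt i d γ = 0 := by
  obtain ⟨e, h1, h2, h3, h4⟩ := h
  rw [residueAt_eq_zero_iff]
  exact ⟨fun p => T.fam_mem_homFun _ _ _, e i γ, h1 i γ, h3 i γ⟩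

/-- If the sections on the components agree at the double points, they form a global section. -/
lemma IsConnecting.mem_boundaries {d : L.quotientSections} (h : T.IsConnecting 0 d) :
    d.1 ∈ L.boundaries := by
  obtain ⟨e, h1, h2, h3, h4⟩ := h
  obtain ⟨s, hs⟩ := T.exists_section h1 h2 fun γ => sub_eq_zero.1 (h4 γ)
  exact T.mem_boundaries_iff.2 ⟨s, fun γ i z => by rw [hs]; exact h3 i γ z⟩

variable (T)

/-- If all residues vanish, the class is trivial on each component, and its trivializations may be
chosen equivariantly. -/
lemma exists_isConnecting_of_residueAt_eq_zero (hc : IsCompatible K k κ r)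
    {d : L.quotientSections} (h : ∀ i γ, T.residueAt i d γ = 0) : ∃ ψ, T.IsConnecting ψ d := by
  have he : ∀ i, ∃ e : evenGroup ϖ → Coord k → k,
      (∀ x γ, e (stabHom ϖ i x * γ) = twistAct (r i) x (e γ)) ∧ ∀ γ, e γ ∈ homFun k (κ i) ∧
        ∀ z : Coord k, T.fam i (L.familyRep γ d.1) z.pt - e γ ∈ regAt (κ i) z := fun i =>
    exists_equivariant (stabHom_injective ϖ i) twistAct_mul
      (p := fun γ e => e ∈ homFun k (κ i) ∧
        ∀ z : Coord k, T.fam i (L.familyRep γ d.1) z.pt - e ∈ regAt (κ i) z)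
      (fun x γ e he => ⟨twistAct_mem_homFun he.1, fun z => by
        rw [T.fam_stabHom_mul, twistFam, ← twistAct_sub, twistAct_mem_regAt_iff, P1.change_pt]
        exact he.2 _⟩)
      (fun γ => ((T.residueAt_eq_zero_iff i d γ).1 (h i γ)).2)
  choose e he1 he2 using he
  choose ψ hψ using fun i => exists_node_values hc i (F := e i) (fun γ => (he2 i γ).1) (he1 i)
  refine ⟨ψ 0 - ψ 1, e, fun i γ => (he2 i γ).1, he1, fun i γ => (he2 i γ).2, fun γ => ?_⟩
  rw [← hψ, ← hψ]
  rfl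

/-- Every element of `I` is the defect of agreement at the double points of a cohomology class
that is trivial on all components. The class is supported on the double points. -/
lemma exists_isConnecting (hc : IsCompatible K k κ r) (ψ : IwahoriSpace ϖ k (r 1) (r 0)) :
    ∃ d, T.IsConnecting ψ d := by
  classical
  have := Fintype.ofFinite 𝓀[K]
  obtain ⟨N, hN, hNstab, hNnode, hN0⟩ := exists_nodeFamily hc 1 ψ
  -- `N` is supported on the double points; `B` has the same values there, but is regular there. The
  -- section `t`, zero on the components of type `s₀` and `B - N` on those of type `s₁`, represents
  -- the class at the double points; on the latter components it differs from `-N` by a regular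
  -- section.
  obtain ⟨B, hBstab, hB⟩ := exists_equivariant (stabHom_injective ϖ 1) (twistAct_mul (r := r 1))
    (p := fun γ B => B ∈ homFun k (κ 1) ∧ ∀ z : Coord k, z.pt ∈ nodeSet K k →
      B z = N γ z ∧ B ∈ regAt (κ 1) z)
    (fun x γ B hB => ⟨twistAct_mem_homFun hB.1, fun z hz => by
      have := hB.2 _ ((pt_change_mem_nodeSet_iff x.1).2 hz)
      rw [hNstab, twistAct_mem_regAt_iff, twistAct, twistAct, this.1]
      exact ⟨rfl, this.2⟩⟩)
    (fun γ => by
      obtain ⟨E, hE, h1, h2, -⟩ := exists_interpolation (nodeVec_injective (K := K) (k := k)) (hN γ)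
      refine ⟨E, hE, fun z hz => ?_⟩
      obtain ⟨j, hj⟩ := hz
      obtain ⟨c, e⟩ := Coord.pt_eq_iff.1 hj.symm
      rw [hE _ _ _ e, hN γ _ _ _ e, h1]
      exact ⟨rfl, regAt_of_pt_eq hj (h2 j)⟩)
  obtain ⟨t, ht⟩ := T.exists_section (F := Fin.cons 0 (Fin.cons (B - N) finZeroElim))
    (fun i γ => by
      fin_cases i
      · exact zero_mem _
      · exact sub_mem (hB γ).1 (hN γ))
    (fun i x γ => by
      fin_cases i
      · funext z; exact (mul_zero _).symm
      · change B (stabHom ϖ 1 x * γ) - N (stabHom ϖ 1 x * γ) = twistAct (r 1) x (B γ - N γ)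
        rw [twistAct_sub, hBstab, hNstab])
    (fun γ => by
      change 0 = B γ nodeCoord - N γ nodeCoord
      rw [((hB γ).2 _ nodeCoord_pt_mem).1, sub_self])
  have ht0 : ∀ γ, T.res 0 (L.ρ γ t) = 0 := ht 0
  have ht1 : ∀ γ, T.res 1 (L.ρ γ t) = B γ - N γ := ht 1
  obtain ⟨d, hd⟩ := T.exists_fam_eq_indicator t
  have hreg0 : ∀ γ (z : Coord k), T.fam 0 (L.familyRep γ d) z.pt - 0 ∈ regAt (κ 0) z := by
    intro γ z
    rw [hd, ht0, ite_self, sub_zero]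
    exact zero_mem _
  have hreg1 : ∀ γ (z : Coord k), T.fam 1 (L.familyRep γ d) z.pt - -N γ ∈ regAt (κ 1) z := by
    intro γ z
    rw [hd]
    split_ifs with hz
    · rw [ht1, sub_neg_eq_add, sub_add_cancel]
      exact ((hB γ).2 z hz).2
    · rw [sub_neg_eq_add, zero_add]
      refine (regAt_congr ?_).1 (zero_mem (regAt (κ 1) z))
      filter_upwards [eventually_notMem (nodeSet_finite (K := K) (k := k)) hz] with z' hz'
      exact (hN0 γ z' hz').symm
  have hdQ : d ∈ L.quotientSections := by
    refine T.mem_quotientSections_iff.2 fun γ i => coboundaries_le_cocycles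
      ⟨fun p => T.fam_mem_homFun _ _ _, ?_⟩
    fin_cases i
    · exact ⟨0, zero_mem _, hreg0 γ⟩
    · exact ⟨-N γ, neg_mem (hN γ), hreg1 γ⟩
  refine ⟨⟨d, hdQ⟩, Fin.cons 0 (Fin.cons (-N) finZeroElim), fun i γ => ?_, fun i x γ => ?_,
    fun i γ z => ?_, fun γ => ?_⟩
  · fin_cases i
    · exact zero_mem _
    · exact neg_mem (hN γ)
  · fin_cases i
    · funext z; exact (mul_zero _).symm
    · change -N (stabHom ϖ 1 x * γ) = twistAct (r 1) x (-N γ)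
      rw [hNstab]
      funext z
      exact (mul_neg _ _).symm
  · fin_cases i
    · exact hreg0 γ z
    · exact hreg1 γ z
  · change 0 - -N γ nodeCoord = ψ.1 γ
    rw [hNnode, sub_neg_eq_add, zero_add]

/-- The residues of a cohomology class may be prescribed on all components. -/
lemma exists_residueAt_eq (χ : ∀ i, TauSpace ϖ k i (-2 - κ i) (r i - 1)) :
    ∃ d, ∀ i γ, T.residueAt i d γ = (χ i).1 γ := by
  have hD : ∀ i, ∃ D : evenGroup ϖ → P1 k → Coord k → k,
      (∀ x γ, D (stabHom ϖ i x * γ) = twistFam (r i) x (D γ)) ∧ ∀ γ,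
        (∃ h : D γ ∈ cocycles k (κ i), residue k (κ i) ⟨D γ, h⟩ = (χ i).1 γ) ∧
        (∀ p ∈ nodeSet K k, D γ p = 0) ∧
        ∀ p (z : Coord k), z.pt ∈ nodeSet K k → D γ p z = 0 := by
    intro i
    refine exists_equivariant (stabHom_injective ϖ i) twistFam_mul
      (p := fun γ D => (∃ h : D ∈ cocycles k (κ i), residue k (κ i) ⟨D, h⟩ = (χ i).1 γ) ∧
        (∀ p ∈ nodeSet K k, D p = 0) ∧
        ∀ p (z : Coord k), z.pt ∈ nodeSet K k → D p z = 0) ?_ ?_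
    · rintro x γ D ⟨⟨h, hres⟩, h0, hnode⟩
      refine ⟨⟨twistFam_mem_cocycles h, ?_⟩, fun p hp => ?_, fun p z hz => ?_⟩
      · rw [residue_twistFam ⟨D, h⟩, hres, (χ i).2]
      · obtain ⟨z, rfl⟩ := Coord.exists_pt p
        rw [twistFam, P1.change_pt, h0 _ ((pt_change_mem_nodeSet_iff _).2 hp)]
        funext z
        exact mul_zero _
      · rw [twistFam, twistAct, hnode _ _ ((pt_change_mem_nodeSet_iff _).2 hz), mul_zero]
    · intro γ
      obtain ⟨D, hres, h0, hnode⟩ := exists_residue_eq (nodeSet_finite (K := K)) ((χ i).1 γ)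
      exact ⟨D.1, ⟨D.2, hres⟩, h0, hnode⟩
  choose D hDstab hD using hD
  obtain ⟨d, hd⟩ := T.exists_fam_eq (D := D) (fun i γ p => (hD i γ).1.choose.1 p) hDstab
    (fun i γ => (hD i γ).2.1) fun i γ => (hD i γ).2.2
  refine ⟨⟨d, T.mem_quotientSections_iff.2 fun γ i => ?_⟩, fun i γ => ?_⟩
  · rw [hd]
    exact (hD i γ).1.choose
  · obtain ⟨h, hres⟩ := (hD i γ).1
    rw [← hres, residueAt]
    congr 1
    exact Subtype.ext (hd i γ)

end EquivariantLineBundle.Trivialization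


/-! ### The first cohomology space -/

section ConnectingSequence

variable {k G : Type*} [Field k] [Group G] {H I : Type*} {V W : Fin 2 → Type*}
  [AddCommMonoid H] [Module k H] [AddCommGroup I] [Module k I]
  [∀ i, AddCommMonoid (V i)] [∀ i, Module k (V i)]
  [∀ i, AddCommMonoid (W i)] [∀ i, Module k (W i)]
  {ρH : Representation k G H} {ρI : Representation k G I} {ρ : ∀ i, Representation k G (V i)}
  {ρ' : ∀ i, Representation k G (W i)}

/-- The sequence `V 0 × V 1 → I → H → W 0 × W 1 → 0` is exact. -/
structure IsConnectingSequence (f : ∀ i, (ρ i).IntertwiningMap ρI) (δ : ρI.IntertwiningMap ρH)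
    (Φ : ∀ i, ρH.IntertwiningMap (ρ' i)) : Prop where
  eq_zero_iff (ψ : I) : δ ψ = 0 ↔ ∃ x : ∀ i, V i, f 0 (x 0) + f 1 (x 1) = ψ
  forall_eq_zero_iff (c : H) : (∀ i, Φ i c = 0) ↔ ∃ ψ, δ ψ = c
  exists_eq (χ : ∀ i, W i) : ∃ c, ∀ i, Φ i c = χ i

variable {f : ∀ i, (ρ i).IntertwiningMap ρI} {δ : ρI.IntertwiningMap ρH}
  {Φ : ∀ i, ρH.IntertwiningMap (ρ' i)}

namespace IsConnectingSequence

variable (h : IsConnectingSequence f δ Φ)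
include h

lemma eq_zero_iff_mem_range (i : Fin 2) [Subsingleton (V i)] {ψ : I} :
    δ ψ = 0 ↔ ∃ x, f (i + 1) x = ψ := by
  rw [h.eq_zero_iff]
  fin_cases i
  · constructor
    · rintro ⟨x, rfl⟩
      refine ⟨x 1, ?_⟩
      have : x 0 = 0 := Subsingleton.elim (α := V ((fun i => i) ⟨0, _⟩)) _ _
      rw [this, map_zero, zero_add]
      rfl
    · rintro ⟨x, rfl⟩
      refine ⟨Fin.cons 0 (Fin.cons x finZeroElim), ?_⟩
      change f 0 0 + f 1 x = _
      rw [map_zero, zero_add]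
      rfl
  · constructor
    · rintro ⟨x, rfl⟩
      refine ⟨x 0, ?_⟩
      have : x 1 = 0 := Subsingleton.elim (α := V ((fun i => i) ⟨1, _⟩)) _ _
      rw [this, map_zero, add_zero]
      rfl
    · rintro ⟨x, rfl⟩
      refine ⟨Fin.cons x (Fin.cons 0 finZeroElim), ?_⟩
      change f 0 x + f 1 0 = _
      rw [map_zero, add_zero]
      rfl

lemma map_eq_zero_iff (i : Fin 2) [Subsingleton (W (i + 1))] {c : H} :
    Φ i c = 0 ↔ ∃ ψ, δ ψ = c := by
  rw [← h.forall_eq_zero_iff]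
  refine ⟨fun hc j => ?_, fun hc => hc i⟩
  have : j = i ∨ j = i + 1 := by omega
  rcases this with rfl | rfl
  · exact hc
  · exact Subsingleton.elim _ _

lemma surjective (i : Fin 2) : Function.Surjective (Φ i) := fun χ => by
  classical
  obtain ⟨c, hc⟩ := h.exists_eq (Pi.single i χ)
  exact ⟨c, by rw [hc, Pi.single_eq_same]⟩

/-- If both `V i` vanish, then `H` is an extension of `W 0 × W 1` by `I`. -/
lemma hasShortExact_prod [∀ i, Subsingleton (V i)] :
    HasShortExact ρI ρH ((ρ' 0).prod (ρ' 1)) := by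
  obtain ⟨g, hg⟩ := exists_intertwiningMap (ρ := ρH) (σ := (ρ' 0).prod (ρ' 1))
    (R := fun c χ => χ = (Φ 0 c, Φ 1 c))
    (fun c c' χ χ' e e' => by rw [e, e', map_add, map_add]; rfl)
    (fun a c χ e => by rw [e, map_smul, map_smul]; rfl)
    (fun g c χ e => by
      rw [e, Representation.IntertwiningMap.isIntertwining,
        Representation.IntertwiningMap.isIntertwining]
      rfl)
    (fun c => ⟨_, rfl⟩)
    (fun χ e => by rw [e, map_zero, map_zero]; rfl)
  have hg' := fun c => (hg c _).1 rfl
  refine ⟨δ, g, injective_of_forall_eq_zero δ fun ψ e => ?_, fun c => ?_, fun χ => ?_⟩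
  · obtain ⟨x, rfl⟩ := (h.eq_zero_iff_mem_range 0).1 e
    rw [Subsingleton.elim x 0, map_zero]
  · rw [hg', Set.mem_range, ← h.forall_eq_zero_iff, Prod.mk_eq_zero,
      Fin.forall_fin_two]
  · obtain ⟨c, hc⟩ := h.exists_eq (Fin.cons χ.1 (Fin.cons χ.2 finZeroElim))
    exact ⟨c, (hg' c).trans (Prod.ext (hc 0) (hc 1))⟩

/-- If `V i` and `W (i + 1)` vanish, then `H` is an extension of `W i` by a quotient of `I`. -/
lemma hasShortExact (i : Fin 2) [Subsingleton (V i)] [Subsingleton (W (i + 1))] :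
    HasShortExact (quotientRep (f (i + 1)).range) ρH (ρ' i) := by
  obtain ⟨g, hg⟩ := exists_intertwiningMap (ρ := quotientRep (f (i + 1)).range) (σ := ρH)
    (R := fun v c => ∃ ψ, Submodule.Quotient.mk ψ = v ∧ δ ψ = c)
    (by
      rintro _ _ _ _ ⟨ψ, rfl, rfl⟩ ⟨ψ', rfl, rfl⟩
      exact ⟨ψ + ψ', rfl, map_add _ _ _⟩)
    (by
      rintro c _ _ ⟨ψ, rfl, rfl⟩
      exact ⟨c • ψ, rfl, map_smul _ _ _⟩)
    (by
      rintro g _ _ ⟨ψ, rfl, rfl⟩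
      exact ⟨ρI g ψ, rfl, LinearMap.congr_fun (δ.isIntertwining' g) ψ⟩)
    (fun v => by
      obtain ⟨ψ, rfl⟩ := Submodule.Quotient.mk_surjective _ v
      exact ⟨_, ψ, rfl, rfl⟩)
    (by
      rintro _ ⟨ψ, e, rfl⟩
      exact (h.eq_zero_iff_mem_range i).2 ((Submodule.Quotient.mk_eq_zero _).1 e))
  have hg' := fun ψ : I => (hg (Submodule.Quotient.mk ψ) _).1 ⟨ψ, rfl, rfl⟩
  refine ⟨g, Φ i, injective_of_forall_eq_zero g fun v e => ?_, fun c => ?_, h.surjective i⟩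
  · obtain ⟨ψ, rfl⟩ := Submodule.Quotient.mk_surjective _ v
    rw [hg'] at e
    exact (Submodule.Quotient.mk_eq_zero _).2 ((h.eq_zero_iff_mem_range i).1 e)
  · rw [h.map_eq_zero_iff i, Set.mem_range, (Submodule.Quotient.mk_surjective _).exists]
    exact exists_congr fun ψ => by rw [hg']

/-- If moreover `V (i + 1)` maps onto `I`, then `H` is isomorphic to `W i`. -/
lemma nonempty_equiv (i : Fin 2) [Subsingleton (V i)] [Subsingleton (W (i + 1))]
    (hf : Function.Surjective (f (i + 1))) : Nonempty (ρH.Equiv (ρ' i)) := by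
  refine nonempty_equiv_of_bijective (Φ i)
    ⟨injective_of_forall_eq_zero _ fun c e => ?_, h.surjective i⟩
  obtain ⟨ψ, rfl⟩ := (h.map_eq_zero_iff i).1 e
  exact (h.eq_zero_iff_mem_range i).2 (hf ψ)

end IsConnectingSequence

end ConnectingSequence

namespace EquivariantLineBundle.Trivialization

open MvPolynomial Filter Topology
open Matrix (GeneralLinearGroup)

universe v

variable {K : Type*} [Field K] [ValuativeRel K] {ϖ : Uniformizer K}
variable {k : Type*} [Field k] [Algebra 𝓀[K] k]
variable {L : EquivariantLineBundle.{v} ϖ k} {κ r : Fin 2 → ℤ} (T : L.Trivialization κ r)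

lemma familyRep_mem_quotientSections (g : evenGroup ϖ) (d : L.quotientSections) :
    L.familyRep g d.1 ∈ L.quotientSections := fun x => by
  obtain ⟨U, hU, hx, h⟩ := d.2 ((g : GL (Fin 2) K)⁻¹ • x)
  refine ⟨_, isOpen_preimage_smul (g : GL (Fin 2) K)⁻¹ hU, hx, fun y hy => ?_⟩
  have := L.isRegularAt_ρ g (h _ hy)
  rwa [map_sub] at this

lemma H1Rep_mk (g : evenGroup ϖ) (d : L.quotientSections) :
    L.H1Rep g (Submodule.Quotient.mk d) =
      Submodule.Quotient.mk ⟨L.familyRep g d.1, familyRep_mem_quotientSections g d⟩ := rfl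

lemma mk_eq_zero_iff {d : L.quotientSections} :
    (Submodule.Quotient.mk d : L.H1) = 0 ↔ d.1 ∈ L.boundaries :=
  Submodule.Quotient.mk_eq_zero _

variable [IsAlgClosed k] [TopologicalSpace K] [IsNonarchimedeanLocalField K]

lemma residueAt_familyRep (i : Fin 2) (g γ : evenGroup ϖ) (d : L.quotientSections) :
    T.residueAt i ⟨L.familyRep g d.1, familyRep_mem_quotientSections g d⟩ γ =
      T.residueAt i d (γ * g) := by
  rw [residueAt, residueAt]
  congr 1
  refine Subtype.ext ?_
  change T.fam i (L.familyRep γ (L.familyRep g d.1)) = T.fam i (L.familyRep (γ * g) d.1)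
  rw [map_mul]
  rfl

lemma residueAt_eq_zero_of_mem_boundaries {d : L.quotientSections} (hd : d.1 ∈ L.boundaries)
    (i : Fin 2) (γ : evenGroup ϖ) : T.residueAt i d γ = 0 := by
  obtain ⟨e, he⟩ := T.mem_boundaries_iff.1 hd
  exact (T.residueAt_eq_zero_iff i d γ).2 ⟨fun p => T.fam_mem_homFun _ _ _, _, T.res_mem _ _,
    he γ i⟩

/-- Restriction to the components of type `s_i`, followed by Serre duality on each of them. -/
lemma exists_residueMap (i : Fin 2) :
    ∃ Φ : L.H1Rep.IntertwiningMap (tau ϖ k i (-2 - κ i) (r i - 1)),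
      ∀ (d : L.quotientSections) γ,
        (Φ (Submodule.Quotient.mk d)).1 γ = T.residueAt i d γ := by
  let F (d : L.quotientSections) : TauSpace ϖ k i (-2 - κ i) (r i - 1) :=
    ⟨T.residueAt i d, (Representation.mem_coindV _ _ _).2 (T.residueAt_stabHom_mul i d)⟩
  obtain ⟨Φ, hΦ⟩ := exists_intertwiningMap (ρ := L.H1Rep)
    (σ := tau ϖ k i (-2 - κ i) (r i - 1))
    (R := fun (c : L.H1) (χ : TauSpace ϖ k i (-2 - κ i) (r i - 1)) =>
      ∃ d : L.quotientSections, Submodule.Quotient.mk d = c ∧ F d = χ)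
    (by
      rintro _ _ _ _ ⟨d, rfl, rfl⟩ ⟨d', rfl, rfl⟩
      exact ⟨d + d', rfl, Subtype.ext (funext fun γ => T.residueAt_add i d d' γ)⟩)
    (by
      rintro c _ _ ⟨d, rfl, rfl⟩
      exact ⟨c • d, rfl, Subtype.ext (funext fun γ => T.residueAt_smul i c d γ)⟩)
    (by
      rintro g _ _ ⟨d, rfl, rfl⟩
      exact ⟨_, (H1Rep_mk g d).symm, Subtype.ext (funext fun γ => T.residueAt_familyRep i g γ d)⟩)
    (fun c => by
      obtain ⟨d, rfl⟩ := Submodule.Quotient.mk_surjective _ c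
      exact ⟨_, d, rfl, rfl⟩)
    (by
      rintro _ ⟨d, hd, rfl⟩
      exact Subtype.ext (funext (T.residueAt_eq_zero_of_mem_boundaries (mk_eq_zero_iff.1 hd) i)))
  refine ⟨Φ, fun d γ => ?_⟩
  rw [(hΦ (Submodule.Quotient.mk d) (F d)).1 ⟨d, rfl, rfl⟩]

/-- The connecting map from the values at the double points to the first cohomology. -/
lemma exists_connectingMap (hc : IsCompatible K k κ r) :
    ∃ δ : (iwahoriInd ϖ k (r 1) (r 0)).IntertwiningMap L.H1Rep,
      ∀ ψ c, δ ψ = c ↔ ∃ d, Submodule.Quotient.mk d = c ∧ T.IsConnecting ψ d := by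
  obtain ⟨δ, hδ⟩ := exists_intertwiningMap (ρ := iwahoriInd ϖ k (r 1) (r 0)) (σ := L.H1Rep)
    (R := fun (ψ : IwahoriSpace ϖ k (r 1) (r 0)) (c : L.H1) =>
      ∃ d, Submodule.Quotient.mk d = c ∧ T.IsConnecting ψ d)
    (by
      rintro ψ ψ' _ _ ⟨d, rfl, h⟩ ⟨d', rfl, h'⟩
      exact ⟨d + d', rfl, h.add h'⟩)
    (by
      rintro c ψ _ ⟨d, rfl, h⟩
      exact ⟨c • d, rfl, h.smul c⟩)
    (by
      rintro g ψ _ ⟨d, rfl, h⟩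
      exact ⟨_, (H1Rep_mk g d).symm, h.of_translate g (fun _ => rfl) rfl⟩)
    (fun ψ => by
      obtain ⟨d, hd⟩ := T.exists_isConnecting hc ψ
      exact ⟨_, d, rfl, hd⟩)
    (by
      rintro _ ⟨d, rfl, h⟩
      exact mk_eq_zero_iff.2 h.mem_boundaries)
  exact ⟨δ, fun ψ c => (hδ ψ c).symm⟩

/-- The long exact cohomology sequence of the restriction of `L` to the normalization of `H̄`,
that is to the disjoint union of the components. -/
lemma exists_isConnectingSequence (T : L.Trivialization κ r) (hc : IsCompatible K k κ r)
    {f : ∀ i, (sigma ϖ k i (κ i) (r i)).IntertwiningMap (iwahoriInd ϖ k (r 1) (r 0))}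
    (hf : ∀ i, IsEvaluation (f i)) :
    ∃ (δ : (iwahoriInd ϖ k (r 1) (r 0)).IntertwiningMap L.H1Rep)
      (Φ : ∀ i, L.H1Rep.IntertwiningMap (tau ϖ k i (-2 - κ i) (r i - 1))),
      IsConnectingSequence f δ Φ := by
  have hfa : ∀ i φ γ, (f i φ).1 γ = symFun (φ.1 γ) nodeCoord := fun i =>
    isEvaluation_iff.1 (hf i)
  obtain ⟨δ, hδ⟩ := T.exists_connectingMap hc
  choose Φ hΦ using T.exists_residueMap
  refine ⟨δ, Φ, ⟨fun ψ => ?_, fun c => ?_, fun χ => ?_⟩⟩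
  · rw [hδ]
    constructor
    · rintro ⟨d, hd, e, h1, h2, h3, h4⟩
      obtain ⟨s, hs⟩ := T.mem_boundaries_iff.1 (mk_eq_zero_iff.1 hd)
      -- the differences `e i - s` are regular everywhere
      have hreg : ∀ i γ z, e i γ - T.res i (L.ρ γ s) ∈ regAt (κ i) z := fun i γ z => by
        have := sub_mem (hs γ i z) (h3 i γ z)
        rwa [sub_sub_sub_cancel_left] at this
      choose φ hφ using fun i => exists_sigma (hreg i) fun x γ => by
        rw [h2, T.res_stabHom_mul, twistAct_sub]
      refine ⟨Fin.cons (φ 0) (Fin.cons (-φ 1) finZeroElim), Subtype.ext (funext fun γ => ?_)⟩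
      change (f 0 (φ 0)).1 γ + (f 1 (-φ 1)).1 γ = ψ.1 γ
      have hneg : (f 1 (-φ 1)).1 γ = -(f 1 (φ 1)).1 γ := by
        rw [hfa, hfa]
        exact map_neg (eval nodeCoord.1) _
      rw [hneg, hfa, hfa, hφ, hφ, ← h4, Pi.sub_apply, Pi.sub_apply, T.res_node]
      ring
    · rintro ⟨φ, rfl⟩
      refine ⟨0, rfl, fun i γ => if i = 0 then symFun ((φ i).1 γ) else -symFun ((φ i).1 γ), ?_⟩
      refine ⟨fun i γ => ?_, fun i x γ => ?_, fun i γ z => ?_, fun γ => ?_⟩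
      · change ite _ _ _ ∈ _
        split_ifs
        · exact symFun_mem_homFun _
        · exact neg_mem (symFun_mem_homFun _)
      · change ite _ _ _ = twistAct (r i) x (ite _ _ _)
        split_ifs
        · exact symFun_stabHom_mul _ _ _
        · rw [symFun_stabHom_mul]
          funext z
          exact (mul_neg _ _).symm
      · rw [Submodule.coe_zero, map_zero, map_zero, Pi.zero_apply, zero_sub]
        refine neg_mem ?_
        change ite _ _ _ ∈ _
        split_ifs
        · exact symFun_mem_regAt _ _
        · exact neg_mem (symFun_mem_regAt _ _)
      · change symFun ((φ 0).1 γ) nodeCoord - -symFun ((φ 1).1 γ) nodeCoord =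
          (f 0 (φ 0)).1 γ + (f 1 (φ 1)).1 γ
        rw [hfa, hfa, sub_neg_eq_add]
  · obtain ⟨d, rfl⟩ := Submodule.Quotient.mk_surjective _ c
    constructor
    · intro h
      obtain ⟨ψ, hψ⟩ := T.exists_isConnecting_of_residueAt_eq_zero hc (d := d) fun i γ => by
        rw [← hΦ, h i]
        rfl
      exact ⟨ψ, (hδ _ _).2 ⟨d, rfl, hψ⟩⟩
    · rintro ⟨ψ, hψ⟩ i
      obtain ⟨d', hd', h⟩ := (hδ _ _).1 hψ
      rw [← hd']
      refine Subtype.ext (funext fun γ => ?_)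
      rw [hΦ, h.residueAt_eq_zero]
      rfl
  · obtain ⟨d, hd⟩ := T.exists_residueAt_eq χ
    refine ⟨Submodule.Quotient.mk d, fun i => Subtype.ext (funext fun γ => ?_)⟩
    rw [hΦ, hd]

end EquivariantLineBundle.Trivialization


/-! ### Duality -/

section LinearDuality

variable {k G : Type*} [Field k] [Group G]

/-- If `V` is the full dual of a space `D` of linear forms on `V`, and `A`, `B` are closed for the
topology defined by `D`, then the forms in `D` that vanish on `A ∩ B` are the sums of forms
in `D` that vanish on `A` and on `B`: both spaces of forms have the same annihilator in `V`. -/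
lemma exists_add_of_forall_inf {V : Type*} [AddCommGroup V] [Module k V]
    {D : Submodule k (Module.Dual k V)} {A B : Submodule k V}
    (hD : ∀ l : Module.Dual k D, ∃ v, ∀ φ : D, l φ = φ.1 v)
    (hA : ∀ v, (∀ φ ∈ D, (∀ a ∈ A, φ a = 0) → φ v = 0) → v ∈ A)
    (hB : ∀ v, (∀ φ ∈ D, (∀ b ∈ B, φ b = 0) → φ v = 0) → v ∈ B)
    {φ : Module.Dual k V} (hφ : φ ∈ D) (h : ∀ v ∈ A, v ∈ B → φ v = 0) :
    ∃ φ₁ ∈ D, ∃ φ₂ ∈ D, (∀ a ∈ A, φ₁ a = 0) ∧ (∀ b ∈ B, φ₂ b = 0) ∧ φ₁ + φ₂ = φ := by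
  let W : Subspace k D := A.dualAnnihilator.comap D.subtype ⊔ B.dualAnnihilator.comap D.subtype
  have key : ⟨φ, hφ⟩ ∈ W := by
    refine (Subspace.forall_mem_dualAnnihilator_apply_eq_zero_iff W ⟨φ, hφ⟩).1 fun l hl => ?_
    rw [Submodule.dualAnnihilator_sup_eq, Submodule.mem_inf, Submodule.mem_dualAnnihilator,
      Submodule.mem_dualAnnihilator] at hl
    obtain ⟨v, hv⟩ := hD l
    rw [hv]
    refine h v (hA v fun φ hφ hφA => ?_) (hB v fun φ hφ hφB => ?_)
    · rw [← hv ⟨φ, hφ⟩]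
      exact hl.1 _ ((Submodule.mem_dualAnnihilator _).2 hφA)
    · rw [← hv ⟨φ, hφ⟩]
      exact hl.2 _ ((Submodule.mem_dualAnnihilator _).2 hφB)
  obtain ⟨φ₁, h1, φ₂, h2, e⟩ := Submodule.mem_sup.1 key
  exact ⟨φ₁.1, φ₁.2, φ₂.1, φ₂.2, (Submodule.mem_dualAnnihilator _).1 h1,
    (Submodule.mem_dualAnnihilator _).1 h2, congrArg Subtype.val e⟩

/-- Criterion for `IsDualQuotient`: restriction of linear forms along `b : H → I` maps `D` onto the
given dual `θ` of `H`, and its kernel consists of the sums of forms vanishing on the image of `f`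
and on that of `f'`. -/
lemma isDualQuotient_of {V V' H I U : Type*} [AddCommMonoid V] [Module k V] [AddCommMonoid V']
    [Module k V'] [AddCommMonoid I] [Module k I] [AddCommMonoid H] [Module k H]
    [AddCommMonoid U] [Module k U] {ρ : Representation k G V} {ρ' : Representation k G V'}
    {ρI : Representation k G I} {ρH : Representation k G H} {θ : Representation k G U}
    {D : Subrepresentation ρI.dual} {f : ρ.IntertwiningMap ρI} {f' : ρ'.IntertwiningMap ρI}
    (b : ρH.IntertwiningMap ρI) (j : θ.IntertwiningMap ρH.dual) (hj : Function.Injective j)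
    (hmap : ∀ φ ∈ D.toSubmodule, ∃ u, ∀ s, j u s = φ (b s))
    (hsurj : ∀ u, ∃ φ ∈ D.toSubmodule, ∀ s, j u s = φ (b s))
    (hb : ∀ s, (∃ x, f x = b s) ∧ ∃ y, f' y = b s)
    (hker : ∀ φ ∈ D.toSubmodule, (∀ s, φ (b s) = 0) → ∃ φ₁ ∈ D.toSubmodule,
      ∃ φ₂ ∈ D.toSubmodule, (∀ x, φ₁ (f x) = 0) ∧ (∀ y, φ₂ (f' y) = 0) ∧ φ₁ + φ₂ = φ) :
    IsDualQuotient D f f' θ := by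
  obtain ⟨π, hπ⟩ := exists_intertwiningMap (ρ := D.toRepresentation) (σ := θ)
    (R := fun φ u => ∀ s, j u s = φ.1 (b s))
    (fun φ φ' u u' h h' s => by
      rw [map_add, LinearMap.add_apply, h, h']
      rfl)
    (fun c φ u h s => by
      rw [map_smul, LinearMap.smul_apply, h]
      rfl)
    (fun g φ u h s => by
      rw [j.isIntertwining]
      change j u (ρH g⁻¹ s) = φ.1 (ρI g⁻¹ (b s))
      rw [h, b.isIntertwining])
    (fun φ => hmap φ.1 φ.2)
    (fun u h => hj (LinearMap.ext fun s => by
      rw [h, map_zero]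
      rfl))
  have hπ' := fun φ => (hπ φ _).2 rfl
  have hπ0 : ∀ φ, π φ = 0 ↔ ∀ s, φ.1 (b s) = 0 := fun φ => by
    rw [← hπ]
    refine forall_congr' fun s => ?_
    rw [map_zero, LinearMap.zero_apply, eq_comm]
  refine ⟨π, fun u => ?_, Subrepresentation.toSubmodule_injective (le_antisymm ?_ ?_)⟩
  · obtain ⟨φ, hφ, h⟩ := hsurj u
    exact ⟨⟨φ, hφ⟩, (hπ ⟨φ, hφ⟩ u).1 h⟩
  · intro φ hφ
    obtain ⟨φ₁, h1, φ₂, h2, hf1, hf2, e⟩ := hker φ.1 φ.2 ((hπ0 φ).1 hφ)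
    exact Submodule.mem_sup.2 ⟨⟨φ₁, h1⟩, hf1, ⟨φ₂, h2⟩, hf2, Subtype.ext e⟩
  · refine sup_le (fun φ hφ => (hπ0 φ).2 fun s => ?_) fun φ hφ => (hπ0 φ).2 fun s => ?_
    · obtain ⟨x, hx⟩ := (hb s).1
      rw [← hx]
      exact hφ x
    · obtain ⟨y, hy⟩ := (hb s).2
      rw [← hy]
      exact hφ y

/-- A linear form that is continuous for the topology defined by a family of linear forms is a
linear combination of finitely many of them. -/
lemma mem_span_image_of_forall_eq_zero {V X : Type*} [AddCommGroup V] [Module k V]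
    {e : X → Module.Dual k V} {u : Module.Dual k V} {S : Set X} (hS : S.Finite)
    (h : ∀ v, (∀ x ∈ S, e x v = 0) → u v = 0) : u ∈ Submodule.span k (e '' S) := by
  have := hS.to_subtype
  rw [Set.image_eq_range]
  exact mem_span_of_iInf_ker_le_ker fun v hv => h v fun x hx => (Submodule.mem_iInf _).1 hv ⟨x, hx⟩

end LinearDuality

section IwahoriDual

/-- Evaluation of homogeneous polynomials, as a linear form. -/
noncomputable def symEval {k : Type*} [Field k] {n : ℤ} (z : Coord k) : Module.Dual k (sym k n) :=
  (MvPolynomial.aeval z.1).toLinearMap ∘ₗ (sym k n).subtype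

lemma symEval_apply {k : Type*} [Field k] {n : ℤ} (z : Coord k) (P : sym k n) :
    symEval z P = symFun P z :=
  RingHom.congr_fun (MvPolynomial.coe_aeval_eq_eval z.1) P.1

open MvPolynomial Filter Topology
open Matrix (GeneralLinearGroup)

variable {K : Type*} [Field K] [ValuativeRel K] {ϖ : Uniformizer K}
variable {k : Type*} [Field k] [Algebra 𝓀[K] k] {m m' : ℤ}

variable (ϖ k m m') in
/-- The linear form `ψ ↦ ψ(γ)` on `I(m, m')`. -/
noncomputable def evalAt (γ : evenGroup ϖ) : Module.Dual k (IwahoriSpace ϖ k m m') :=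
  LinearMap.proj γ ∘ₗ (IwahoriSpace ϖ k m m').subtype

lemma evalAt_mem (γ : evenGroup ϖ) :
    evalAt ϖ k m m' γ ∈ (iwahoriIndDual ϖ k m m').toSubmodule :=
  ⟨{γ}, Set.finite_singleton γ, fun _ h => h γ rfl⟩

/-- The topological dual of `I(m, m')` is spanned by the evaluations: it is a compact induction. -/
lemma span_evalAt : Submodule.span k (Set.range (evalAt ϖ k m m')) =
    (iwahoriIndDual ϖ k m m').toSubmodule := by
  refine le_antisymm (Submodule.span_le.2 ?_) ?_
  · rintro _ ⟨γ, rfl⟩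
    exact evalAt_mem γ
  · rintro φ ⟨S, hS, h⟩
    exact Submodule.span_mono (Set.image_subset_range _ _)
      (mem_span_image_of_forall_eq_zero (e := evalAt ϖ k m m') hS h)

/-- The representation `I(m, m')` is the full dual of its topological dual. -/
lemma exists_eq_of_dual_iwahoriIndDual
    (l : Module.Dual k (iwahoriIndDual ϖ k m m').toSubmodule) :
    ∃ ψ : IwahoriSpace ϖ k m m', ∀ φ : (iwahoriIndDual ϖ k m m').toSubmodule, l φ = φ.1 ψ := by
  have hψ : (fun γ => l ⟨evalAt ϖ k m m' γ, evalAt_mem γ⟩) ∈ IwahoriSpace ϖ k m m' := by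
    refine (Representation.mem_coindV _ _ _).2 fun x γ => ?_
    have e : (⟨evalAt ϖ k m m' (iwahoriHom ϖ x * γ), evalAt_mem _⟩ :
        (iwahoriIndDual ϖ k m m').toSubmodule) =
          iwahoriChar K k m m' x • ⟨evalAt ϖ k m m' γ, evalAt_mem γ⟩ :=
      Subtype.ext (LinearMap.ext fun ψ => ψ.2 x γ)
    rw [e, map_smul]
    rfl
  refine ⟨⟨_, hψ⟩, ?_⟩
  rintro ⟨φ, hφ⟩
  have hφ' := hφ
  rw [← span_evalAt] at hφ'
  induction hφ' using Submodule.span_induction with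
  | mem _ h =>
    obtain ⟨γ, rfl⟩ := h
    rfl
  | zero => exact map_zero l
  | add φ φ' h h' ih ih' =>
    rw [span_evalAt] at h h'
    exact (map_add l ⟨φ, h⟩ ⟨φ', h'⟩).trans (congrArg₂ (· + ·) (ih h) (ih' h'))
  | smul c φ h ih =>
    rw [span_evalAt] at h
    exact (map_smul l c ⟨φ, h⟩).trans (congrArg (c * ·) (ih h))

variable [TopologicalSpace K] [IsNonarchimedeanLocalField K] [IsAlgClosed k]
variable {κ r : Fin 2 → ℤ} {i : Fin 2}
  {f : (sigma ϖ k i (κ i) (r i)).IntertwiningMap (iwahoriInd ϖ k (r 1) (r 0))}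

lemma apply_stabHom_nodeRep (hf : IsEvaluation f) (φ : SigmaSpace ϖ k i (κ i) (r i))
    (j : Option 𝓀[K]) (γ : evenGroup ϖ) : (f φ).1 (stabHom ϖ i (nodeRep j, 1) * γ) =
      ((GeneralLinearGroup.det (red k (nodeRep j)) ^ r i : kˣ) : k) *
        symFun (φ.1 γ) (nodeVec k j) := by
  rw [isEvaluation_iff.1 hf, symFun_stabHom_mul, twistAct, change_nodeRep]

/-- The image of the evaluation map is closed in `I`. -/
lemma exists_eq_of_forall_iwahoriIndDual (hc : IsCompatible K k κ r) (hf : IsEvaluation f)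
    {ψ : IwahoriSpace ϖ k (r 1) (r 0)}
    (h : ∀ φ ∈ (iwahoriIndDual ϖ k (r 1) (r 0)).toSubmodule, (∀ x, φ (f x) = 0) → φ ψ = 0) :
    ∃ x, f x = ψ := by
  have := Fintype.ofFinite 𝓀[K]
  obtain ⟨F, hF, hstab, hnode, h0⟩ := exists_nodeFamily hc i ψ
  let E : sym k (κ i) →ₗ[k] Option 𝓀[K] → k := LinearMap.pi fun j => symEval (nodeVec k j)
  have hE : ∀ γ, (fun j => F γ (nodeVec k j)) ∈ LinearMap.range E := by
    intro γ
    by_contra hγ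
    -- a linear relation between the values at the double points of a component that holds
    -- on the image of the evaluation map but not for `ψ`
    obtain ⟨l, hl, hlE⟩ := Submodule.exists_le_ker_of_notMem hγ
    let B : IwahoriSpace ϖ k (r 1) (r 0) →ₗ[k] Option 𝓀[K] → k := LinearMap.pi fun j =>
      ((GeneralLinearGroup.det (red k (nodeRep j)) ^ r i : kˣ) : k)⁻¹ •
        evalAt ϖ k (r 1) (r 0) (stabHom ϖ i (nodeRep j, 1) * γ)
    have hB : ∀ ψ' j, B ψ' j = ((GeneralLinearGroup.det (red k (nodeRep j)) ^ r i : kˣ) : k)⁻¹ *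
      ψ'.1 (stabHom ϖ i (nodeRep j, 1) * γ) := fun ψ' j => rfl
    have hBψ : B ψ = fun j => F γ (nodeVec k j) := funext fun j => by
      rw [hB, ← hnode, hstab, twistAct, change_nodeRep, inv_mul_cancel_left₀ (Units.ne_zero _)]
    have hBf : ∀ x, B (f x) = E (x.1 γ) := fun x => funext fun j => by
      rw [hB, apply_stabHom_nodeRep hf, inv_mul_cancel_left₀ (Units.ne_zero _)]
      exact (symEval_apply _ _).symm
    have hD : l ∘ₗ B ∈ (iwahoriIndDual ϖ k (r 1) (r 0)).toSubmodule := by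
      refine ⟨Set.range fun j => stabHom ϖ i (nodeRep j, 1) * γ, Set.finite_range _, ?_⟩
      intro ψ' hψ'
      have : B ψ' = 0 := funext fun j => by
        rw [hB, hψ' _ ⟨j, rfl⟩, mul_zero]
        rfl
      rw [LinearMap.comp_apply, this, map_zero]
    have hDf : ∀ x, (l ∘ₗ B) (f x) = 0 := fun x => by
      rw [LinearMap.comp_apply, hBf]
      exact hlE ⟨_, rfl⟩
    have := h _ hD hDf
    rw [LinearMap.comp_apply, hBψ] at this
    exact hl this
  obtain ⟨φ, hφ, hφF⟩ := exists_equivariant (stabHom_injective ϖ i)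
    (act := fun x P => inflate (K := K) (detTwist (r i) (symRep k (κ i))) x P)
    (p := fun γ P => ∀ z, z.pt ∈ nodeSet K k → symFun P z = F γ z)
    (fun x y P => by rw [map_mul]; rfl)
    (fun x γ P hP z hz => by
      rw [symFun_inflate, hstab, twistAct, twistAct, hP _ ((pt_change_mem_nodeSet_iff _).2 hz)])
    (fun γ => by
      obtain ⟨P, hP⟩ := hE γ
      refine ⟨P, fun z hz => ?_⟩
      obtain ⟨j, hj⟩ := hz
      obtain ⟨c, e⟩ := Coord.pt_eq_iff.1 hj.symm
      rw [symFun_mem_homFun _ _ _ _ e, hF γ _ _ _ e]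
      rw [← symEval_apply, ← congrFun hP j]
      rfl)
  refine ⟨⟨φ, hφ⟩, Subtype.ext (funext fun γ => ?_)⟩
  exact (hf ⟨φ, hφ⟩ γ).trans ((hφF γ _ nodeCoord_pt_mem).trans (hnode γ))

/-- A family of forms of degree at most `q` is determined on a component by the values of its image
in `I` that correspond to the double points of that component. -/
lemma apply_eq_zero_of_forall_nodeRep (hf : IsEvaluation f) (hn : κ i ≤ Nat.card 𝓀[K])
    {φ : SigmaSpace ϖ k i (κ i) (r i)} {γ : evenGroup ϖ}
    (h : ∀ j : Option 𝓀[K], (f φ).1 (stabHom ϖ i (nodeRep j, 1) * γ) = 0) : φ.1 γ = 0 := by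
  have hz : ∀ z : Coord k, z.pt ∈ nodeSet K k → eval z.1 (φ.1 γ).1 = 0 := by
    rintro z ⟨j, hj⟩
    refine (eq_zero_iff_of_mem_homFun (symFun_mem_homFun (φ.1 γ)) hj).1 ?_
    have := h j
    rw [apply_stabHom_nodeRep hf] at this
    exact (mul_eq_zero.1 this).resolve_left (Units.ne_zero _)
  obtain ⟨P', hP', e⟩ := eq_dicksonForm_mul (φ.1 γ).2 hz
  rcases mem_sym_cases hP' with ⟨a, ha, -⟩ | ⟨-, rfl⟩
  · omega
  · exact Subtype.ext (by rw [e, mul_zero]; rfl)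

end IwahoriDual


section DualFibreProduct

variable {k G : Type*} [Field k] [Group G] {H I : Type*} {V : Fin 2 → Type*}
  [AddCommGroup H] [Module k H] [AddCommGroup I] [Module k I]
  [∀ i, AddCommMonoid (V i)] [∀ i, Module k (V i)]
  {ρH : Representation k G H} {ρI : Representation k G I} {ρ : ∀ i, Representation k G (V i)}
  {a : ∀ i, ρH.IntertwiningMap (ρ i)} {f : ∀ i, (ρ i).IntertwiningMap ρI}

/-- For full duals, the forms vanishing on an intersection of subspaces are sums of forms vanishing
on the two subspaces, without any condition of closedness. -/
lemma IsFibreProduct.isDualQuotient_top (h : IsFibreProduct a f)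
    (hf : ∀ i, Function.Injective (f i)) : IsDualQuotient ⊤ (f 0) (f 1) ρH.dual := by
  have hb : Function.Injective ((f 0).comp (a 0)).toLinearMap := fun s s' e =>
    h.ext 0 (hf 0 e) (hf 1 ((h.comm s).symm.trans (Eq.trans e (h.comm s'))))
  refine isDualQuotient_of ((f 0).comp (a 0)) (.id _) (fun _ _ e => e)
    (fun φ _ => ⟨φ ∘ₗ ((f 0).comp (a 0)).toLinearMap, fun s => rfl⟩) (fun u => ?_)
    (fun s => ⟨⟨_, rfl⟩, ⟨_, (h.comm s).symm⟩⟩) (fun φ _ hφ => ?_)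
  · obtain ⟨φ, rfl⟩ := LinearMap.dualMap_surjective_of_injective hb u
    exact ⟨φ, trivial, fun s => rfl⟩
  · have key : φ ∈ ((f 0).range.toSubmodule ⊓ (f 1).range.toSubmodule).dualAnnihilator := by
      refine (Submodule.mem_dualAnnihilator _).2 ?_
      rintro _ ⟨⟨x, rfl⟩, ⟨y, hy⟩⟩
      obtain ⟨s, hs, -⟩ := h.exists_eq' 0 x y hy.symm
      have := hφ s
      rw [Representation.IntertwiningMap.comp_apply, hs] at this
      exact this
    rw [Subspace.dualAnnihilator_inf_eq] at key
    obtain ⟨φ₁, h1, φ₂, h2, e⟩ := Submodule.mem_sup.1 key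
    exact ⟨φ₁, trivial, φ₂, trivial, fun x => (Submodule.mem_dualAnnihilator _).1 h1 _ ⟨x, rfl⟩,
      fun y => (Submodule.mem_dualAnnihilator _).1 h2 _ ⟨y, rfl⟩, e⟩

end DualFibreProduct

namespace EquivariantLineBundle.Trivialization

open MvPolynomial Filter Topology
open Matrix (GeneralLinearGroup)

universe v

variable {K : Type*} [Field K] [ValuativeRel K] {ϖ : Uniformizer K}
variable {k : Type*} [Field k] [Algebra 𝓀[K] k] {L : EquivariantLineBundle.{v} ϖ k}
variable [IsAlgClosed k] [TopologicalSpace K] [IsNonarchimedeanLocalField K]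
variable {κ r : Fin 2 → ℤ} (T : L.Trivialization κ r)

/-- The topological dual of the space of global sections: in small degrees, the topology of `H⁰` is
induced by that of `I`, since the value of a section at a point is determined by its values
at the double points of a component through that point. -/
lemma isDualQuotient_H0Dual (T : L.Trivialization κ r) (hc : IsCompatible K k κ r)
    {f : ∀ i, (sigma ϖ k i (κ i) (r i)).IntertwiningMap (iwahoriInd ϖ k (r 1) (r 0))}
    (hf : ∀ i, IsEvaluation (f i)) (hn : ∀ i, κ i ≤ Nat.card 𝓀[K]) :
    IsDualQuotient (iwahoriIndDual ϖ k (r 1) (r 0)) (f 0) (f 1) L.H0Dual.toRepresentation := by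
  obtain ⟨a, ha, h⟩ := T.exists_isFibreProduct hf
  let j : L.H0Dual.toRepresentation.IntertwiningMap L.H0Rep.dual :=
    ⟨L.H0Dual.toSubmodule.subtype, fun g => rfl⟩
  have hres : ∀ (γ : evenGroup ϖ) (i : Fin 2) (z : Coord k) (s : L.H0),
      s.1 (chart ϖ (γ * toVertex ϖ i) z.pt) = 0 ↔ symFun ((a i s).1 γ⁻¹) z = 0 := by
    intro γ i z s
    rw [ha, show (0 : k) = T.res i (L.ρ γ⁻¹ 0) z by rw [map_zero, map_zero]; rfl, T.res_ρ_eq_iff]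
    rfl
  have hb : ∀ s γ, (f 0 (a 0 s)).1 γ = symFun ((a 0 s).1 γ) nodeCoord := fun s =>
    isEvaluation_iff.1 (hf 0) _
  refine isDualQuotient_of ((f 0).comp (a 0)) j Subtype.val_injective ?_ ?_
    (fun s => ⟨⟨_, rfl⟩, ⟨_, (h.comm s).symm⟩⟩) ?_
  · rintro φ ⟨S, hS, hφ⟩
    refine ⟨⟨φ ∘ₗ ((f 0).comp (a 0)).toLinearMap,
      (fun γ : evenGroup ϖ => chart ϖ ((γ⁻¹ : evenGroup ϖ) * toVertex ϖ 0)
        (nodeCoord (k := k)).pt) '' S,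
      hS.image _, fun s hs => hφ _ fun γ hγ => ?_⟩, fun s => rfl⟩
    have := (hres γ⁻¹ 0 nodeCoord s).1 (hs _ ⟨γ, hγ, rfl⟩)
    rw [inv_inv] at this
    exact (hb s γ).trans this
  · rintro ⟨u, S, hS, hu⟩
    choose γ i z hx using exists_chart_eq (ϖ := ϖ) (k := k)
    have := Fintype.ofFinite 𝓀[K]
    let S' : Set (evenGroup ϖ) := Set.image2
      (fun x (j : Option 𝓀[K]) => stabHom ϖ (i x) (nodeRep j, 1) * (γ x)⁻¹) S Set.univ
    -- A section whose image in `I` vanishes at the elements of `S'` vanishes on a component through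
    -- each point of `S`, so that `u` only depends on finitely many values of the image in `I`.
    have key := mem_span_image_of_forall_eq_zero
      (e := fun γ => evalAt ϖ k (r 1) (r 0) γ ∘ₗ ((f 0).comp (a 0)).toLinearMap) (u := u) (S := S')
      (hS.image2 _ Set.finite_univ) (fun s hs => hu s fun x hx' => by
        rw [← hx x, hres, apply_eq_zero_of_forall_nodeRep (hf (i x)) (hn (i x)) fun j => ?_]
        · exact map_zero _
        · have hcomm : f (i x) (a (i x) s) = f 0 (a 0 s) := by
            rcases Fin.exists_fin_two.1 ⟨i x, rfl⟩ with e | e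
            · rw [e]
            · rw [e]
              exact (h.comm s).symm
          rw [hcomm]
          exact hs _ ⟨x, hx', j, trivial, rfl⟩)
    have e : (fun γ => evalAt ϖ k (r 1) (r 0) γ ∘ₗ ((f 0).comp (a 0)).toLinearMap) '' S' =
        ((f 0).comp (a 0)).toLinearMap.dualMap '' (evalAt ϖ k (r 1) (r 0) '' S') := by
      rw [Set.image_image]
      rfl
    rw [e, ← Submodule.map_span] at key
    obtain ⟨φ, hφ, rfl⟩ := key
    refine ⟨φ, ?_, fun s => rfl⟩
    rw [← span_evalAt]
    exact Submodule.span_mono (Set.image_subset_range _ _) hφ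
  · intro φ hφ h0
    obtain ⟨φ₁, h1, φ₂, h2, hA, hB, e⟩ := exists_add_of_forall_inf
      (A := (f 0).range.toSubmodule) (B := (f 1).range.toSubmodule)
      exists_eq_of_dual_iwahoriIndDual
      (fun ψ hψ => exists_eq_of_forall_iwahoriIndDual hc (hf 0) fun φ hφ hφ0 =>
        hψ φ hφ (by rintro _ ⟨x, rfl⟩; exact hφ0 x))
      (fun ψ hψ => exists_eq_of_forall_iwahoriIndDual hc (hf 1) fun φ hφ hφ0 =>
        hψ φ hφ (by rintro _ ⟨x, rfl⟩; exact hφ0 x)) hφ (by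
        rintro _ ⟨x, rfl⟩ ⟨y, hy⟩
        obtain ⟨s, hs, -⟩ := h.exists_eq' 0 x y hy.symm
        have := h0 s
        rw [Representation.IntertwiningMap.comp_apply, hs] at this
        exact this)
    exact ⟨φ₁, h1, φ₂, h2, fun x => hA _ ⟨x, rfl⟩, fun y => hB _ ⟨y, rfl⟩, e⟩

end EquivariantLineBundle.Trivialization

end Drinfeld


namespace Drinfeld

/-! ### Vanishing in negative degrees, and the conclusion -/

lemma subsingleton_sym {k : Type*} [Field k] {n : ℤ} (hn : n < 0) : Subsingleton (sym k n) := by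
  obtain ⟨n, rfl⟩ := Int.eq_negSucc_of_lt_zero hn
  exact inferInstanceAs (Subsingleton (⊥ : Submodule k (MvPolynomial (Fin 2) k)))

section Vanishing

variable {K : Type*} [Field K] [ValuativeRel K] {ϖ : Uniformizer K}
variable {k : Type*} [Field k] [Algebra 𝓀[K] k] {i : Fin 2} {n r : ℤ}

lemma subsingleton_sigma (hn : n < 0) : Subsingleton (SigmaSpace ϖ k i n r) :=
  have := subsingleton_sym (k := k) hn
  inferInstance

lemma subsingleton_tau (hn : n < 0) : Subsingleton (TauSpace ϖ k i n r) :=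
  have := subsingleton_sym (k := k) hn
  inferInstance

end Vanishing

end Drinfeld

open Drinfeld in
theorem mainTheorem8 {K : Type*} [Field K] [ValuativeRel K] [TopologicalSpace K]
    [IsNonarchimedeanLocalField K] [CharZero K] (hp : ringChar 𝓀[K] ≠ 2) (ϖ : Uniformizer K)
    {k : Type*} [Field k] [Algebra 𝓀[K] k] [IsAlgClosure 𝓀[K] k]
    (q : ℤ) (hq : q = Nat.card 𝓀[K])
    (L : EquivariantLineBundle ϖ k) (κ r : Fin 2 → ℤ) (hr : r 0 = r 1 + κ 1)
    (hL : L.HasData (r 1) (κ 0) (κ 1)) :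
    ∃ f : ∀ i : Fin 2,
        (sigma ϖ k i (κ i) (r i)).IntertwiningMap (iwahoriInd ϖ k (r 1) (r 0)),
      (∀ i, IsEvaluation (f i)) ∧
      -- (1)
      ((∀ i, q + 1 ≤ κ i) →
        HasShortExact
          ((sigma ϖ k 0 (κ 0 - q - 1) (1 + r 0)).prod (sigma ϖ k 1 (κ 1 - q - 1) (1 + r 1)))
          L.H0Rep (iwahoriInd ϖ k (r 1) (r 0))) ∧
      -- (2)
      ((∀ i, 0 ≤ κ i ∧ κ i ≤ q) →
        (∀ i, Function.Injective (f i)) ∧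
        Nonempty (L.H0Rep.Equiv (imageInter (f 0) (f 1)).toRepresentation) ∧
        IsDualQuotient (iwahoriIndDual ϖ k (r 1) (r 0)) (f 0) (f 1) L.H0Dual.toRepresentation ∧
        IsDualQuotient ⊤ (f 0) (f 1) L.H0Rep.dual) ∧
      -- (3)
      (∀ i, 0 ≤ κ i → κ i ≤ q → q + 1 ≤ κ (i + 1) →
        HasShortExact (sigma ϖ k (i + 1) (κ (i + 1) - q - 1) (1 + r (i + 1)))
          L.H0Rep (sigma ϖ k i (κ i) (r i))) ∧
      -- (4)
      ((∀ i, κ i ≤ -1) →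
        HasShortExact (iwahoriInd ϖ k (r 1) (r 0)) L.H1Rep
          ((tau ϖ k 0 (-2 - κ 0) (r 0 - 1)).prod (tau ϖ k 1 (-2 - κ 1) (r 1 - 1)))) ∧
      -- (5)
      (∀ i, κ i ≤ -1 → -1 ≤ κ (i + 1) → κ (i + 1) ≤ q →
        Function.Injective (f (i + 1)) ∧
        HasShortExact (quotientRep (f (i + 1)).range) L.H1Rep
          (tau ϖ k i (-2 - κ i) (r i - 1))) ∧
      -- (6)
      (∀ i, κ i ≤ -1 → q + 1 ≤ κ (i + 1) →
        Nonempty (L.H0Rep.Equiv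
          (sigma ϖ k (i + 1) (κ (i + 1) - q - 1) (1 + r (i + 1)))) ∧
        Nonempty (L.H1Rep.Equiv (tau ϖ k i (-2 - κ i) (r i - 1)))) := by
  have : IsAlgClosed k := IsAlgClosure.isAlgClosed 𝓀[K]
  obtain ⟨T⟩ := L.exists_trivialization hr hL
  have hc : IsCompatible K k κ r := ⟨hr, T.weight⟩
  choose f hf using exists_isEvaluation (ϖ := ϖ) hc
  obtain ⟨a, -, hfib⟩ := T.exists_isFibreProduct hf
  obtain ⟨δ, Φ, hseq⟩ := T.exists_isConnectingSequence hc hf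
  choose j hj hex using fun i => exists_kernel_of_isEvaluation (hf i)
  subst hq
  have hinj : ∀ i, κ i ≤ Nat.card 𝓀[K] → Function.Injective (f i) := fun i =>
    injective_of_isEvaluation (hf i)
  have hsurj : ∀ i, Nat.card 𝓀[K] + 1 ≤ κ i → Function.Surjective (f i) := fun i hi =>
    surjective_of_isEvaluation hc (hf i) (by omega)
  refine ⟨f, hf, fun h => ?_, fun h => ⟨fun i => hinj i (h i).2, ?_, ?_, ?_⟩, fun i h1 h2 h3 => ?_,
    fun h => ?_, fun i h1 h2 h3 => ⟨hinj _ h3, ?_⟩, fun i h1 h2 => ⟨?_, ?_⟩⟩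
  · exact hfib.hasShortExact_prod hj hex fun i => hsurj i (h i)
  · exact hfib.nonempty_equiv_imageInter fun i => hinj i (h i).2
  · exact T.isDualQuotient_H0Dual hc hf fun i => (h i).2
  · exact hfib.isDualQuotient_top fun i => hinj i (h i).2
  · exact hfib.hasShortExact i (hj _) (hex _) (hsurj _ h3)
  -- In negative degrees `σ` vanishes, so that `V i = 0` in the connecting sequence.
  · have := fun i => subsingleton_sigma (ϖ := ϖ) (k := k) (i := i) (r := r i)
      (lt_of_le_of_lt (h i) (by omega))
    exact hseq.hasShortExact_prod
  · have := subsingleton_sigma (ϖ := ϖ) (k := k) (i := i) (r := r i)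
      (lt_of_le_of_lt h1 (by omega))
    have := subsingleton_tau (ϖ := ϖ) (k := k) (i := i + 1) (n := -2 - κ (i + 1))
      (r := r (i + 1) - 1) (by omega)
    exact hseq.hasShortExact i
  · have := subsingleton_sigma (ϖ := ϖ) (k := k) (i := i) (r := r i)
      (lt_of_le_of_lt h1 (by omega))
    obtain ⟨g, g', hg, hgg', -⟩ := hfib.hasShortExact i (hj _) (hex _) (hsurj _ h2)
    obtain ⟨e⟩ := nonempty_equiv_of_bijective g
      ⟨hg, fun s => (hgg' s).1 (Subsingleton.elim _ _)⟩
    exact ⟨e.symm⟩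
  · have := subsingleton_sigma (ϖ := ϖ) (k := k) (i := i) (r := r i)
      (lt_of_le_of_lt h1 (by omega))
    have := subsingleton_tau (ϖ := ϖ) (k := k) (i := i + 1) (n := -2 - κ (i + 1))
      (r := r (i + 1) - 1) (by omega)
    exact hseq.nonempty_equiv i (hsurj _ h2)
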